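/- Let $(X,H,\mu)$ be an abstract Wiener space with inclusion $H\hookrightarrow X$, let $H_\infty\subset H$ be a countable dense set, and let $\varepsilon>0$. For $1<p<\infty$ and $\alpha>0$ let $D^p_\alpha=(I-L)^{-\alpha/2}L^p(\mu)$ with norm $\|f\|_{p,\alpha}=\|(I-L)^{\alpha/2}f\|_{L^p}$, where $L$ is the Ornstein–Uhlenbeck operator; let $D^{\infty-}_\alpha=\bigcap_{1<p<\infty}D^p_\alpha$. The capacity of an open set $O$ is $C^p_\alpha(O)=\inf\{\|U\|_{p,\alpha}: U\in D^p_\alpha,\ U\ge 1\ \mu\text{-a.e. on }O\}$, and $C^p_\alpha(A)=\inf\{C^p_\alpha(O): O\supset A\text{ open}\}$ for arbitrary $A\subset X$. Let $F\in D^{\infty-}_{2+\varepsilon}$ be real-valued and $H$-convex, i.e. for all $h,k\in H$ and $\alpha\in[0,1]$, $F(\omega+\alpha h+(1-\alpha)k)\le\alpha F(\omega+h)+(1-\alpha)F(\omega+k)$ for $\mu$-a.e. $\omega$. Denote again by $F,\nabla F,\nabla^2F$ any fixed redefinitions (versions equal $\mu$-a.e. to $F$ and its first two Malliavin derivatives)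 that are $(p,\varepsilon)$-quasi-continuous for all $1<p<\infty$, i.e. continuous on the complement of open sets of arbitrarily small $C^p_\varepsilon$-capacity. For $u\in\mathbb R$ let $A_u=F^{-1}(-\infty,u]$ with boundary hypersurface $\partial A_u=F^{-1}(u)$, and let $\mathrm{Sm}(F)$ be the set of $x\in X$ such that $\nabla F(x)\ne0$ and for all $h_1,h_2\in H_\infty$ there is a sequence $\varepsilon_n\downarrow0$ along which $$F(x+h_1)+\varepsilon_n\langle\nabla F(x+h_1),h_2\rangle_H+\varepsilon_n^2\langle\nabla^2F(x+h_1),h_2\otimes h_2\rangle_{H\otimes H}-F(x+h_1+\varepsilon_nh_2)\to0 .$$ Put $\eta_x=\nabla F(x)/\|\nabla F(x)\|_H$. Then there is a set $N\subset X$ with $C^p_\varepsilon(N)=0$ for all $1<p<\infty$ such that for every $u\in\mathbb R$ and every $r>0$, writing $S_u=(\mathrm{Sm}(F)\cap\partial A_u)\setminus N$, the map $x\mapsto x+r\eta_x$ is one-to-one on $S_u$, and moreover, for each $x\in S_u$, $$\{y\in S_u:\ y\ne x,\ y-(x+r\eta_x)\in H,\ \|y-(x+r\eta_x)\|_H\le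 r\}=\emptyset .$$ -/

import Mathlib

open MeasureTheory ProbabilityTheory Set Filter Topology
open scoped ENNReal NNReal TensorProduct

noncomputable section

namespace WienerTube

section AbstractWienerSpace

variable {X H : Type*} [NormedAddCommGroup X] [NormedSpace ℝ X]
  [NormedAddCommGroup H] [InnerProductSpace ℝ H] [CompleteSpace H]

/-- The element of `H` that represents the restriction to `H` of a continuous linear functional
on `X`, i.e. the image of `ℓ` under the transpose `X* → H* = H` of `ι : H → X`. -/
def dualVec (ι : H →L[ℝ] X) (ℓ : StrongDual ℝ X) : H :=
  (InnerProductSpace.toDual ℝ H).symm (ℓ.comp ι)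

/-- `(X, H, μ)` is an abstract Wiener space: `H` is embedded continuously and densely in `X` by
`ι`, and `μ` is the standard cylindrical Gaussian measure of `H`, i.e. every continuous linear
functional `ℓ` on `X` is centred Gaussian with variance `‖ℓ|_H‖²`. -/
structure IsAbstractWienerSpace [MeasurableSpace X] (ι : H →L[ℝ] X) (μ : Measure X) : Prop where
  injective : Function.Injective ι
  dense : DenseRange ι
  gaussian : ∀ ℓ : StrongDual ℝ X, μ.map ℓ = gaussianReal 0 (‖dualVec ι ℓ‖₊ ^ 2)

end AbstractWienerSpace

section Sobolev

variable {X : Type*} [NormedAddCommGroup X] [NormedSpace ℝ X] [MeasurableSpace X]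

/-- The Ornstein–Uhlenbeck semigroup `P_t = exp(t L)`, by Mehler's formula. -/
def ouSemigroup (μ : Measure X) (t : ℝ) (g : X → ℝ) (x : X) : ℝ :=
  ∫ y, g (Real.exp (-t) • x + √(1 - Real.exp (-2 * t)) • y) ∂μ

/-- The operator `(I - L)^{-α/2}`, for `α > 0`, as the Gamma-type integral
`Γ(α/2)⁻¹ ∫₀^∞ t^{α/2 - 1} e^{-t} P_t dt`. -/
def besselPotential (μ : Measure X) (α : ℝ) (g : X → ℝ) (x : X) : ℝ :=
  (Real.Gamma (α / 2))⁻¹ *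
    ∫ t in Ioi (0 : ℝ), t ^ (α / 2 - 1) * Real.exp (-t) * ouSemigroup μ t g x

/-- `f ∈ D^p_α`: `f ∈ L^p` and `(I - L)^{α/2} f ∈ L^p`. -/
def MemD (μ : Measure X) (p : ℝ≥0∞) (α : ℝ) (f : X → ℝ) : Prop :=
  MemLp f p μ ∧ ∃ g : X → ℝ, MemLp g p μ ∧ f =ᵐ[μ] besselPotential μ α g

/-- `f ∈ D^{∞-}_α = ⋂_{1 < p < ∞} D^p_α`. -/
def MemDInf (μ : Measure X) (α : ℝ) (f : X → ℝ) : Prop :=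
  ∀ p : ℝ≥0∞, 1 < p → p < ⊤ → MemD μ p α f

/-- `‖f‖_{p,α} = ‖(I - L)^{α/2} f‖_{L^p}`. The function `g = (I - L)^{α/2} f` is unique almost
everywhere, so the infimum is over a single value (it is `∞` if there is no such `g`). -/
def sobolevNorm (μ : Measure X) (p : ℝ≥0∞) (α : ℝ) (f : X → ℝ) : ℝ≥0∞ :=
  ⨅ (g : X → ℝ) (_ : MemLp g p μ) (_ : f =ᵐ[μ] besselPotential μ α g), eLpNorm g p μ

/-- The `(p, α)`-capacity of an open set. -/
def openCapacity (μ : Measure X) (p : ℝ≥0∞) (α : ℝ) (O : Set X) : ℝ≥0∞ :=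
  ⨅ (U : X → ℝ) (_ : MemD μ p α U) (_ : ∀ᵐ x ∂μ, x ∈ O → 1 ≤ U x), sobolevNorm μ p α U

/-- The `(p, α)`-capacity of an arbitrary set. -/
def capacity (μ : Measure X) (p : ℝ≥0∞) (α : ℝ) (A : Set X) : ℝ≥0∞ :=
  ⨅ (O : Set X) (_ : IsOpen O) (_ : A ⊆ O), openCapacity μ p α O

/-- `(p, α)`-quasi-continuity: continuity of the restriction to the complement of open sets of
arbitrarily small `(p, α)`-capacity. -/
def QuasiContinuous {E : Type*} [TopologicalSpace E] (μ : Measure X) (p : ℝ≥0∞) (α : ℝ)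
    (f : X → E) : Prop :=
  ∀ δ : ℝ≥0∞, 0 < δ → ∃ O : Set X, IsOpen O ∧ capacity μ p α O < δ ∧ ContinuousOn f Oᶜ

end Sobolev

section Derivatives

/-- A smooth cylindrical functional `x ↦ f (ℓ₁ x, …, ℓₙ x)` with `f ∈ C_b^∞(ℝⁿ)`. -/
structure SmoothCyl (X : Type*) [NormedAddCommGroup X] [NormedSpace ℝ X] where
  n : ℕ
  ℓ : Fin n → StrongDual ℝ X
  f : (Fin n → ℝ) → ℝ
  smooth : ContDiff ℝ ((⊤ : ℕ∞) : WithTop ℕ∞) f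
  bounded : ∀ k : ℕ, ∃ C : ℝ, ∀ v, ‖iteratedFDeriv ℝ k f v‖ ≤ C

variable {X H : Type*} [NormedAddCommGroup X] [NormedSpace ℝ X]
  [NormedAddCommGroup H] [InnerProductSpace ℝ H] [CompleteSpace H]

/-- The Hilbert space tensor product `H ⊗ H` (the space of Hilbert–Schmidt operators). -/
abbrev HTensor (H : Type*) [NormedAddCommGroup H] [InnerProductSpace ℝ H] : Type _ :=
  UniformSpace.Completion (H ⊗[ℝ] H)

/-- `h ⊗ k` as an element of the Hilbert space tensor product. -/
def tmulH (h k : H) : HTensor H := ((h ⊗ₜ[ℝ] k : H ⊗[ℝ] H) : HTensor H)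

namespace SmoothCyl

/-- The value `f (ℓ₁ x, …, ℓₙ x)`. -/
def eval (S : SmoothCyl X) (x : X) : ℝ := S.f fun i => S.ℓ i x

/-- `DF = ∑ᵢ ∂ᵢf (ℓ₁ x, …, ℓₙ x) hᵢ`, where `hᵢ ∈ H` represents `ℓᵢ`. -/
def grad (ι : H →L[ℝ] X) (S : SmoothCyl X) (x : X) : H :=
  ∑ i, fderiv ℝ S.f (fun j => S.ℓ j x) (Pi.single i 1) • dualVec ι (S.ℓ i)

/-- `D²F = ∑ᵢⱼ ∂ᵢ∂ⱼf (ℓ₁ x, …, ℓₙ x) hᵢ ⊗ hⱼ`. -/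
def hess (ι : H →L[ℝ] X) (S : SmoothCyl X) (x : X) : HTensor H :=
  ∑ i, ∑ j, iteratedFDeriv ℝ 2 S.f (fun k => S.ℓ k x) ![Pi.single i 1, Pi.single j 1] •
    tmulH (dualVec ι (S.ℓ i)) (dualVec ι (S.ℓ j))

end SmoothCyl

variable [MeasurableSpace X]

/-- `DF = G` and `D²F = K` in the `L^p` sense: `(F, G, K)` is in the closure in `L^p` of
`(D⁰, D¹, D²)` on smooth cylindrical functionals. -/
structure HasMalliavinDerivs (ι : H →L[ℝ] X) (μ : Measure X) (p : ℝ≥0∞)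
    (F : X → ℝ) (G : X → H) (K : X → HTensor H) : Prop where
  memLp : MemLp F p μ
  memLp_grad : MemLp G p μ
  memLp_hess : MemLp K p μ
  approx : ∃ S : ℕ → SmoothCyl X,
    Tendsto (fun m => eLpNorm (fun x => (S m).eval x - F x) p μ) atTop (𝓝 0) ∧
    Tendsto (fun m => eLpNorm (fun x => (S m).grad ι x - G x) p μ) atTop (𝓝 0) ∧
    Tendsto (fun m => eLpNorm (fun x => (S m).hess ι x - K x) p μ) atTop (𝓝 0)

/-- `Fs`, `G`, `K` are redefinitions of `F`, `∇F`, `∇²F` that are `(p, ε)`-quasi-continuous for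
all `1 < p < ∞`. -/
structure IsRedefinition (ι : H →L[ℝ] X) (μ : Measure X) (ε : ℝ)
    (F Fs : X → ℝ) (G : X → H) (K : X → HTensor H) : Prop where
  ae_eq : Fs =ᵐ[μ] F
  derivs : ∀ p : ℝ≥0∞, 1 < p → p < ⊤ → HasMalliavinDerivs ι μ p F G K
  quasi : ∀ p : ℝ≥0∞, 1 < p → p < ⊤ → QuasiContinuous μ p ε Fs
  quasi_grad : ∀ p : ℝ≥0∞, 1 < p → p < ⊤ → QuasiContinuous μ p ε G
  quasi_hess : ∀ p : ℝ≥0∞, 1 < p → p < ⊤ → QuasiContinuous μ p ε K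

/-- `H`-convexity of a Wiener functional; the exceptional null set may depend on `h, k, α`. -/
def HConvex (ι : H →L[ℝ] X) (μ : Measure X) (F : X → ℝ) : Prop :=
  AEMeasurable F μ ∧ ∀ h k : H, ∀ α ∈ Icc (0 : ℝ) 1, ∀ᵐ ω ∂μ,
    F (ω + ι (α • h + (1 - α) • k)) ≤ α * F (ω + ι h) + (1 - α) * F (ω + ι k)

end Derivatives

section Tube

variable {X H : Type*} [NormedAddCommGroup X] [NormedSpace ℝ X]
  [NormedAddCommGroup H] [InnerProductSpace ℝ H]

/-- The difference `T₂(F, x, h₁, h₂, ε)` between the second-order expansion of `F` at `x + h₁`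
in the direction `h₂` and the value `F (x + h₁ + ε h₂)`. -/
def taylorTwo (ι : H →L[ℝ] X) (F : X → ℝ) (G : X → H) (K : X → HTensor H)
    (x : X) (h₁ h₂ : H) (ε : ℝ) : ℝ :=
  F (x + ι h₁) + ε * inner ℝ (G (x + ι h₁)) h₂ + ε ^ 2 * inner ℝ (K (x + ι h₁)) (tmulH h₂ h₂)
    - F (x + ι h₁ + ι (ε • h₂))

/-- The set `Sm(F)` of smooth points, for the functional `F` with gradient `G` and second
derivative `K`, and a countable dense set `D` of directions. -/
def smoothPoints (ι : H →L[ℝ] X) (D : Set H) (F : X → ℝ) (G : X → H) (K : X → HTensor H) :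
    Set X :=
  {x | G x ≠ 0 ∧ ∀ h₁ ∈ D, ∀ h₂ ∈ D, ∃ e : ℕ → ℝ, (∀ n, 0 < e n) ∧ Antitone e ∧
    Tendsto e atTop (𝓝 0) ∧
    Tendsto (fun n => taylorTwo ι F G K x h₁ h₂ (e n)) atTop (𝓝 0)}

/-- The hypersurface `∂A_u = F⁻¹(u)` that bounds `A_u = F⁻¹(-∞, u]`. -/
def bdry (F : X → ℝ) (u : ℝ) : Set X := {x | F x = u}

/-- The unit normal field `η = ∇F / ‖∇F‖_H`. -/
def unitNormal (G : X → H) (x : X) : H := ‖G x‖⁻¹ • G x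

/-- The set of all `y ∈ X` with `y - c ∈ H` and `‖y - c‖_H ≤ r`. -/
def hBall (ι : H →L[ℝ] X) (c : X) (r : ℝ) : Set X := {y | ∃ k : H, ‖k‖ ≤ r ∧ y = c + ι k}

end Tube

end WienerTube

end

open MeasureTheory ProbabilityTheory Set Filter Topology
open scoped ENNReal NNReal TensorProduct

noncomputable section

namespace WienerTube

set_option linter.unusedSectionVars false

/-! The geometry is short. Suppose F(x) + ⟨∇F(x), h⟩ ≤ F(x + h) whenever x and x + h avoid N. If y =
x + h lies on the level set of x, then ⟨∇F(x), h⟩ ≤ 0. If y also lies in the H-ball of radius r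
about x + rη_x, then ‖h - rη_x‖² ≤ r² expands to ‖h‖² ≤ 2r⟨η_x, h⟩, so h = 0. Injectivity follows,
since x + rη_x = y + rη_y puts y at distance r from that centre.

The difficulty is to find one set N of zero capacity that serves all h at once. Convexity gives the
inequality for almost every x and all h in a countable dense set E. It is then averaged over the law
at time t of the Ornstein–Uhlenbeck process started at x. The law started at x + h is the translate
of this one by e^{-t}h, and at positive times translation along H acts continuously by
Cameron–Martin, so the averaged inequality extends from E to all of H. As t tends to 0 it survives
at every point where short averages of F and ∇F converge to the quasi-continuous versions
(`RegularAt.add_inner_le`).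

It remains to see that quasi-every point is of this kind (`polar_not_regularAt`). The core is a
Lebesgue point theorem, `polar_not_tendsto_pot_unif`: the function is approximated by bounded
continuous ones, with an error below a potential ∫ P_s w γ(ds), where γ is the Gamma law of
parameter ε/2 and ∫ w^p is small. Short averages of such a potential are at most a constant times
the potential itself (`pot_unif_pot_le`), which replaces a maximal inequality, and the set where a
potential of small energy exceeds 1 has small capacity. For the gradient the approximation comes
from F = (I - L)^{-(2+ε)/2} g: Gaussian integration by parts in Mehler's formula costs a singular
factor in time, which the two surplus orders of smoothness absorb (`potApprox_of_memD`). -/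

lemma exists_le_lowerSemicontinuous_lintegral_rpow_le {X : Type*} [TopologicalSpace X]
    [MeasurableSpace X] [BorelSpace X] (μ : Measure X) [μ.WeaklyRegular] {w : X → ℝ≥0∞}
    (hw : Measurable w) {p : ℝ} (hp : 0 < p) {δ : ℝ≥0∞} (hδ : δ ≠ 0) :
    ∃ w' : X → ℝ≥0∞, (∀ x, w x ≤ w' x) ∧ LowerSemicontinuous w' ∧
      ∫⁻ x, w' x ^ p ∂μ ≤ ∫⁻ x, w x ^ p ∂μ + δ := by
  obtain ⟨g, hle, hlsc, hint⟩ :=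
    exists_le_lowerSemicontinuous_lintegral_ge μ (fun x => w x ^ p) (by fun_prop) hδ
  refine ⟨fun x => g x ^ (1 / p), fun x => ?_, ?_, ?_⟩
  · calc w x = (w x ^ p) ^ (1 / p) := by rw [← ENNReal.rpow_mul, mul_one_div_cancel hp.ne',
          ENNReal.rpow_one]
      _ ≤ g x ^ (1 / p) := by gcongr; exact hle x
  · exact ENNReal.continuous_rpow_const.comp_lowerSemicontinuous hlsc
      (ENNReal.monotone_rpow_of_nonneg (by positivity))
  · refine le_trans (le_of_eq ?_) hint
    refine lintegral_congr fun x => ?_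
    rw [← ENNReal.rpow_mul, one_div_mul_cancel hp.ne', ENNReal.rpow_one]

/-! ### Gaussian measure: rotation invariance and the Cameron–Martin theorem. -/

section Gaussian

variable {X H : Type*} [NormedAddCommGroup X] [NormedSpace ℝ X]
  [MeasurableSpace X] [BorelSpace X]
  [NormedAddCommGroup H] [InnerProductSpace ℝ H] [CompleteSpace H]
  {ι : H →L[ℝ] X} {μ : Measure X}

lemma inner_dualVec (ℓ : StrongDual ℝ X) (h : H) : inner ℝ (dualVec ι ℓ) h = ℓ (ι h) := by
  simp [dualVec]

lemma dualVec_add (ℓ ℓ' : StrongDual ℝ X) :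
    dualVec ι (ℓ + ℓ') = dualVec ι ℓ + dualVec ι ℓ' := by
  simp [dualVec]

lemma dualVec_smul (c : ℝ) (ℓ : StrongDual ℝ X) : dualVec ι (c • ℓ) = c • dualVec ι ℓ := by
  simp [dualVec]

namespace IsAbstractWienerSpace

lemma secondCountableTopology [TopologicalSpace.SeparableSpace H]
    (hW : IsAbstractWienerSpace ι μ) : SecondCountableTopology X :=
  have := hW.dense.separableSpace ι.continuous
  UniformSpace.secondCountable_of_separable X

lemma isProbabilityMeasure (hW : IsAbstractWienerSpace ι μ) : IsProbabilityMeasure μ := by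
  have h := hW.gaussian 0
  have h1 : (μ.map (0 : StrongDual ℝ X)) univ = 1 := by rw [h]; exact measure_univ
  rw [Measure.map_apply (by fun_prop) MeasurableSet.univ] at h1
  exact ⟨by simpa using h1⟩

lemma charFunDual_eq (hW : IsAbstractWienerSpace ι μ) (ℓ : StrongDual ℝ X) :
    charFunDual μ ℓ = Complex.exp (-(‖dualVec ι ℓ‖ ^ 2 / 2 : ℝ)) := by
  rw [charFunDual_eq_charFun_map_one, hW.gaussian, charFun_gaussianReal]
  simp

/-- A vector orthogonal to this subspace has an image under `ι` that every functional kills; by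
Hahn–Banach and injectivity it is zero. -/
lemma denseRange_dualVec (hW : IsAbstractWienerSpace ι μ) :
    DenseRange (dualVec ι : StrongDual ℝ X → H) := by
  let S : Submodule ℝ H :=
    { carrier := range (dualVec ι : StrongDual ℝ X → H)
      add_mem' := by
        rintro _ _ ⟨a, rfl⟩ ⟨b, rfl⟩
        exact ⟨a + b, dualVec_add a b⟩
      zero_mem' := ⟨0, by simpa using dualVec_smul (ι := ι) 0 0⟩
      smul_mem' := by
        rintro c _ ⟨a, rfl⟩
        exact ⟨c • a, dualVec_smul c a⟩ }
  have hS : Dense (S : Set H) := by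
    rw [Submodule.dense_iff_topologicalClosure_eq_top,
      Submodule.topologicalClosure_eq_top_iff, Submodule.eq_bot_iff]
    intro h hh
    rw [Submodule.mem_orthogonal] at hh
    apply hW.injective
    rw [map_zero]
    refine (SeparatingDual.eq_zero_of_forall_dual_eq_zero (R := ℝ) (x := ι h)) fun ℓ => ?_
    rw [← inner_dualVec]
    exact hh _ ⟨ℓ, rfl⟩
  exact hS

variable [CompleteSpace X] [SecondCountableTopology X]

/-- If `y`, `z` are independent with law `μ` and `a² + b² = c²`, then `a y + b z` has the law of
`c y`. -/
lemma map_mix (hW : IsAbstractWienerSpace ι μ) {a b c : ℝ} (h : a ^ 2 + b ^ 2 = c ^ 2) :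
    (μ.prod μ).map (fun z : X × X => a • z.1 + b • z.2) = μ.map (fun y => c • y) := by
  have := hW.isProbabilityMeasure
  let L : X × X →L[ℝ] X :=
    a • ContinuousLinearMap.fst ℝ X X + b • ContinuousLinearMap.snd ℝ X X
  let C : X →L[ℝ] X := c • ContinuousLinearMap.id ℝ X
  have : IsProbabilityMeasure ((μ.prod μ).map L) :=
    Measure.isProbabilityMeasure_map (by fun_prop)
  have : IsProbabilityMeasure (μ.map C) := Measure.isProbabilityMeasure_map (by fun_prop)
  change (μ.prod μ).map L = μ.map C
  refine Measure.ext_of_charFunDual (funext fun ℓ => ?_)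
  rw [charFunDual_map, charFunDual_map, charFunDual_prod]
  have h1 : (ℓ.comp L).comp (.inl ℝ X X) = a • ℓ := by ext x; simp [L]
  have h2 : (ℓ.comp L).comp (.inr ℝ X X) = b • ℓ := by ext x; simp [L]
  have h3 : ℓ.comp C = c • ℓ := by ext x; simp [C]
  rw [h1, h2, h3, hW.charFunDual_eq, hW.charFunDual_eq, hW.charFunDual_eq, ← Complex.exp_add]
  simp only [dualVec_smul, norm_smul, mul_pow, Real.norm_eq_abs, sq_abs, ← h]
  congr 1
  push_cast
  ring

lemma lintegral_mix (hW : IsAbstractWienerSpace ι μ) {a b c : ℝ} (h : a ^ 2 + b ^ 2 = c ^ 2)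
    {w : X → ℝ≥0∞} (hw : Measurable w) (v : X) :
    ∫⁻ y, ∫⁻ z, w (v + (a • y + b • z)) ∂μ ∂μ = ∫⁻ y, w (v + c • y) ∂μ := by
  have := hW.isProbabilityMeasure
  rw [lintegral_lintegral (f := fun y z => w (v + (a • y + b • z))) (by fun_prop)]
  have h1 := lintegral_map (μ := μ.prod μ) (f := fun y => w (v + y))
    (g := fun z : X × X => a • z.1 + b • z.2) (by fun_prop) (by fun_prop)
  rw [← h1, hW.map_mix h, lintegral_map (by fun_prop) (by fun_prop)]

lemma integral_exp (hW : IsAbstractWienerSpace ι μ) (ℓ : StrongDual ℝ X) :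
    ∫ y, Real.exp (ℓ y) ∂μ = Real.exp (‖dualVec ι ℓ‖ ^ 2 / 2) := by
  have h := mgf_gaussianReal (p := μ) (X := ℓ) (hW.gaussian ℓ) 1
  simpa [mgf] using h

lemma integrable_exp (hW : IsAbstractWienerSpace ι μ) (ℓ : StrongDual ℝ X) :
    Integrable (fun y => Real.exp (ℓ y)) μ := by
  have h := integrable_exp_mul_gaussianReal (μ := 0) (v := ‖dualVec ι ℓ‖₊ ^ 2) 1
  rw [← hW.gaussian ℓ, integrable_map_measure (by fun_prop) (by fun_prop)] at h
  simpa [Function.comp_def] using h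

/-- The Cameron–Martin density of the translation by the vector that represents `ℓ`. -/
def cmDensity (ι : H →L[ℝ] X) (ℓ : StrongDual ℝ X) (y : X) : ℝ :=
  Real.exp (ℓ y - ‖dualVec ι ℓ‖ ^ 2 / 2)

lemma integral_cmDensity (hW : IsAbstractWienerSpace ι μ) (ℓ : StrongDual ℝ X) :
    ∫ y, cmDensity ι ℓ y ∂μ = 1 := by
  simp only [cmDensity, Real.exp_sub]
  rw [integral_div, hW.integral_exp, div_self (Real.exp_pos _).ne']

lemma integrable_cmDensity (hW : IsAbstractWienerSpace ι μ) (ℓ : StrongDual ℝ X) :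
    Integrable (cmDensity ι ℓ) μ := by
  have := (hW.integrable_exp ℓ).div_const (Real.exp (‖dualVec ι ℓ‖ ^ 2 / 2))
  simp only [← Real.exp_sub] at this
  exact this

lemma continuous_cmDensity (ℓ : StrongDual ℝ X) : Continuous (cmDensity ι ℓ) := by
  unfold cmDensity; fun_prop

/-- The Cameron–Martin theorem for translations by representatives of functionals. -/
lemma map_add_dualVec (hW : IsAbstractWienerSpace ι μ) (ℓ : StrongDual ℝ X) :
    μ.map (fun y => y + ι (dualVec ι ℓ)) =
      μ.withDensity (fun y => ENNReal.ofReal (cmDensity ι ℓ y)) := by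
  have := hW.isProbabilityMeasure
  set ν := μ.withDensity (fun y => ENNReal.ofReal (cmDensity ι ℓ y)) with hν
  have hdens : Measurable (fun y => ENNReal.ofReal (cmDensity ι ℓ y)) :=
    (continuous_cmDensity ℓ).measurable.ennreal_ofReal
  have hνp : IsProbabilityMeasure ν := ⟨by
    rw [hν, withDensity_apply _ MeasurableSet.univ, setLIntegral_univ,
      ← ofReal_integral_eq_lintegral_ofReal (hW.integrable_cmDensity ℓ)
        (ae_of_all _ fun y => (Real.exp_pos _).le), hW.integral_cmDensity, ENNReal.ofReal_one]⟩
  have : IsProbabilityMeasure (μ.map fun y => y + ι (dualVec ι ℓ)) :=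
    Measure.isProbabilityMeasure_map (by fun_prop)
  refine Measure.ext_of_charFunDual (funext fun ℓ' => ?_)
  -- One-dimensional marginals of the weighted measure are identified by their real moment
  -- generating functions, which determine the complex ones by analytic continuation.
  have key : ν.map ℓ' = gaussianReal (ℓ' (ι (dualVec ι ℓ))) (‖dualVec ι ℓ'‖₊ ^ 2) := by
    have hmgf : mgf id (gaussianReal (ℓ' (ι (dualVec ι ℓ))) (‖dualVec ι ℓ'‖₊ ^ 2)) =
        mgf ℓ' ν := by
      funext s
      rw [mgf_gaussianReal (Measure.map_id)]
      have h1 : mgf ℓ' ν s = ∫ y, cmDensity ι ℓ y * Real.exp (s * ℓ' y) ∂μ := by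
        rw [mgf, hν, integral_withDensity_eq_integral_toReal_smul hdens (by simp)]
        refine integral_congr_ae (ae_of_all _ fun y => ?_)
        simp [cmDensity, (Real.exp_pos _).le]
      have h2 : ∀ y, cmDensity ι ℓ y * Real.exp (s * ℓ' y) =
          Real.exp ((s • ℓ' + ℓ) y) / Real.exp (‖dualVec ι ℓ‖ ^ 2 / 2) := by
        intro y
        rw [cmDensity, ← Real.exp_add, ← Real.exp_sub]
        congr 1
        simp
        ring
      simp_rw [h1, h2]
      rw [integral_div, hW.integral_exp, ← Real.exp_sub, dualVec_add, dualVec_smul,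
        norm_add_sq_real, norm_smul, inner_smul_left, inner_dualVec]
      congr 1
      simp [mul_pow]
      ring
    have h := eqOn_complexMGF_of_mgf hmgf
    rw [integrableExpSet_id_gaussianReal] at h
    have h' := Measure.ext_of_complexMGF_eq (μ := gaussianReal _ _) (μ' := ν) aemeasurable_id
      (Y := ℓ') (by fun_prop) (funext fun z => h (by simp))
    rw [← h', Measure.map_id]
  rw [charFunDual_map_add_const, hW.charFunDual_eq, charFunDual_eq_charFun_map_one, key,
    charFun_gaussianReal, ← Complex.exp_add]
  congr 1
  simp
  ring

lemma lintegral_add_dualVec (hW : IsAbstractWienerSpace ι μ) (ℓ : StrongDual ℝ X)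
    {w : X → ℝ≥0∞} (hw : Measurable w) :
    ∫⁻ y, w (y + ι (dualVec ι ℓ)) ∂μ = ∫⁻ y, ENNReal.ofReal (cmDensity ι ℓ y) * w y ∂μ := by
  rw [← lintegral_map (g := fun y => y + ι (dualVec ι ℓ)) hw (by fun_prop), hW.map_add_dualVec,
    lintegral_withDensity_eq_lintegral_mul _
      (continuous_cmDensity ℓ).measurable.ennreal_ofReal hw]
  rfl

lemma integral_add_dualVec (hW : IsAbstractWienerSpace ι μ) (ℓ : StrongDual ℝ X)
    {w : X → ℝ} (hw : Measurable w) :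
    ∫ y, w (y + ι (dualVec ι ℓ)) ∂μ = ∫ y, cmDensity ι ℓ y * w y ∂μ := by
  rw [← integral_map (φ := fun y => y + ι (dualVec ι ℓ)) (by fun_prop)
    hw.aestronglyMeasurable, hW.map_add_dualVec, integral_withDensity_eq_integral_toReal_smul
      (continuous_cmDensity ℓ).measurable.ennreal_ofReal (by simp)]
  refine integral_congr_ae (ae_of_all _ fun y => ?_)
  simp [cmDensity, (Real.exp_pos _).le]

lemma lintegral_cmDensity_sq (hW : IsAbstractWienerSpace ι μ) (ℓ : StrongDual ℝ X) :
    ∫⁻ y, ENNReal.ofReal (cmDensity ι ℓ y) ^ (2 : ℝ) ∂μ =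
      ENNReal.ofReal (Real.exp (‖dualVec ι ℓ‖ ^ 2)) := by
  have h2 : ∀ y, ENNReal.ofReal (cmDensity ι ℓ y) ^ (2 : ℝ) =
      ENNReal.ofReal (Real.exp (((2 : ℝ) • ℓ) y) / Real.exp (‖dualVec ι ℓ‖ ^ 2)) := by
    intro y
    rw [ENNReal.rpow_two, cmDensity, ← ENNReal.ofReal_pow (Real.exp_pos _).le, ← Real.exp_nat_mul,
      ← Real.exp_sub]
    congr 2
    simp
    ring
  simp_rw [h2]
  rw [← ofReal_integral_eq_lintegral_ofReal ((hW.integrable_exp _).div_const _)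
    (ae_of_all _ fun y => by positivity), integral_div, hW.integral_exp, ← Real.exp_sub,
    dualVec_smul, norm_smul]
  congr 2
  simp [mul_pow]
  ring

/-- Translations along `H` are bounded from `L²` to `L¹`. -/
lemma lintegral_add_le (hW : IsAbstractWienerSpace ι μ) (h : H) {w : X → ℝ≥0∞}
    (hw : Measurable w) :
    ∫⁻ y, w (y + ι h) ∂μ ≤
      ENNReal.ofReal (Real.exp (‖h‖ ^ 2 / 2)) * (∫⁻ y, w y ^ (2 : ℝ) ∂μ) ^ (1 / 2 : ℝ) := by
  have := hW.isProbabilityMeasure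
  -- Cauchy–Schwarz against the Cameron–Martin density, whose `L²` norm is exp(‖k‖²/2) for k =
  -- `dualVec ι ℓ`.
  have hdual : ∀ (ℓ : StrongDual ℝ X) {w : X → ℝ≥0∞}, Measurable w →
      ∫⁻ y, w (y + ι (dualVec ι ℓ)) ∂μ ≤ ENNReal.ofReal (Real.exp (‖dualVec ι ℓ‖ ^ 2 / 2)) *
        (∫⁻ y, w y ^ (2 : ℝ) ∂μ) ^ (1 / 2 : ℝ) := by
    intro ℓ w hw
    rw [hW.lintegral_add_dualVec ℓ hw]
    refine (ENNReal.lintegral_mul_le_Lp_mul_Lq μ Real.HolderConjugate.two_two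
      (continuous_cmDensity ℓ).measurable.ennreal_ofReal.aemeasurable hw.aemeasurable).trans ?_
    rw [hW.lintegral_cmDensity_sq, ENNReal.ofReal_rpow_of_pos (Real.exp_pos _), ← Real.exp_mul]
    simp [div_eq_mul_inv]
  obtain ⟨u, hu, hlim⟩ := mem_closure_iff_seq_limit.1 (hW.denseRange_dualVec h)
  choose ℓ hℓ using hu
  -- Representatives of functionals are dense in `H`; for lower semicontinuous `w`, Fatou's lemma
  -- carries the bound to every `h`.
  have hlsc : ∀ w : X → ℝ≥0∞, LowerSemicontinuous w → ∫⁻ y, w (y + ι h) ∂μ ≤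
      ENNReal.ofReal (Real.exp (‖h‖ ^ 2 / 2)) * (∫⁻ y, w y ^ (2 : ℝ) ∂μ) ^ (1 / 2 : ℝ) := by
    intro w hw
    have hmw := hw.measurable
    by_cases htop : (∫⁻ y, w y ^ (2 : ℝ) ∂μ) ^ (1 / 2 : ℝ) = ⊤
    · rw [htop, ENNReal.mul_top (by simp [Real.exp_pos])]
      exact le_top
    calc ∫⁻ y, w (y + ι h) ∂μ ≤ ∫⁻ y, liminf (fun n => w (y + ι (u n))) atTop ∂μ := by
          refine lintegral_mono fun y => ?_
          have ht : Tendsto (fun n => y + ι (u n)) atTop (𝓝 (y + ι h)) :=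
            tendsto_const_nhds.add ((ι.continuous.tendsto h).comp hlim)
          exact (lowerSemicontinuous_iff_le_liminf.1 hw _).trans
            (liminf_le_liminf_of_le ht)
      _ ≤ liminf (fun n => ∫⁻ y, w (y + ι (u n)) ∂μ) atTop :=
          lintegral_liminf_le fun n => by fun_prop
      _ ≤ liminf (fun n => ENNReal.ofReal (Real.exp (‖u n‖ ^ 2 / 2)) *
            (∫⁻ y, w y ^ (2 : ℝ) ∂μ) ^ (1 / 2 : ℝ)) atTop := by
          refine liminf_le_liminf (Eventually.of_forall fun n => ?_)
          rw [← hℓ n]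
          exact hdual _ hmw
      _ = _ := by
          refine Tendsto.liminf_eq (ENNReal.Tendsto.mul_const ?_ (Or.inr htop))
          refine ENNReal.tendsto_ofReal ?_
          exact (Real.continuous_exp.tendsto _).comp ((hlim.norm.pow 2).div_const 2)
  by_cases htop : ∫⁻ y, w y ^ (2 : ℝ) ∂μ = ⊤
  · rw [htop, ENNReal.top_rpow_of_pos (by norm_num), ENNReal.mul_top (by simp [Real.exp_pos])]
    exact le_top
  -- A general `w` lies below lower semicontinuous functions whose energy exceeds its own by at most
  -- 1/n; at n = 0 this inverse is ∞, which does no harm.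
  refine ge_of_tendsto' (x := atTop)
    (f := fun n : ℕ => ENNReal.ofReal (Real.exp (‖h‖ ^ 2 / 2)) *
      ((∫⁻ y, w y ^ (2 : ℝ) ∂μ) + ((n : ℝ≥0∞))⁻¹) ^ (1 / 2 : ℝ)) ?_ fun n => ?_
  · refine ENNReal.Tendsto.const_mul ?_ (Or.inr ENNReal.ofReal_ne_top)
    refine (ENNReal.continuous_rpow_const.tendsto _).comp ?_
    simpa using tendsto_const_nhds.add ENNReal.tendsto_inv_nat_nhds_zero
  · obtain ⟨w', hle, hlsc', hint⟩ := exists_le_lowerSemicontinuous_lintegral_rpow_le μ hw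
      (p := 2) (by norm_num) (δ := ((n : ℝ≥0∞))⁻¹) (by simp)
    refine (lintegral_mono fun y => hle _).trans ((hlsc w' hlsc').trans ?_)
    gcongr

end IsAbstractWienerSpace
end Gaussian

lemma rpow_lintegral_le_lintegral_rpow {α : Type*} [MeasurableSpace α] (ν : Measure α)
    [IsProbabilityMeasure ν] {p : ℝ} (hp : 1 < p) {f : α → ℝ≥0∞} (hf : AEMeasurable f ν) :
    (∫⁻ x, f x ∂ν) ^ p ≤ ∫⁻ x, f x ^ p ∂ν := by
  have h := ENNReal.lintegral_mul_le_Lp_mul_Lq ν (Real.HolderConjugate.conjExponent hp) hf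
    (aemeasurable_const (b := (1 : ℝ≥0∞)))
  simp only [Pi.mul_apply, mul_one, ENNReal.one_rpow, lintegral_const, measure_univ] at h
  calc (∫⁻ x, f x ∂ν) ^ p ≤ ((∫⁻ x, f x ^ p ∂ν) ^ (1 / p)) ^ p := by gcongr
    _ = _ := by rw [← ENNReal.rpow_mul, one_div_mul_cancel (by positivity), ENNReal.rpow_one]

/-! ### The Ornstein–Uhlenbeck semigroup and its time averages. -/

section Mehler

variable {X : Type*} [NormedAddCommGroup X] [NormedSpace ℝ X]

/-- The point `e^{-s} x + √(1 - e^{-2s}) y` of Mehler's formula. -/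
def mix (s : ℝ) (x y : X) : X := Real.exp (-s) • x + √(1 - Real.exp (-2 * s)) • y

lemma continuous_mix : Continuous fun q : ℝ × X × X => mix q.1 q.2.1 q.2.2 := by
  unfold mix; fun_prop

@[fun_prop]
lemma continuous_mix_comp {Y : Type*} [TopologicalSpace Y] {s : Y → ℝ} {x y : Y → X}
    (hs : Continuous s) (hx : Continuous x) (hy : Continuous y) :
    Continuous fun q => mix (s q) (x q) (y q) :=
  continuous_mix.comp (hs.prodMk (hx.prodMk hy))

lemma mix_mix (s t : ℝ) (x y z : X) : mix s (mix t x z) y = Real.exp (-(s + t)) • x +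
    ((Real.exp (-s) * √(1 - Real.exp (-2 * t))) • z + √(1 - Real.exp (-2 * s)) • y) := by
  simp only [mix, smul_add, smul_smul, ← Real.exp_add, ← add_assoc]
  congr 4
  ring

lemma mix_add (s : ℝ) (x h y : X) : mix s (x + h) y = mix s x y + Real.exp (-s) • h := by
  simp only [mix, smul_add]; abel

lemma one_sub_exp_nonneg {s : ℝ} (hs : 0 ≤ s) : 0 ≤ 1 - Real.exp (-2 * s) := by
  rw [sub_nonneg, Real.exp_le_one_iff]; linarith

/-- The variances of the noise from two successive times add up; with rotation invariance this is
the semigroup law. -/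
lemma mix_coeff {s t : ℝ} (hs : 0 ≤ s) (ht : 0 ≤ t) :
    (Real.exp (-s) * √(1 - Real.exp (-2 * t))) ^ 2 + √(1 - Real.exp (-2 * s)) ^ 2 =
      √(1 - Real.exp (-2 * (s + t))) ^ 2 := by
  rw [mul_pow, Real.sq_sqrt (one_sub_exp_nonneg hs), Real.sq_sqrt (one_sub_exp_nonneg ht),
    Real.sq_sqrt (one_sub_exp_nonneg (add_nonneg hs ht)), ← Real.exp_nat_mul, mul_sub,
    ← Real.exp_add]
  push_cast
  ring_nf

variable [MeasurableSpace X]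

/-- The Ornstein–Uhlenbeck semigroup on functions with values in `[0, ∞]`. -/
def sg (μ : Measure X) (s : ℝ) (w : X → ℝ≥0∞) (x : X) : ℝ≥0∞ := ∫⁻ y, w (mix s x y) ∂μ

/-- The average `∫ P_s w γ(ds)` of the Ornstein–Uhlenbeck semigroup. -/
def pot (γ : Measure ℝ) (μ : Measure X) (w : X → ℝ≥0∞) (x : X) : ℝ≥0∞ := ∫⁻ s, sg μ s w x ∂γ

section Basic

variable {γ γ' : Measure ℝ} {μ : Measure X}

lemma sg_mono {s : ℝ} {w w' : X → ℝ≥0∞} (h : ∀ x, w x ≤ w' x) (x : X) :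
    sg μ s w x ≤ sg μ s w' x := lintegral_mono fun _ => h _

lemma pot_mono {w w' : X → ℝ≥0∞} (h : ∀ x, w x ≤ w' x) (x : X) :
    pot γ μ w x ≤ pot γ μ w' x := lintegral_mono fun _ => sg_mono h x

variable [BorelSpace X] [SecondCountableTopology X] [SFinite μ] [SFinite γ] [SFinite γ']

lemma measurable_comp_mix {w : X → ℝ≥0∞} (hw : Measurable w) :
    Measurable fun q : (ℝ × X) × X => w (mix q.1.1 q.1.2 q.2) :=
  hw.comp (by fun_prop : Continuous fun q : (ℝ × X) × X => mix q.1.1 q.1.2 q.2).measurable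

lemma measurable_sg {w : X → ℝ≥0∞} (hw : Measurable w) :
    Measurable fun q : ℝ × X => sg μ q.1 w q.2 :=
  (measurable_comp_mix hw).lintegral_prod_right'

@[fun_prop]
lemma measurable_sg_time {w : X → ℝ≥0∞} (hw : Measurable w) (x : X) :
    Measurable fun s => sg μ s w x :=
  (measurable_sg hw).comp (by fun_prop : Measurable fun s : ℝ => (s, x))

@[fun_prop]
lemma measurable_pot {w : X → ℝ≥0∞} (hw : Measurable w) : Measurable (pot γ μ w) :=
  Measurable.lintegral_prod_right' (f := fun q : X × ℝ => sg μ q.2 w q.1)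
    ((measurable_sg hw).comp measurable_swap)

lemma pot_add {w w' : X → ℝ≥0∞} (hw : Measurable w) (x : X) :
    pot γ μ (fun x => w x + w' x) x = pot γ μ w x + pot γ μ w' x := by
  simp only [pot]
  rw [← lintegral_add_left (measurable_sg_time hw x)]
  refine lintegral_congr fun s => lintegral_add_left ?_ _
  exact hw.comp (by fun_prop : Continuous fun y => mix s x y).measurable

lemma pot_const_mul {w : X → ℝ≥0∞} (hw : Measurable w) (c : ℝ≥0∞) (x : X) :
    pot γ μ (fun x => c * w x) x = c * pot γ μ w x := by
  simp only [pot]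
  rw [← lintegral_const_mul _ (measurable_sg_time hw x)]
  refine lintegral_congr fun s => lintegral_const_mul _ ?_
  exact hw.comp (by fun_prop : Continuous fun y => mix s x y).measurable

lemma pot_const [IsProbabilityMeasure μ] [IsProbabilityMeasure γ] (c : ℝ≥0∞) (x : X) :
    pot γ μ (fun _ => c) x = c := by
  simp [pot, sg]

lemma pot_eq_prod {w : X → ℝ≥0∞} (hw : Measurable w) (x : X) :
    pot γ μ w x = ∫⁻ z, w (mix z.1 x z.2) ∂(γ.prod μ) := by
  rw [lintegral_prod]
  · rfl
  · exact (hw.comp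
      (by fun_prop : Continuous fun q : ℝ × X => mix q.1 x q.2).measurable).aemeasurable

lemma rpow_pot_le [IsProbabilityMeasure μ] [IsProbabilityMeasure γ] {p : ℝ} (hp : 1 < p)
    {w : X → ℝ≥0∞} (hw : Measurable w) (x : X) :
    pot γ μ w x ^ p ≤ pot γ μ (fun x => w x ^ p) x := by
  rw [pot_eq_prod hw, pot_eq_prod (hw.pow_const p)]
  exact rpow_lintegral_le_lintegral_rpow _ hp (hw.comp
      (by fun_prop : Continuous fun q : ℝ × X => mix q.1 x q.2).measurable).aemeasurable

/-- By Fatou's lemma a potential inherits lower semicontinuity from its weight. This supplies the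
open sets that the definition of capacity asks for. -/
lemma isOpen_lt_pot {w : X → ℝ≥0∞} (hw : LowerSemicontinuous w) (c : ℝ≥0∞) :
    IsOpen {x | c < pot γ μ w x} := by
  rw [← isClosed_compl_iff]
  refine IsSeqClosed.isClosed fun u x hu hlim => ?_
  simp only [mem_compl_iff, mem_ofPred_eq, not_lt] at hu ⊢
  have hm := hw.measurable
  calc pot γ μ w x ≤ ∫⁻ z, liminf (fun n => w (mix z.1 (u n) z.2)) atTop ∂(γ.prod μ) := by
        rw [pot_eq_prod hm]
        refine lintegral_mono fun z => ?_
        have ht : Tendsto (fun n => mix z.1 (u n) z.2) atTop (𝓝 (mix z.1 x z.2)) :=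
          ((by fun_prop : Continuous fun x => mix z.1 x z.2).tendsto x).comp hlim
        exact (lowerSemicontinuous_iff_le_liminf.1 hw _).trans (liminf_le_liminf_of_le ht)
    _ ≤ liminf (fun n => ∫⁻ z, w (mix z.1 (u n) z.2) ∂(γ.prod μ)) atTop :=
        lintegral_liminf_le fun n =>
          hm.comp (by fun_prop : Continuous fun q : ℝ × X => mix q.1 (u n) q.2).measurable
    _ ≤ c := by
        refine liminf_le_of_le (by isBoundedDefault) fun b hb => ?_
        obtain ⟨n, hn⟩ := hb.exists
        refine hn.trans ?_
        rw [← pot_eq_prod hm]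
        exact hu n

end Basic

section Invariance

variable {H : Type*} [NormedAddCommGroup H] [InnerProductSpace ℝ H] [CompleteSpace H]
  {ι : H →L[ℝ] X} {γ γ' : Measure ℝ} {μ : Measure X}
  [BorelSpace X] [CompleteSpace X] [SecondCountableTopology X]
  [SFinite μ] [SFinite γ] [SFinite γ']

lemma sg_sg (hW : IsAbstractWienerSpace ι μ) {s t : ℝ} (hs : 0 ≤ s) (ht : 0 ≤ t)
    {w : X → ℝ≥0∞} (hw : Measurable w) (x : X) :
    sg μ t (sg μ s w) x = sg μ (s + t) w x := by
  simp only [sg, mix_mix]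
  exact hW.lintegral_mix (mix_coeff hs ht) hw _

lemma lintegral_sg (hW : IsAbstractWienerSpace ι μ) {s : ℝ} (hs : 0 ≤ s)
    {w : X → ℝ≥0∞} (hw : Measurable w) : ∫⁻ x, sg μ s w x ∂μ = ∫⁻ x, w x ∂μ := by
  have h := hW.lintegral_mix (a := Real.exp (-s)) (b := √(1 - Real.exp (-2 * s))) (c := 1)
    (by rw [Real.sq_sqrt (one_sub_exp_nonneg hs), ← Real.exp_nat_mul]; push_cast; ring_nf) hw 0
  simpa [sg, mix] using h

lemma lintegral_pot (hW : IsAbstractWienerSpace ι μ) [IsProbabilityMeasure γ]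
    (hγ : ∀ᵐ s ∂γ, 0 ≤ s) {w : X → ℝ≥0∞} (hw : Measurable w) :
    ∫⁻ x, pot γ μ w x ∂μ = ∫⁻ x, w x ∂μ := by
  simp only [pot]
  rw [lintegral_lintegral_swap]
  · rw [lintegral_congr_ae (g := fun _ => ∫⁻ x, w x ∂μ)]
    · simp
    · filter_upwards [hγ] with s hs using lintegral_sg hW hs hw
  · exact ((measurable_sg hw).comp measurable_swap).aemeasurable

lemma lintegral_rpow_pot_le (hW : IsAbstractWienerSpace ι μ) [IsProbabilityMeasure γ]
    (hγ : ∀ᵐ s ∂γ, 0 ≤ s) {p : ℝ} (hp : 1 < p) {w : X → ℝ≥0∞} (hw : Measurable w) :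
    ∫⁻ x, pot γ μ w x ^ p ∂μ ≤ ∫⁻ x, w x ^ p ∂μ := by
  have := hW.isProbabilityMeasure
  refine (lintegral_mono fun x => rpow_pot_le hp hw x).trans ?_
  rw [lintegral_pot hW hγ (hw.pow_const p)]

/-- By P_t P_s = P_{s+t}, comparing iterated averages becomes a matter of convolving laws of time.
-/
lemma pot_pot (hW : IsAbstractWienerSpace ι μ) (hγ : ∀ᵐ s ∂γ, 0 ≤ s) (hγ' : ∀ᵐ s ∂γ', 0 ≤ s)
    {w : X → ℝ≥0∞} (hw : Measurable w) (x : X) :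
    pot γ' μ (pot γ μ w) x = ∫⁻ t, ∫⁻ s, sg μ (s + t) w x ∂γ ∂γ' := by
  refine lintegral_congr_ae ?_
  filter_upwards [hγ'] with t ht
  have h1 : sg μ t (pot γ μ w) x = ∫⁻ s, sg μ t (sg μ s w) x ∂γ := by
    simp only [sg, pot]
    rw [lintegral_lintegral_swap]
    have hf : Measurable fun q : X × ℝ => (q.2, mix t x q.1) :=
      (by fun_prop : Continuous fun q : X × ℝ => (q.2, mix t x q.1)).measurable
    exact ((measurable_sg (μ := μ) hw).comp hf).aemeasurable
  rw [h1]
  refine lintegral_congr_ae ?_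
  filter_upwards [hγ] with s hs using sg_sg hW hs ht hw x

/-- A null set is not charged by `P_s 1_N (x)`, for almost all `x` and `s`. -/
lemma pot_eq_zero_ae (hW : IsAbstractWienerSpace ι μ) [IsProbabilityMeasure γ]
    (hγ : ∀ᵐ s ∂γ, 0 ≤ s) {w : X → ℝ≥0∞} (hw : Measurable w) (h0 : w =ᵐ[μ] 0) :
    pot γ μ w =ᵐ[μ] 0 := by
  rw [← lintegral_eq_zero_iff (measurable_pot hw), lintegral_pot hW hγ hw, lintegral_eq_zero_iff hw]
  exact h0

end Invariance

end Mehler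

/-! ### Gamma and uniform laws of time, and their convolutions. -/

section TimeMeasures

/-- The uniform distribution on `(0, δ]`. -/
def unif (δ : ℝ) : Measure ℝ :=
  volume.withDensity (indicator (Ioc 0 δ) fun _ => (ENNReal.ofReal δ)⁻¹)

/-- The defining density of `unif` fits the convolution formula for densities; this form is the one
to compute with. -/
lemma unif_eq (δ : ℝ) : unif δ = (ENNReal.ofReal δ)⁻¹ • volume.restrict (Ioc 0 δ) := by
  rw [unif, withDensity_indicator measurableSet_Ioc, withDensity_const]

lemma isProbabilityMeasure_unif {δ : ℝ} (hδ : 0 < δ) : IsProbabilityMeasure (unif δ) := ⟨by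
  rw [unif_eq]
  simp [ENNReal.inv_mul_cancel (ENNReal.ofReal_pos.2 hδ).ne' ENNReal.ofReal_ne_top]⟩

lemma ae_mem_unif (δ : ℝ) : ∀ᵐ s ∂unif δ, s ∈ Ioc 0 δ := by
  rw [unif_eq]
  exact Measure.ae_smul_measure (ae_restrict_mem measurableSet_Ioc) _

lemma measurable_gammaPDF (a r : ℝ) : Measurable (gammaPDF a r) :=
  (measurable_gammaPDFReal a r).ennreal_ofReal

lemma ae_pos_gammaMeasure (a : ℝ) : ∀ᵐ s ∂gammaMeasure a 1, 0 < s := by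
  rw [gammaMeasure, ae_withDensity_iff (measurable_gammaPDF a 1)]
  have h : ∀ᵐ s : ℝ, s ≠ 0 := by simp [ae_iff]
  filter_upwards [h] with s hs h0
  by_contra hlt
  exact h0 (gammaPDF_of_neg (lt_of_le_of_ne (not_lt.1 hlt) hs))

/-- Transfers statements valid at almost every Gamma-distributed time to uniformly distributed
times. -/
lemma absolutelyContinuous_gammaMeasure {a : ℝ} (ha : 0 < a) :
    volume.restrict (Ioi 0) ≪ gammaMeasure a 1 := by
  refine Measure.AbsolutelyContinuous.mk fun s hs h => ?_
  rw [gammaMeasure, withDensity_apply _ hs,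
    lintegral_eq_zero_iff (measurable_gammaPDF a 1)] at h
  have h2 : ∀ᵐ x : ℝ, x ∈ s → ¬ (0 < x) := by
    rw [← ae_restrict_iff' hs]
    filter_upwards [h] with x hx hpos
    have := gammaPDFReal_pos ha one_pos hpos
    simp only [gammaPDF, Pi.zero_apply, ENNReal.ofReal_eq_zero] at hx
    linarith
  rw [Measure.restrict_apply hs]
  refine measure_mono_null ?_ h2
  rintro x ⟨h1, h3⟩
  simp only [mem_compl_iff, mem_ofPred_eq]
  exact fun h4 => h4 h1 h3

/-- Substitution r = s + t and Tonelli; the inner integral on the right is the convolution of the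
two densities. -/
lemma lintegral_lintegral_add_withDensity {A B φ : ℝ → ℝ≥0∞} (hA : Measurable A)
    (hB : Measurable B) (hφ : Measurable φ) :
    ∫⁻ t, ∫⁻ s, φ (s + t) ∂(volume.withDensity A) ∂(volume.withDensity B) =
      ∫⁻ r, φ r * ∫⁻ t, A (r - t) * B t := by
  have h1 : ∀ t, ∫⁻ s, φ (s + t) ∂(volume.withDensity A) = ∫⁻ r, A (r - t) * φ r := by
    intro t
    rw [lintegral_withDensity_eq_lintegral_mul _ hA (by fun_prop),
      ← lintegral_add_right_eq_self (fun r => A (r - t) * φ r) t]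
    simp
  simp_rw [h1]
  rw [lintegral_withDensity_eq_lintegral_mul _ hB (by fun_prop)]
  calc ∫⁻ t, B t * ∫⁻ r, A (r - t) * φ r = ∫⁻ t, ∫⁻ r, B t * (A (r - t) * φ r) := by
        refine lintegral_congr fun t => (lintegral_const_mul _ (by fun_prop)).symm
    _ = ∫⁻ r, ∫⁻ t, B t * (A (r - t) * φ r) := lintegral_lintegral_swap (by fun_prop)
    _ = _ := by
        refine lintegral_congr fun r => ?_
        rw [← lintegral_const_mul _ (by fun_prop)]
        refine lintegral_congr fun t => by ring

lemma lintegral_sub_rpow {a r c : ℝ} (ha : 0 < a) (hc : 0 ≤ c) (hcr : c ≤ r) :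
    ∫⁻ t in Ioc 0 c, ENNReal.ofReal ((r - t) ^ (a - 1)) =
      ENNReal.ofReal ((r ^ a - (r - c) ^ a) / a) := by
  have hint : IntervalIntegrable (fun t => (r - t) ^ (a - 1)) volume 0 c := by
    have := (intervalIntegral.intervalIntegrable_rpow' (a := r) (b := r - c) (r := a - 1)
      (by linarith)).comp_sub_left r
    simpa using this
  rw [← ofReal_integral_eq_lintegral_ofReal
    ((intervalIntegrable_iff_integrableOn_Ioc_of_le hc).1 hint),
    ← intervalIntegral.integral_of_le hc,
    intervalIntegral.integral_comp_sub_left (fun t => t ^ (a - 1)) r,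
    integral_rpow (Or.inl (by linarith))]
  · simp
  · filter_upwards [ae_restrict_mem measurableSet_Ioc] with t ht
    exact Real.rpow_nonneg (by linarith [ht.2]) _

/-- Division by r^a leaves 1 - (1 - z)^a ≤ max(a, 1) z with z = c/r in [0, 1]. This is Bernoulli's
inequality for a ≥ 1, and 1 - z ≤ (1 - z)^a for a ≤ 1. -/
lemma rpow_sub_rpow_le {a r c : ℝ} (ha : 0 < a) (hc : 0 ≤ c) (hcr : c ≤ r) (hr : 0 < r) :
    r ^ a - (r - c) ^ a ≤ max a 1 * c * r ^ (a - 1) := by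
  have hz0 : 0 ≤ c / r := by positivity
  have hz1 : c / r ≤ 1 := (div_le_one hr).2 hcr
  have key : 1 - max a 1 * (c / r) ≤ (1 - c / r) ^ a := by
    rcases le_total a 1 with h | h
    · rw [max_eq_right h, one_mul]
      exact Real.self_le_rpow_of_le_one (by linarith) (by linarith) h
    · rw [max_eq_left h]
      have := one_add_mul_self_le_rpow_one_add (s := -(c / r)) (by linarith) h
      rw [← sub_eq_add_neg] at this
      linarith
  have h1 : (r - c) ^ a = r ^ a * (1 - c / r) ^ a := by
    rw [← Real.mul_rpow hr.le (by linarith)]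
    congr 1
    field_simp
  have h2 : r ^ a = r ^ (a - 1) * r := by
    rw [← Real.rpow_add_one hr.ne']; simp
  have h3 : 0 ≤ r ^ a := by positivity
  calc r ^ a - (r - c) ^ a = r ^ a * (1 - (1 - c / r) ^ a) := by rw [h1]; ring
    _ ≤ r ^ a * (max a 1 * (c / r)) := by gcongr; linarith
    _ = max a 1 * c * r ^ (a - 1) := by rw [h2]; field_simp

lemma gammaPDF_one_of_pos {a x : ℝ} (hx : 0 < x) : gammaPDF a 1 x =
    ENNReal.ofReal ((Real.Gamma a)⁻¹ * x ^ (a - 1) * Real.exp (-x)) := by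
  rw [gammaPDF_of_nonneg hx.le]
  simp

/-- Gamma laws of parameters a and 1 convolve to the law of parameter a + 1. Only this inequality is
needed, so the integral may be cut down to 0 < t < r. -/
lemma gammaPDF_succ_le {a r : ℝ} (ha : 0 < a) (hr : 0 < r) :
    gammaPDF (a + 1) 1 r ≤ ∫⁻ t, gammaPDF a 1 (r - t) * gammaPDF 1 1 t := by
  have hG := Real.Gamma_pos_of_pos ha
  calc gammaPDF (a + 1) 1 r
      = ENNReal.ofReal ((Real.Gamma a)⁻¹ * Real.exp (-r)) *
        ∫⁻ t in Ioc 0 r, ENNReal.ofReal ((r - t) ^ (a - 1)) := by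
        rw [lintegral_sub_rpow ha hr.le le_rfl, ← ENNReal.ofReal_mul (by positivity),
          gammaPDF_one_of_pos hr, Real.Gamma_add_one ha.ne', sub_self, Real.zero_rpow ha.ne']
        congr 1
        simp
        field_simp
    _ = ∫⁻ t in Ioc 0 r, ENNReal.ofReal ((Real.Gamma a)⁻¹ * Real.exp (-r)) *
          ENNReal.ofReal ((r - t) ^ (a - 1)) := (lintegral_const_mul _ (by fun_prop)).symm
    _ = ∫⁻ t in Ioo 0 r, ENNReal.ofReal ((Real.Gamma a)⁻¹ * Real.exp (-r)) *
          ENNReal.ofReal ((r - t) ^ (a - 1)) := by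
        rw [restrict_Ioo_eq_restrict_Ioc]
    _ = ∫⁻ t in Ioo 0 r, gammaPDF a 1 (r - t) * gammaPDF 1 1 t := by
        refine setLIntegral_congr_fun measurableSet_Ioo fun t ht => ?_
        rw [gammaPDF_one_of_pos (sub_pos.2 ht.2), gammaPDF_one_of_pos ht.1,
          ← ENNReal.ofReal_mul (by positivity), ← ENNReal.ofReal_mul
            (by have := sub_pos.2 ht.2; positivity)]
        congr 1
        have : Real.exp (-r) = Real.exp (-(r - t)) * Real.exp (-t) := by
          rw [← Real.exp_add]; ring_nf
        rw [this]
        simp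
        ring
    _ ≤ _ := setLIntegral_le_lintegral _ _

/-- The constant in the domination of shifted Gamma densities. -/
def domConst (a : ℝ) : ℝ := Real.exp 1 * (max a 1 / a)

/-- A shift by t ≤ δ ≤ 1 costs at most a factor e in the exponential, and averaging the power over
such shifts costs max(a, 1)/a. The constant does not depend on δ. -/
lemma average_gammaPDF_le {a r δ : ℝ} (ha : 0 < a) (hr : 0 < r) (hδ : 0 < δ) (hδ1 : δ ≤ 1) :
    ∫⁻ t, gammaPDF a 1 (r - t) * indicator (Ioc 0 δ) (fun _ => (ENNReal.ofReal δ)⁻¹) t ≤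
      ENNReal.ofReal (domConst a) * gammaPDF a 1 r := by
  have hG := Real.Gamma_pos_of_pos ha
  set c := min r δ with hc
  have hc0 : 0 ≤ c := (lt_min hr hδ).le
  have hcr : c ≤ r := min_le_left _ _
  have hcδ : c ≤ δ := min_le_right _ _
  -- The shifted density vanishes for t > r, so only t ≤ min(r, δ) contributes; t = r is a null set
  -- and is left out.
  have h1 : ∀ t, t ≠ r → gammaPDF a 1 (r - t) *
      indicator (Ioc 0 δ) (fun _ => (ENNReal.ofReal δ)⁻¹) t ≤
      indicator (Ioc 0 c) (fun t => ENNReal.ofReal ((Real.Gamma a)⁻¹ * Real.exp (1 - r) * δ⁻¹) *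
        ENNReal.ofReal ((r - t) ^ (a - 1))) t := by
    intro t htr
    by_cases ht : t ∈ Ioc 0 δ
    · rw [indicator_of_mem ht]
      rcases lt_or_gt_of_ne htr with h | h
      · rw [indicator_of_mem (s := Ioc 0 c) ⟨ht.1, le_min h.le ht.2⟩,
          gammaPDF_one_of_pos (sub_pos.2 h), ← ENNReal.ofReal_inv_of_pos hδ]
        have hrt := sub_pos.2 h
        rw [← ENNReal.ofReal_mul (by positivity), ← ENNReal.ofReal_mul (by positivity)]
        refine ENNReal.ofReal_le_ofReal ?_
        have he : Real.exp (-(r - t)) ≤ Real.exp (1 - r) :=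
          Real.exp_le_exp.2 (by linarith [ht.2])
        calc (Real.Gamma a)⁻¹ * (r - t) ^ (a - 1) * Real.exp (-(r - t)) * δ⁻¹
            ≤ (Real.Gamma a)⁻¹ * (r - t) ^ (a - 1) * Real.exp (1 - r) * δ⁻¹ := by gcongr
          _ = _ := by ring
      · rw [gammaPDF_of_neg (by linarith)]
        simp
    · rw [indicator_of_notMem ht]
      simp
  have hne : ∀ᵐ t : ℝ, t ≠ r := by simp [ae_iff]
  calc _ ≤ ∫⁻ t, indicator (Ioc 0 c) (fun t => ENNReal.ofReal ((Real.Gamma a)⁻¹ *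
          Real.exp (1 - r) * δ⁻¹) * ENNReal.ofReal ((r - t) ^ (a - 1))) t :=
        lintegral_mono_ae (by filter_upwards [hne] with t ht using h1 t ht)
    _ = ENNReal.ofReal ((Real.Gamma a)⁻¹ * Real.exp (1 - r) * δ⁻¹ *
          ((r ^ a - (r - c) ^ a) / a)) := by
        rw [lintegral_indicator measurableSet_Ioc, lintegral_const_mul _ (by fun_prop),
          lintegral_sub_rpow ha hc0 hcr, ← ENNReal.ofReal_mul (by positivity)]
    _ ≤ ENNReal.ofReal (domConst a) * gammaPDF a 1 r := by
        rw [gammaPDF_one_of_pos hr, ← ENNReal.ofReal_mul (by unfold domConst; positivity)]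
        refine ENNReal.ofReal_le_ofReal ?_
        have h2 := rpow_sub_rpow_le ha hc0 hcr hr
        have h3 : max a 1 * c * r ^ (a - 1) ≤ max a 1 * δ * r ^ (a - 1) := by gcongr
        calc (Real.Gamma a)⁻¹ * Real.exp (1 - r) * δ⁻¹ * ((r ^ a - (r - c) ^ a) / a)
            ≤ (Real.Gamma a)⁻¹ * Real.exp (1 - r) * δ⁻¹ *
              ((max a 1 * δ * r ^ (a - 1)) / a) := by
              gcongr
              exact h2.trans h3
          _ = _ := by
              rw [domConst, sub_eq_add_neg 1 r, Real.exp_add]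
              field_simp

end TimeMeasures

/-! ### Pointwise comparison of potentials. -/

section Domination

variable {X : Type*} [NormedAddCommGroup X] [NormedSpace ℝ X] [MeasurableSpace X]
  {H : Type*} [NormedAddCommGroup H] [InnerProductSpace ℝ H] [CompleteSpace H]
  {ι : H →L[ℝ] X} {μ : Measure X}
  [BorelSpace X] [CompleteSpace X] [SecondCountableTopology X]

/-- Two orders of smoothness move from the potential onto the weight, whose `L^p` norm an average of
the semigroup does not increase. -/
lemma pot_gammaMeasure_succ_le (hW : IsAbstractWienerSpace ι μ) {a : ℝ} (ha : 0 < a)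
    {w : X → ℝ≥0∞} (hw : Measurable w) (x : X) :
    pot (gammaMeasure (a + 1) 1) μ w x ≤
      pot (gammaMeasure a 1) μ (pot (gammaMeasure 1 1) μ w) x := by
  have := hW.isProbabilityMeasure
  have := isProbabilityMeasure_gammaMeasure ha one_pos
  have := isProbabilityMeasure_gammaMeasure (a := 1) one_pos one_pos
  have hm := measurable_sg_time (μ := μ) hw x
  have h0 : ∀ᵐ r : ℝ, r ≠ 0 := by simp [ae_iff]
  rw [pot_pot hW ((ae_pos_gammaMeasure _).mono fun _ h => h.le)
    ((ae_pos_gammaMeasure _).mono fun _ h => h.le) hw]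
  simp only [gammaMeasure]
  have hswap : ∀ A B : ℝ → ℝ≥0∞, Measurable A → Measurable B →
      ∫⁻ t, ∫⁻ s, sg μ (s + t) w x ∂(volume.withDensity A) ∂(volume.withDensity B) =
      ∫⁻ t, ∫⁻ s, sg μ (s + t) w x ∂(volume.withDensity B) ∂(volume.withDensity A) := by
    intro A B hA hB
    rw [lintegral_lintegral_swap]
    · simp_rw [add_comm]
    · exact (hm.comp (by fun_prop : Measurable fun q : ℝ × ℝ => q.2 + q.1)).aemeasurable
  rw [hswap _ _ (measurable_gammaPDF _ _) (measurable_gammaPDF _ _),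
    lintegral_lintegral_add_withDensity (φ := fun s => sg μ s w x)
    (measurable_gammaPDF _ _) (measurable_gammaPDF _ _) hm, pot,
    lintegral_withDensity_eq_lintegral_mul _ (measurable_gammaPDF _ _) hm]
  refine lintegral_mono_ae ?_
  filter_upwards [h0] with r hr
  simp only [Pi.mul_apply]
  rw [mul_comm]
  gcongr
  rcases lt_or_gt_of_ne hr with h | h
  · rw [gammaPDF_of_neg h]; exact zero_le
  · exact gammaPDF_succ_le ha h

/-- Plays the role of a maximal inequality: one potential bounds all its short averages, at every
point and not only almost everywhere. -/
lemma pot_unif_pot_le (hW : IsAbstractWienerSpace ι μ) {a δ : ℝ} (ha : 0 < a) (hδ : 0 < δ)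
    (hδ1 : δ ≤ 1) {w : X → ℝ≥0∞} (hw : Measurable w) (x : X) :
    pot (unif δ) μ (pot (gammaMeasure a 1) μ w) x ≤
      ENNReal.ofReal (domConst a) * pot (gammaMeasure a 1) μ w x := by
  have := hW.isProbabilityMeasure
  have := isProbabilityMeasure_gammaMeasure ha one_pos
  have := isProbabilityMeasure_unif hδ
  have hm := measurable_sg_time (μ := μ) hw x
  have h0 : ∀ᵐ r : ℝ, r ≠ 0 := by simp [ae_iff]
  rw [pot_pot hW ((ae_pos_gammaMeasure _).mono fun _ h => h.le)
    ((ae_mem_unif _).mono fun _ h => h.1.le) hw, gammaMeasure, unif,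
    lintegral_lintegral_add_withDensity (φ := fun s => sg μ s w x)
    (measurable_gammaPDF _ _) (by fun_prop (disch := exact measurableSet_Ioc)) hm, pot,
    lintegral_withDensity_eq_lintegral_mul _ (measurable_gammaPDF _ _) hm,
    ← lintegral_const_mul _ ((measurable_gammaPDF _ _).mul hm)]
  refine lintegral_mono_ae ?_
  filter_upwards [h0] with r hr
  simp only [Pi.mul_apply]
  rw [← mul_assoc, mul_comm]
  gcongr
  rcases lt_or_gt_of_ne hr with h | h
  · refine le_of_eq_of_le (lintegral_eq_zero_of_ae_eq_zero (ae_of_all _ fun t => ?_)) zero_le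
    by_cases ht : t ∈ Ioc 0 δ
    · simp only
      rw [gammaPDF_of_neg (by linarith [ht.1])]; simp
    · simp [ht]
  · exact average_gammaPDF_le ha h hδ hδ1

end Domination

/-! ### Bessel potentials and a calculus of small and polar sets. -/

section Capacity

variable {X : Type*} [NormedAddCommGroup X] [NormedSpace ℝ X] [MeasurableSpace X]
  {H : Type*} [NormedAddCommGroup H] [InnerProductSpace ℝ H] [CompleteSpace H]
  {ι : H →L[ℝ] X} {μ : Measure X}

/-- The normalised kernel is the Gamma density, so the Bessel potential is the semigroup averaged
over a Gamma-distributed time. -/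
lemma besselPotential_eq {α : ℝ} (hα : 0 < α) (g : X → ℝ) (x : X) :
    besselPotential μ α g x = ∫ s, ∫ y, g (mix s x y) ∂μ ∂(gammaMeasure (α / 2) 1) := by
  have hG := Real.Gamma_pos_of_pos (half_pos hα)
  rw [gammaMeasure, integral_withDensity_eq_integral_toReal_smul (measurable_gammaPDF _ _)
    (by simp [gammaPDF]), besselPotential, ← integral_const_mul,
    ← integral_indicator measurableSet_Ioi]
  refine integral_congr_ae ?_
  have h0 : ∀ᵐ r : ℝ, r ≠ 0 := by simp [ae_iff]
  filter_upwards [h0] with r hr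
  rcases lt_or_gt_of_ne hr with h | h
  · rw [gammaPDF_of_neg h, indicator_of_notMem (by simpa using h.le)]
    simp
  · rw [gammaPDF_one_of_pos h, indicator_of_mem (by simpa using h),
      ENNReal.toReal_ofReal (by positivity)]
    simp only [ouSemigroup, mix, smul_eq_mul]
    ring

lemma enorm_besselPotential_le {α : ℝ} (hα : 0 < α) (g : X → ℝ) (x : X) :
    ‖besselPotential μ α g x‖ₑ ≤ pot (gammaMeasure (α / 2) 1) μ (fun z => ‖g z‖ₑ) x := by
  rw [besselPotential_eq hα]
  exact (enorm_integral_le_lintegral_enorm _).trans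
    (lintegral_mono fun s => enorm_integral_le_lintegral_enorm _)

variable [BorelSpace X] [CompleteSpace X] [SecondCountableTopology X]

/-- The starting point `x` is fixed here: this is how almost sure statements become available at
each point outside a polar set. -/
lemma ae_ae_of_pot_eq_zero [SFinite μ] {γ : Measure ℝ} {N : Set X} (hN : MeasurableSet N) {x : X}
    (h : pot γ μ (N.indicator 1) x = 0) : ∀ᵐ s ∂γ, ∀ᵐ y ∂μ, mix s x y ∉ N := by
  have hm : Measurable (N.indicator (1 : X → ℝ≥0∞)) := measurable_one.indicator hN
  rw [pot, lintegral_eq_zero_iff (measurable_sg_time hm x)] at h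
  filter_upwards [h] with s hs
  simp only [sg, Pi.zero_apply] at hs
  have hm' : Measurable fun y => N.indicator (1 : X → ℝ≥0∞) (mix s x y) :=
    hm.comp (by fun_prop : Continuous fun y => mix s x y).measurable
  rw [lintegral_eq_zero_iff hm'] at hs
  filter_upwards [hs] with y hy hmem
  simp [hmem] at hy

lemma ae_ae_mix (hW : IsAbstractWienerSpace ι μ) {γ : Measure ℝ} [IsProbabilityMeasure γ]
    (hγ : ∀ᵐ s ∂γ, 0 ≤ s) {P : X → Prop} (h : ∀ᵐ x ∂μ, P x) :
    ∀ᵐ x ∂μ, ∀ᵐ s ∂γ, ∀ᵐ y ∂μ, P (mix s x y) := by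
  have := hW.isProbabilityMeasure
  obtain ⟨N, hsub, hN, hN0⟩ := exists_measurable_superset_of_null h
  have h0 : N.indicator (1 : X → ℝ≥0∞) =ᵐ[μ] 0 := indicator_meas_zero hN0
  filter_upwards [pot_eq_zero_ae hW hγ (measurable_one.indicator hN) h0] with x hx
  filter_upwards [ae_ae_of_pot_eq_zero hN hx] with s hs
  filter_upwards [hs] with y hy
  by_contra hP
  exact hy (hsub hP)

lemma ae_nonneg_gammaMeasure (a : ℝ) : ∀ᵐ s ∂gammaMeasure a 1, 0 ≤ s :=
  (ae_pos_gammaMeasure a).mono fun _ h => h.le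

lemma besselPotential_congr_ae (hW : IsAbstractWienerSpace ι μ) {α : ℝ} (hα : 0 < α)
    {g g' : X → ℝ} (h : g =ᵐ[μ] g') :
    besselPotential μ α g =ᵐ[μ] besselPotential μ α g' := by
  have := isProbabilityMeasure_gammaMeasure (half_pos hα) one_pos
  filter_upwards [ae_ae_mix hW (ae_nonneg_gammaMeasure (α / 2)) h] with x hx
  rw [besselPotential_eq hα, besselPotential_eq hα]
  refine integral_congr_ae ?_
  filter_upwards [hx] with s hs using integral_congr_ae hs

lemma besselPotential_toReal (hW : IsAbstractWienerSpace ι μ) {α : ℝ} (hα : 0 < α)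
    {w : X → ℝ≥0∞} (hw : Measurable w) (hfin : ∫⁻ x, w x ∂μ ≠ ⊤) :
    ∀ᵐ x ∂μ, besselPotential μ α (fun z => (w z).toReal) x =
      (pot (gammaMeasure (α / 2) 1) μ w x).toReal := by
  have := hW.isProbabilityMeasure
  have := isProbabilityMeasure_gammaMeasure (half_pos hα) one_pos
  have hγ := ae_nonneg_gammaMeasure (α / 2)
  have h1 : ∀ᵐ x ∂μ, pot (gammaMeasure (α / 2) 1) μ w x < ⊤ :=
    ae_lt_top (measurable_pot hw) (by rwa [lintegral_pot hW hγ hw])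
  filter_upwards [h1, ae_ae_mix hW hγ (ae_lt_top hw hfin)] with x hx hx2
  have h2 := ae_lt_top (measurable_sg_time (μ := μ) hw x) hx.ne
  rw [besselPotential_eq hα, pot,
    ← integral_toReal (measurable_sg_time hw x).aemeasurable h2]
  refine integral_congr_ae ?_
  filter_upwards [hx2] with s hs
  exact integral_toReal
    (hw.comp (by fun_prop : Continuous fun y => mix s x y).measurable).aemeasurable hs

/-- `A` is covered by an open set that is `(r, γ)`-small, with energy at most `c`. -/
def SmallCap (μ : Measure X) (γ : Measure ℝ) (r : ℝ) (A : Set X) (c : ℝ≥0∞) : Prop :=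
  ∃ (O : Set X) (w : X → ℝ≥0∞), IsOpen O ∧ A ⊆ O ∧ Measurable w ∧
    (∀ᵐ x ∂μ, x ∈ O → 1 ≤ pot γ μ w x) ∧ ∫⁻ x, w x ^ r ∂μ ≤ c

/-- Sets of capacity zero. -/
def Polar (μ : Measure X) (γ : Measure ℝ) (r : ℝ) (A : Set X) : Prop :=
  ∀ c : ℝ≥0∞, 0 < c → SmallCap μ γ r A c

variable {γ : Measure ℝ} {r : ℝ} {A B : Set X} {c d : ℝ≥0∞}

lemma SmallCap.mono (h : SmallCap μ γ r B c) (hAB : A ⊆ B) (hcd : c ≤ d) :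
    SmallCap μ γ r A d := by
  obtain ⟨O, w, hO, hBO, hw, h1, h2⟩ := h
  exact ⟨O, w, hO, hAB.trans hBO, hw, h1, h2.trans hcd⟩

lemma Polar.mono (h : Polar μ γ r B) (hAB : A ⊆ B) : Polar μ γ r A :=
  fun c hc => (h c hc).mono hAB le_rfl

/-- The `ℓ^r` combination of the weights dominates each of them, and its energy is exactly the sum
of theirs. -/
lemma SmallCap.iUnion (hr : 0 < r) {A : ℕ → Set X} {c : ℕ → ℝ≥0∞}
    (h : ∀ n, SmallCap μ γ r (A n) (c n)) : SmallCap μ γ r (⋃ n, A n) (∑' n, c n) := by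
  choose O w hO hA hw h1 h2 using h
  refine ⟨⋃ n, O n, fun x => (∑' n, w n x ^ r) ^ (1 / r), isOpen_iUnion hO,
    iUnion_mono hA, ?_, ?_, ?_⟩
  · exact (Measurable.tsum fun n => (hw n).pow_const r).pow_const _
  · filter_upwards [ae_all_iff.2 h1] with x hx hmem
    obtain ⟨n, hn⟩ := mem_iUnion.1 hmem
    refine (hx n hn).trans (pot_mono (fun z => ?_) x)
    calc w n z = (w n z ^ r) ^ (1 / r) := by
          rw [← ENNReal.rpow_mul, mul_one_div_cancel hr.ne', ENNReal.rpow_one]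
      _ ≤ _ := by
          gcongr
          exact ENNReal.le_tsum n
  · calc ∫⁻ x, ((∑' n, w n x ^ r) ^ (1 / r)) ^ r ∂μ = ∫⁻ x, ∑' n, w n x ^ r ∂μ := by
          refine lintegral_congr fun x => ?_
          rw [← ENNReal.rpow_mul, one_div_mul_cancel hr.ne', ENNReal.rpow_one]
      _ = ∑' n, ∫⁻ x, w n x ^ r ∂μ :=
          lintegral_tsum fun n => ((hw n).pow_const r).aemeasurable
      _ ≤ ∑' n, c n := ENNReal.tsum_le_tsum h2

lemma Polar.iUnion (hr : 0 < r) {A : ℕ → Set X} (h : ∀ n, Polar μ γ r (A n)) :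
    Polar μ γ r (⋃ n, A n) := by
  intro c hc
  obtain ⟨δ, hδ, hsum⟩ := ENNReal.exists_pos_sum_of_countable' hc.ne' ℕ
  exact (SmallCap.iUnion hr fun n => h n _ (hδ n)).mono subset_rfl hsum.le

lemma Polar.biUnion (hr : 0 < r) {I : Type*} {s : Set I} (hs : s.Countable) {A : I → Set X}
    (h : ∀ i ∈ s, Polar μ γ r (A i)) : Polar μ γ r (⋃ i ∈ s, A i) := by
  rcases s.eq_empty_or_nonempty with rfl | hne
  · intro c hc
    refine ⟨∅, 0, isOpen_empty, by simp, measurable_zero, by simp, ?_⟩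
    simp [ENNReal.zero_rpow_of_pos hr]
  · obtain ⟨f, rfl⟩ := hs.exists_eq_range hne
    rw [biUnion_range]
    exact Polar.iUnion hr fun n => h _ ⟨n, rfl⟩

lemma Polar.union (hr : 0 < r) (hA : Polar μ γ r A) (hB : Polar μ γ r B) :
    Polar μ γ r (A ∪ B) := by
  refine (Polar.iUnion hr (A := fun n => if n = 0 then A else B) fun n => ?_).mono ?_
  · split_ifs
    exacts [hA, hB]
  · rintro x (hx | hx)
    · exact mem_iUnion.2 ⟨0, by simpa using hx⟩
    · exact mem_iUnion.2 ⟨1, by simpa using hx⟩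

lemma SmallCap.union (hr : 0 < r) (hA : SmallCap μ γ r A c) (hB : SmallCap μ γ r B d) :
    SmallCap μ γ r (A ∪ B) (c + d) := by
  have hE : SmallCap μ γ r (∅ : Set X) 0 :=
    ⟨∅, 0, isOpen_empty, by simp, measurable_zero, by simp, by simp [ENNReal.zero_rpow_of_pos hr]⟩
  have h := SmallCap.iUnion hr (A := fun n : ℕ => if n = 0 then A else if n = 1 then B else ∅)
    (c := fun n => if n = 0 then c else if n = 1 then d else 0) (fun n => by
      split_ifs
      exacts [hA, hB, hE])
  refine h.mono ?_ ?_
  · rintro x (hx | hx)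
    · exact mem_iUnion.2 ⟨0, by simpa using hx⟩
    · exact mem_iUnion.2 ⟨1, by simpa using hx⟩
  · rw [tsum_eq_sum (s := {0, 1}) (by intro b hb; simp at hb; simp [hb])]
    simp

variable [IsProbabilityMeasure μ] [SFinite γ]

/-- A lower semicontinuous majorant of `w` with hardly more energy makes the superlevel set of its
potential open. -/
lemma smallCap_lt_pot (hr : 0 < r) {w : X → ℝ≥0∞} (hw : Measurable w)
    (h : ∫⁻ x, w x ^ r ∂μ < c) : SmallCap μ γ r {x | 1 < pot γ μ w x} c := by
  obtain ⟨w', hle, hlsc, hint⟩ := exists_le_lowerSemicontinuous_lintegral_rpow_le μ hw hr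
    (δ := c - ∫⁻ x, w x ^ r ∂μ) (tsub_pos_of_lt h).ne'
  refine ⟨{x | 1 < pot γ μ w' x}, w', isOpen_lt_pot hlsc 1, fun x hx => ?_, hlsc.measurable,
    ae_of_all _ fun x hx => le_of_lt hx, ?_⟩
  · exact lt_of_lt_of_le hx (pot_mono hle x)
  · rwa [add_tsub_cancel_of_le h.le] at hint

/-- Dividing `w` by n leaves the set unchanged and sends the energy to zero. -/
lemma polar_pot_eq_top (hr : 0 < r) {w : X → ℝ≥0∞} (hw : Measurable w)
    (h : ∫⁻ x, w x ^ r ∂μ ≠ ⊤) : Polar μ γ r {x | pot γ μ w x = ⊤} := by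
  intro c hc
  have hlim : Tendsto (fun n : ℕ => ((n : ℝ≥0∞)⁻¹) ^ r * ∫⁻ x, w x ^ r ∂μ) atTop (𝓝 0) := by
    have h1 := (ENNReal.continuous_rpow_const (y := r)).tendsto 0 |>.comp
      ENNReal.tendsto_inv_nat_nhds_zero
    rw [ENNReal.zero_rpow_of_pos hr] at h1
    simpa using ENNReal.Tendsto.mul_const h1 (Or.inr h)
  obtain ⟨n, hn, hn0⟩ := ((hlim.eventually_lt_const hc).and (eventually_gt_atTop 0)).exists
  refine (smallCap_lt_pot (γ := γ) hr (hw.const_mul ((n : ℝ≥0∞)⁻¹)) (c := c) ?_).mono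
    (fun x hx => ?_) le_rfl
  · simp_rw [ENNReal.mul_rpow_of_nonneg _ _ hr.le]
    rwa [lintegral_const_mul _ (hw.pow_const r)]
  · simp only [mem_ofPred_eq] at hx ⊢
    rw [pot_const_mul hw, hx, ENNReal.mul_top (by simp)]
    exact ENNReal.one_lt_top

/-- The weight ∞ · w still has zero energy, while its potential is ∞ wherever that of `w` is
nonzero. -/
lemma polar_pot_ne_zero (hr : 0 < r) {w : X → ℝ≥0∞} (hw : Measurable w) (h : w =ᵐ[μ] 0) :
    Polar μ γ r {x | pot γ μ w x ≠ 0} := by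
  intro c hc
  refine (smallCap_lt_pot (γ := γ) hr (hw.const_mul ⊤) (c := c) ?_).mono
    (fun x hx => ?_) le_rfl
  · refine lt_of_eq_of_lt ?_ hc
    rw [lintegral_eq_zero_iff (by fun_prop)]
    filter_upwards [h] with x hx
    simp [hx, hr]
  · simp only [mem_ofPred_eq] at hx ⊢
    rw [pot_const_mul hw, ENNReal.top_mul hx]
    exact ENNReal.one_lt_top

end Capacity

/-! ### Translation between small sets and the capacities of the statement. -/

section Link

variable {X : Type*} [NormedAddCommGroup X] [NormedSpace ℝ X] [MeasurableSpace X]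
  {H : Type*} [NormedAddCommGroup H] [InnerProductSpace ℝ H] [CompleteSpace H]
  {ι : H →L[ℝ] X} {μ : Measure X} [BorelSpace X] [CompleteSpace X] [SecondCountableTopology X]
  {p : ℝ≥0∞} {α : ℝ} {A : Set X} {c : ℝ≥0∞}

lemma one_lt_toReal (hp : 1 < p) (hp' : p < ⊤) : 1 < p.toReal := by
  rw [← ENNReal.toReal_one]
  exact (ENNReal.toReal_lt_toReal ENNReal.one_ne_top hp'.ne).2 hp

/-- The potential of `w` is an admissible competitor U, with (I - L)^{α/2} U equal to `w` up to a
null set. -/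
lemma SmallCap.capacity_le (hW : IsAbstractWienerSpace ι μ) (hα : 0 < α) (hp : 1 < p)
    (hp' : p < ⊤) (hc : c ≠ ⊤) (h : SmallCap μ (gammaMeasure (α / 2) 1) p.toReal A c) :
    capacity μ p α A ≤ c ^ (1 / p.toReal) := by
  have := hW.isProbabilityMeasure
  have := isProbabilityMeasure_gammaMeasure (half_pos hα) one_pos
  have hr := one_lt_toReal hp hp'
  have hp0 : p ≠ 0 := (zero_lt_one.trans hp).ne'
  obtain ⟨O, w, hO, hAO, hw, h1, h2⟩ := h
  have hfin : ∫⁻ x, w x ^ p.toReal ∂μ ≠ ⊤ := (h2.trans_lt hc.lt_top).ne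
  have hfin1 : ∫⁻ x, w x ∂μ ≠ ⊤ := by
    intro h3
    have h4 := rpow_lintegral_le_lintegral_rpow μ hr hw.aemeasurable
    rw [h3, ENNReal.top_rpow_of_pos (by linarith)] at h4
    exact hfin (top_le_iff.1 h4)
  have hbess := besselPotential_toReal hW hα hw hfin1
  have hle : ∀ x, ‖(w x).toReal‖ₑ ≤ w x := fun x => by
    rw [Real.enorm_eq_ofReal ENNReal.toReal_nonneg]; exact ENNReal.ofReal_toReal_le
  have hnorm : eLpNorm (fun x => (w x).toReal) p μ ≤ c ^ (1 / p.toReal) := by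
    rw [eLpNorm_eq_lintegral_rpow_enorm_toReal hp0 hp'.ne]
    gcongr
    refine le_trans (lintegral_mono fun x => ?_) h2
    gcongr
    exact hle x
  have hmem : MemLp (fun x => (w x).toReal) p μ :=
    ⟨hw.ennreal_toReal.aestronglyMeasurable,
      hnorm.trans_lt (ENNReal.rpow_lt_top_of_nonneg (by positivity) hc)⟩
  set U := besselPotential μ α (fun x => (w x).toReal) with hU
  have hUm : MemLp U p μ := by
    refine ⟨((measurable_pot hw).ennreal_toReal.aestronglyMeasurable).congr
      (EventuallyEq.symm hbess), ?_⟩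
    rw [eLpNorm_eq_lintegral_rpow_enorm_toReal hp0 hp'.ne]
    refine ENNReal.rpow_lt_top_of_nonneg (by positivity) ?_
    refine ((?_ : _ ≤ ∫⁻ x, w x ^ p.toReal ∂μ).trans_lt hfin.lt_top).ne
    refine le_trans (lintegral_mono fun x => ?_)
      (lintegral_rpow_pot_le hW (ae_nonneg_gammaMeasure (α / 2)) hr hw)
    gcongr
    exact (enorm_besselPotential_le hα _ x).trans (pot_mono hle x)
  have hpfin : ∀ᵐ x ∂μ, pot (gammaMeasure (α / 2) 1) μ w x < ⊤ :=
    ae_lt_top (measurable_pot hw) (by rwa [lintegral_pot hW (ae_nonneg_gammaMeasure _) hw])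
  calc capacity μ p α A ≤ openCapacity μ p α O := iInf₂_le_of_le O hO (iInf_le _ hAO)
    _ ≤ sobolevNorm μ p α U := by
        refine iInf₂_le_of_le U ⟨hUm, _, hmem, EventuallyEq.rfl⟩ (iInf_le _ ?_)
        filter_upwards [h1, hbess, hpfin] with x hx hx2 hx3 hxO
        rw [hx2, ← ENNReal.toReal_one]
        exact (ENNReal.toReal_le_toReal ENNReal.one_ne_top hx3.ne).2 (hx hxO)
    _ ≤ eLpNorm (fun x => (w x).toReal) p μ :=
        iInf₂_le_of_le _ hmem (iInf_le _ EventuallyEq.rfl)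
    _ ≤ _ := hnorm

lemma Polar.capacity_eq_zero (hW : IsAbstractWienerSpace ι μ) (hα : 0 < α) (hp : 1 < p)
    (hp' : p < ⊤) (h : Polar μ (gammaMeasure (α / 2) 1) p.toReal A) : capacity μ p α A = 0 := by
  have hr := one_lt_toReal hp hp'
  refine le_antisymm (ge_of_tendsto' (x := atTop)
    (f := fun n : ℕ => ((n : ℝ≥0∞)⁻¹) ^ (1 / p.toReal)) ?_ fun n => ?_) zero_le
  · have h1 := (ENNReal.continuous_rpow_const (y := 1 / p.toReal)).tendsto 0 |>.comp
      ENNReal.tendsto_inv_nat_nhds_zero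
    rwa [ENNReal.zero_rpow_of_pos (by positivity)] at h1
  · rcases Nat.eq_zero_or_pos n with rfl | hn
    · simp [ENNReal.top_rpow_of_pos, zero_lt_one.trans hr]
    · exact (h _ (by simp)).capacity_le hW hα hp hp' (by simp [hn.ne'])

/-- A competitor is the potential of some `g`, hence lies below the potential of |g|, which has the
same `L^p` norm. -/
lemma smallCap_of_capacity_lt (hW : IsAbstractWienerSpace ι μ) (hα : 0 < α) (hp : 1 < p)
    (hp' : p < ⊤) (h : capacity μ p α A < c ^ (1 / p.toReal)) :
    SmallCap μ (gammaMeasure (α / 2) 1) p.toReal A c := by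
  have := hW.isProbabilityMeasure
  have hr := one_lt_toReal hp hp'
  have hp0 : p ≠ 0 := (zero_lt_one.trans hp).ne'
  simp only [capacity, openCapacity, sobolevNorm, iInf_lt_iff] at h
  obtain ⟨O, hO, hAO, U, -, hU, g, hg, hUg, hlt⟩ := h
  set g' := hg.1.mk g with hg'
  have hgg' : g =ᵐ[μ] g' := hg.1.ae_eq_mk
  have hm : Measurable g' := hg.1.stronglyMeasurable_mk.measurable
  refine ⟨O, fun x => ‖g' x‖ₑ, hO, hAO, hm.enorm, ?_, ?_⟩
  · filter_upwards [hU, hUg, besselPotential_congr_ae hW hα hgg'] with x h1 h2 h3 hx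
    refine le_trans ?_ (enorm_besselPotential_le hα g' x)
    rw [← h3, ← h2]
    have h4 := h1 hx
    rw [Real.enorm_eq_ofReal (by linarith), ← ENNReal.ofReal_one]
    exact ENNReal.ofReal_le_ofReal h4
  · rw [eLpNorm_congr_ae hgg', eLpNorm_eq_lintegral_rpow_enorm_toReal hp0 hp'.ne] at hlt
    exact ((ENNReal.rpow_lt_rpow_iff (by positivity)).1 hlt).le

end Link

/-! ### Lebesgue points of quasi-continuous functions. -/

section LebesguePoints

variable {X : Type*} [NormedAddCommGroup X] [NormedSpace ℝ X] [MeasurableSpace X]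
  {H : Type*} [NormedAddCommGroup H] [InnerProductSpace ℝ H] [CompleteSpace H]
  {ι : H →L[ℝ] X} {μ : Measure X} [BorelSpace X] [CompleteSpace X] [SecondCountableTopology X]

lemma unif_absolutelyContinuous {a : ℝ} (ha : 0 < a) (δ : ℝ) : unif δ ≪ gammaMeasure a 1 := by
  rw [unif_eq]
  refine (Measure.smul_absolutelyContinuous).trans ?_
  refine (Measure.absolutelyContinuous_of_le
    (Measure.restrict_mono_set volume Ioc_subset_Ioi_self)).trans ?_
  exact absolutelyContinuous_gammaMeasure ha

/-- `u` is a limit of bounded continuous functions, with errors that are dominated by potentials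
of small energy. -/
def PotApprox (μ : Measure X) (γ : Measure ℝ) (r : ℝ) (u : X → ℝ) : Prop :=
  ∀ c : ℝ≥0∞, 0 < c → ∃ (v : X → ℝ) (w : X → ℝ≥0∞), Continuous v ∧ (∃ C, ∀ x, |v x| ≤ C) ∧
    Measurable w ∧ ∫⁻ x, w x ^ r ∂μ < c ∧ ∀ᵐ x ∂μ, ‖u x - v x‖ₑ ≤ pot γ μ w x

/-- The times at which short averages are taken. -/
def scale (n : ℕ) : ℝ := 1 / ((n : ℝ) + 1)

lemma scale_pos (n : ℕ) : 0 < scale n := Nat.one_div_pos_of_nat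

lemma scale_le_one (n : ℕ) : scale n ≤ 1 := by
  rw [scale, div_le_one (by positivity)]; linarith [n.cast_nonneg (α := ℝ)]

lemma tendsto_scale : Tendsto scale atTop (𝓝 0) := tendsto_one_div_add_atTop_nhds_zero_nat

lemma tendsto_pot_unif [IsProbabilityMeasure μ] {v : X → ℝ} (hv : Continuous v)
    (hb : ∃ C, ∀ x, |v x| ≤ C) (x : X) :
    Tendsto (fun n => pot (unif (scale n)) μ (fun z => ‖v z - v x‖ₑ) x) atTop (𝓝 0) := by
  obtain ⟨C, hC⟩ := hb
  have h1 : Tendsto (fun s => sg μ s (fun z => ‖v z - v x‖ₑ) x) (𝓝 0) (𝓝 0) := by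
    have h2 : (0 : ℝ≥0∞) = ∫⁻ y, ‖v (mix 0 x y) - v x‖ₑ ∂μ := by simp [mix]
    rw [h2]
    refine tendsto_lintegral_filter_of_dominated_convergence (fun _ => ENNReal.ofReal (C + C))
      (Eventually.of_forall fun s => ?_) (Eventually.of_forall fun s => ae_of_all _ fun y => ?_)
      (by simp) (ae_of_all _ fun y => ?_)
    · exact (by fun_prop : Continuous fun y => ‖v (mix s x y) - v x‖ₑ).measurable
    · simp only [← ofReal_norm]
      exact ENNReal.ofReal_le_ofReal ((norm_sub_le _ _).trans (add_le_add (hC _) (hC _)))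
    · exact (by fun_prop : Continuous fun s => ‖v (mix s x y) - v x‖ₑ).tendsto 0
  rw [ENNReal.tendsto_nhds_zero] at h1 ⊢
  intro ε hε
  obtain ⟨δ, hδ, hball⟩ := Metric.eventually_nhds_iff.1 (h1 ε hε)
  filter_upwards [tendsto_scale.eventually_lt_const hδ] with n hn
  have := isProbabilityMeasure_unif (scale_pos n)
  calc pot (unif (scale n)) μ (fun z => ‖v z - v x‖ₑ) x
      ≤ ∫⁻ s, ε ∂(unif (scale n)) := by
        refine lintegral_mono_ae ?_
        filter_upwards [ae_mem_unif (scale n)] with s hs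
        refine hball ?_
        rw [Real.dist_eq, sub_zero, abs_of_pos hs.1]
        exact hs.2.trans_lt hn
    _ = ε := by simp

/-- Off a small open `O'` the function `us` is continuous, so the set is relatively open there and
`O' ∪ V` is an open cover. Almost everywhere on `V` outside `O'` the error estimate makes the
potential of ρ⁻¹ `w` at least 1; on `O'` the weight `w'` does so. -/
lemma smallCap_lt_enorm_sub (hW : IsAbstractWienerSpace ι μ) {α : ℝ} (hα : 0 < α) {p : ℝ≥0∞}
    (hp : 1 < p) (hp' : p < ⊤) {u us v : X → ℝ} (hae : us =ᵐ[μ] u)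
    (hq : QuasiContinuous μ p α us) (hv : Continuous v) {w : X → ℝ≥0∞} (hw : Measurable w)
    {c d ρ : ℝ≥0∞} (hρ0 : ρ ≠ 0) (hρ : ρ ≠ ⊤) (hd : 0 < d)
    (huv : ∀ᵐ x ∂μ, ‖u x - v x‖ₑ ≤ pot (gammaMeasure (α / 2) 1) μ w x)
    (hwc : ∫⁻ x, (ρ⁻¹ * w x) ^ p.toReal ∂μ ≤ c) :
    SmallCap μ (gammaMeasure (α / 2) 1) p.toReal {x | ρ < ‖us x - v x‖ₑ} (c + d) := by
  have := hW.isProbabilityMeasure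
  have := isProbabilityMeasure_gammaMeasure (half_pos hα) one_pos
  have hr := one_lt_toReal hp hp'
  have hr0 : 0 < p.toReal := by linarith
  obtain ⟨O, hO, hcap, hcont⟩ := hq (d ^ (1 / p.toReal))
    (by rcases eq_or_ne d ⊤ with rfl | h
        · rw [ENNReal.top_rpow_of_pos (by positivity)]; exact ENNReal.zero_lt_top
        · exact ENNReal.rpow_pos hd h)
  obtain ⟨O', w', hO', hOO', hw', h1, h2⟩ := smallCap_of_capacity_lt hW hα hp hp' hcap
  obtain ⟨V, hV, hVeq⟩ := (continuousOn_iff'.1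
    ((hcont.mono (compl_subset_compl.2 hOO')).sub hv.continuousOn).enorm) (Ioi ρ) isOpen_Ioi
  have hsub : {x | ρ < ‖us x - v x‖ₑ} ⊆ O' ∪ V := by
    intro x hx
    by_cases hxO : x ∈ O'
    · exact Or.inl hxO
    · exact Or.inr (hVeq.subset ⟨hx, hxO⟩).1
  refine ⟨O' ∪ V, fun x => ((ρ⁻¹ * w x) ^ p.toReal + w' x ^ p.toReal) ^ (1 / p.toReal),
    hO'.union hV, hsub, by fun_prop, ?_, ?_⟩
  · have hcancel : ∀ t : ℝ≥0∞, (t ^ p.toReal) ^ (1 / p.toReal) = t := fun t => by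
      rw [← ENNReal.rpow_mul, mul_one_div_cancel hr0.ne', ENNReal.rpow_one]
    filter_upwards [h1, huv, hae] with x hx1 hx2 hx3 hxmem
    by_cases hxO : x ∈ O'
    · refine (hx1 hxO).trans (pot_mono (fun z => ?_) x)
      conv_lhs => rw [← hcancel (w' z)]
      gcongr
      exact le_add_self
    · have hxV : x ∈ V := hxmem.resolve_left hxO
      have h3 : ρ < ‖us x - v x‖ₑ := (hVeq.symm.subset ⟨hxV, hxO⟩).1
      rw [hx3] at h3
      calc (1 : ℝ≥0∞) = ρ⁻¹ * ρ := (ENNReal.inv_mul_cancel hρ0 hρ).symm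
        _ ≤ ρ⁻¹ * pot (gammaMeasure (α / 2) 1) μ w x := by
            gcongr
            exact h3.le.trans hx2
        _ = pot (gammaMeasure (α / 2) 1) μ (fun z => ρ⁻¹ * w z) x :=
            (pot_const_mul hw _ _).symm
        _ ≤ _ := by
            refine pot_mono (fun z => ?_) x
            conv_lhs => rw [← hcancel (ρ⁻¹ * w z)]
            gcongr
            exact le_self_add
  · calc _ = ∫⁻ x, ((ρ⁻¹ * w x) ^ p.toReal + w' x ^ p.toReal) ∂μ := by
          refine lintegral_congr fun x => ?_
          rw [← ENNReal.rpow_mul, one_div_mul_cancel hr0.ne', ENNReal.rpow_one]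
      _ = ∫⁻ x, (ρ⁻¹ * w x) ^ p.toReal ∂μ + ∫⁻ x, w' x ^ p.toReal ∂μ :=
          lintegral_add_left (by fun_prop) _
      _ ≤ c + d := add_le_add hwc h2

/-- Quasi-every point is a Lebesgue point of a quasi-continuous function, with respect to short
averages of the Ornstein–Uhlenbeck semigroup. -/
theorem polar_not_tendsto_pot_unif (hW : IsAbstractWienerSpace ι μ) {α : ℝ} (hα : 0 < α)
    {p : ℝ≥0∞} (hp : 1 < p) (hp' : p < ⊤) {u us : X → ℝ} (hu : Measurable u) (hae : us =ᵐ[μ] u)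
    (hq : QuasiContinuous μ p α us)
    (happ : PotApprox μ (gammaMeasure (α / 2) 1) p.toReal u) :
    Polar μ (gammaMeasure (α / 2) 1) p.toReal
      {x | ¬ Tendsto (fun n => pot (unif (scale n)) μ (fun z => ‖u z - us x‖ₑ) x)
        atTop (𝓝 0)} := by
  have := hW.isProbabilityMeasure
  have := isProbabilityMeasure_gammaMeasure (half_pos hα) one_pos
  have hr := one_lt_toReal hp hp'
  have hr0 : 0 < p.toReal := by linarith
  set γ := gammaMeasure (α / 2) 1 with hγ
  set L : ℕ → X → ℝ≥0∞ := fun n x => pot (unif (scale n)) μ (fun z => ‖u z - us x‖ₑ) x with hL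
  have key : ∀ k : ℕ, Polar μ γ p.toReal {x | ¬ ∀ᶠ n in atTop, L n x ≤ 3 * (k + 1 : ℝ≥0∞)⁻¹} := by
    intro k c hc
    set ρ : ℝ≥0∞ := (k + 1 : ℝ≥0∞)⁻¹ with hρdef
    have hρ0 : ρ ≠ 0 := by simp [hρdef, ENNReal.add_eq_top]
    have hρt : ρ ≠ ⊤ := by simp [hρdef]
    -- The second summand pays for short averages of the potential; the 1 lets the same energy bound
    -- serve the set where `us` and `v` differ.
    set K : ℝ≥0∞ := 1 + ENNReal.ofReal (domConst (α / 2)) with hK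
    have hKt : K ≠ ⊤ := by simp [hK]
    have hK0 : K ≠ 0 := by simp [hK]
    -- Four shares: one for the large potential, two for `us` far from `v` (approximation and
    -- quasi-continuity), one for the null set where the error estimate fails.
    obtain ⟨d, hd0, hd⟩ : ∃ d : ℝ≥0∞, 0 < d ∧ d + (d + d) + d ≤ c := by
      refine ⟨c / 4, ENNReal.div_pos hc.ne' (by simp), le_of_eq ?_⟩
      have : c / 4 + (c / 4 + c / 4) + c / 4 = 4 * (c / 4) := by ring
      rw [this, ENNReal.mul_div_cancel (by simp) (by simp)]
    have hfac0 : (ρ⁻¹ * K) ^ p.toReal ≠ 0 := by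
      simp [ENNReal.rpow_eq_zero_iff, hK0, hρt, hr0, hr0.not_gt]
    have hfact : (ρ⁻¹ * K) ^ p.toReal ≠ ⊤ := by
      refine ENNReal.rpow_ne_top_of_nonneg hr0.le (ENNReal.mul_ne_top (by simpa using hρ0) hKt)
    obtain ⟨v, w, hv, hvb, hw, hwd, huv⟩ := happ (d / (ρ⁻¹ * K) ^ p.toReal)
      (ENNReal.div_pos hd0.ne' hfact)
    have hI : ∫⁻ x, (ρ⁻¹ * K * w x) ^ p.toReal ∂μ < d := by
      simp_rw [ENNReal.mul_rpow_of_nonneg _ _ hr0.le]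
      rw [← ENNReal.mul_rpow_of_nonneg _ _ hr0.le, lintegral_const_mul _ (hw.pow_const _), mul_comm]
      exact (ENNReal.lt_div_iff_mul_lt (Or.inl hfac0) (Or.inl hfact)).1 hwd
    have hI' : ∫⁻ x, (ρ⁻¹ * w x) ^ p.toReal ∂μ ≤ d := by
      refine le_trans (lintegral_mono fun x => ?_) hI.le
      gcongr
      exact le_mul_of_one_le_right' (by simp [hK])
    obtain ⟨N, hsubN, hN, hN0⟩ := exists_measurable_superset_of_null huv
    have hpol := polar_pot_ne_zero (γ := γ) hr0 (measurable_one.indicator hN)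
      (w := N.indicator (1 : X → ℝ≥0∞)) (indicator_meas_zero hN0)
    have hA := smallCap_lt_pot (γ := γ) hr0 (hw.const_mul (ρ⁻¹ * K)) hI
    have hB := smallCap_lt_enorm_sub hW hα hp hp' hae hq hv hw hρ0 hρt hd0 huv hI'
    refine ((hA.union hr0 hB).union hr0 (hpol d hd0)).mono ?_ hd
    intro x hx
    by_contra hnot
    simp only [mem_union, mem_ofPred_eq, not_or, not_lt, not_not] at hnot
    obtain ⟨⟨h1, h2⟩, h3⟩ := hnot
    apply hx
    rw [pot_const_mul hw] at h1
    have h1' : K * pot γ μ w x ≤ ρ := by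
      rw [mul_assoc] at h1
      have h4 : ρ * (ρ⁻¹ * (K * pot γ μ w x)) ≤ ρ * 1 := by gcongr
      rwa [← mul_assoc, ENNReal.mul_inv_cancel hρ0 hρt, one_mul, mul_one] at h4
    have h5 := ae_ae_of_pot_eq_zero hN h3
    have ht := tendsto_pot_unif (μ := μ) hv hvb x
    filter_upwards [ht.eventually_le_const (pos_iff_ne_zero.2 hρ0)] with n hn
    have := isProbabilityMeasure_unif (scale_pos n)
    have h6 : pot (unif (scale n)) μ (fun z => ‖u z - v z‖ₑ) x ≤ ρ := by
      calc pot (unif (scale n)) μ (fun z => ‖u z - v z‖ₑ) x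
          ≤ pot (unif (scale n)) μ (pot γ μ w) x := by
            refine lintegral_mono_ae ?_
            filter_upwards [(unif_absolutelyContinuous (half_pos hα) _).ae_le h5] with s hs
            refine lintegral_mono_ae ?_
            filter_upwards [hs] with y hy
            by_contra hlt
            exact hy (hsubN hlt)
        _ ≤ ENNReal.ofReal (domConst (α / 2)) * pot γ μ w x :=
            pot_unif_pot_le hW (half_pos hα) (scale_pos n) (scale_le_one n) hw x
        _ ≤ K * pot γ μ w x := by gcongr; exact le_add_self
        _ ≤ ρ := h1'
    -- Error of approximation, oscillation of the continuous `v`, and discrepancy at `x` itself: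
    -- each is at most ρ.
    calc L n x ≤ pot (unif (scale n)) μ (fun z => ‖u z - v z‖ₑ +
            (‖v z - v x‖ₑ + ‖us x - v x‖ₑ)) x := by
          refine pot_mono (fun z => ?_) x
          have : u z - us x = (u z - v z) + ((v z - v x) - (us x - v x)) := by ring
          rw [this]
          refine (enorm_add_le _ _).trans ?_
          gcongr
          exact enorm_sub_le
      _ = pot (unif (scale n)) μ (fun z => ‖u z - v z‖ₑ) x +
            (pot (unif (scale n)) μ (fun z => ‖v z - v x‖ₑ) x + ‖us x - v x‖ₑ) := by
          have hvm := hv.measurable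
          rw [pot_add (by fun_prop : Measurable fun z => ‖u z - v z‖ₑ),
            pot_add (by fun_prop : Measurable fun z => ‖v z - v x‖ₑ), pot_const]
      _ ≤ ρ + (ρ + ρ) := add_le_add h6 (add_le_add hn h2)
      _ = 3 * ρ := by ring
  refine (Polar.iUnion hr0 key).mono fun x hx => ?_
  by_contra hnot
  apply hx
  simp only [mem_iUnion, mem_ofPred_eq, not_exists, not_not] at hnot
  rw [ENNReal.tendsto_nhds_zero]
  intro ε hε
  have hlim : Tendsto (fun k : ℕ => 3 * (k + 1 : ℝ≥0∞)⁻¹) atTop (𝓝 0) := by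
    have h1 := (tendsto_add_atTop_iff_nat 1).2 ENNReal.tendsto_inv_nat_nhds_zero
    simpa using ENNReal.Tendsto.const_mul h1 (Or.inr (by simp : (3 : ℝ≥0∞) ≠ ⊤))
  obtain ⟨k, hk⟩ := (hlim.eventually_le_const hε).exists
  filter_upwards [hnot k] with n hn using hn.trans hk

end LebesguePoints

/-! ### Directional derivatives along H in integrated form. -/

section ShiftCalculus

variable {X : Type*} [NormedAddCommGroup X] [NormedSpace ℝ X] [MeasurableSpace X]
  {H : Type*} [NormedAddCommGroup H] [InnerProductSpace ℝ H] [CompleteSpace H]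
  {ι : H →L[ℝ] X} {μ : Measure X} [BorelSpace X] [CompleteSpace X] [SecondCountableTopology X]

namespace IsAbstractWienerSpace

lemma memLp_dual (hW : IsAbstractWienerSpace ι μ) (ℓ : StrongDual ℝ X) (p : ℝ≥0) :
    MemLp ℓ p μ := by
  have h := memLp_id_gaussianReal (μ := 0) (v := ‖dualVec ι ℓ‖₊ ^ 2) p
  rw [← hW.gaussian ℓ] at h
  simpa using (memLp_map_measure_iff (f := ℓ) (by fun_prop) (by fun_prop)).1 h

lemma lintegral_enorm_dual_lt_top (hW : IsAbstractWienerSpace ι μ) (ℓ : StrongDual ℝ X) :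
    ∫⁻ y, ‖ℓ y‖ₑ ∂μ < ⊤ := by
  have h := (hW.memLp_dual ℓ 1).2
  simpa [eLpNorm_one_eq_lintegral_enorm] using h

lemma lintegral_dual_sq (hW : IsAbstractWienerSpace ι μ) (ℓ : StrongDual ℝ X) :
    ∫⁻ y, ‖ℓ y‖ₑ ^ (2 : ℝ) ∂μ = ‖dualVec ι ℓ‖ₑ ^ (2 : ℝ) := by
  have hm := hW.memLp_dual ℓ 2
  have h1 : ∫ y, ℓ y ^ 2 ∂μ = ‖dualVec ι ℓ‖ ^ 2 := by
    have h2 := variance_id_gaussianReal (μ := 0) (v := ‖dualVec ι ℓ‖₊ ^ 2)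
    rw [variance_of_integral_eq_zero aemeasurable_id (by simp), ← hW.gaussian ℓ,
      integral_map (by fun_prop) (by fun_prop)] at h2
    simpa using h2
  have h3 : ∀ t : ℝ, ‖t‖ₑ ^ (2 : ℝ) = ENNReal.ofReal (t ^ 2) := fun t => by
    rw [Real.enorm_eq_ofReal_abs, ENNReal.rpow_two, ← ENNReal.ofReal_pow (abs_nonneg _), sq_abs]
  simp_rw [h3]
  rw [← ofReal_integral_eq_lintegral_ofReal hm.integrable_sq (ae_of_all _ fun y => sq_nonneg _), h1,
    ← h3]
  simp

/-- Integration by parts, in integrated form. -/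
lemma integral_shift_sub (hW : IsAbstractWienerSpace ι μ) (ℓ : StrongDual ℝ X) {Z : X → ℝ}
    (hZ : Measurable Z) {C : ℝ} (hC : ∀ x, |Z x| ≤ C) {θ : ℝ} (hθ : 0 ≤ θ) :
    ∫ y, Z (y + ι (θ • dualVec ι ℓ)) ∂μ - ∫ y, Z y ∂μ =
      ∫ s in (0 : ℝ)..θ, ∫ y, ℓ y * Z (y + ι (s • dualVec ι ℓ)) ∂μ := by
  have := hW.isProbabilityMeasure
  set k := dualVec ι ℓ with hk
  have hℓk : ℓ (ι k) = ‖k‖ ^ 2 := by rw [← inner_dualVec, real_inner_self_eq_norm_sq]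
  set D : ℝ → X → ℝ := fun s y => cmDensity ι (s • ℓ) y with hD
  have hDeq : ∀ s y, D s y = Real.exp (s * ℓ y - s ^ 2 * ‖k‖ ^ 2 / 2) := fun s y => by
    simp [hD, cmDensity, dualVec_smul, norm_smul, mul_pow, hk]
  have hDcont : Continuous fun q : ℝ × X => D q.1 q.2 := by
    simp only [hDeq]; fun_prop
  have hshift : ∀ s, ∫ y, Z (y + ι (s • k)) ∂μ = ∫ y, D s y * Z y ∂μ := fun s => by
    rw [hk, ← dualVec_smul, hW.integral_add_dualVec _ hZ]
  -- The derivative of the Cameron–Martin density in s has the factor ℓ - s‖k‖²; translating back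
  -- turns this factor into ℓ.
  have hshift' : ∀ s, ∫ y, ℓ y * Z (y + ι (s • k)) ∂μ =
      ∫ y, D s y * (ℓ y - s * ‖k‖ ^ 2) * Z y ∂μ := fun s => by
    have h := hW.integral_add_dualVec (s • ℓ) (w := fun y => (ℓ y - s * ‖k‖ ^ 2) * Z y)
      (by fun_prop)
    simp only [dualVec_smul, ← hk, map_add, map_smul, smul_eq_mul, hℓk, add_sub_cancel_right,
      ← mul_assoc] at h
    simpa only [map_smul] using h
  have hderiv : ∀ y s, HasDerivAt (fun s => D s y * Z y) (D s y * (ℓ y - s * ‖k‖ ^ 2) * Z y) s := by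
    intro y s
    simp only [hDeq]
    have h1 : HasDerivAt (fun s : ℝ => s * ℓ y - s ^ 2 * ‖k‖ ^ 2 / 2) (ℓ y - s * ‖k‖ ^ 2) s := by
      have := ((hasDerivAt_id s).mul_const (ℓ y)).sub
        (((hasDerivAt_pow 2 s).mul_const (‖k‖ ^ 2)).div_const 2)
      refine this.congr_deriv ?_
      simp
      ring
    exact h1.exp.mul_const _
  have hint : Integrable (Function.uncurry fun (s : ℝ) y => D s y * (ℓ y - s * ‖k‖ ^ 2) * Z y)
      ((volume.restrict (Ioc 0 θ)).prod μ) := by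
    have hmeas : Measurable
        (Function.uncurry fun (s : ℝ) y => D s y * (ℓ y - s * ‖k‖ ^ 2) * Z y) := by
      refine Measurable.mul ?_ (hZ.comp measurable_snd)
      exact (hDcont.mul (by fun_prop)).measurable
    refine ⟨hmeas.aestronglyMeasurable, ?_⟩
    rw [hasFiniteIntegral_iff_enorm, lintegral_prod _ hmeas.enorm.aemeasurable]
    -- Undoing the translation shows that the integral of the density times |ℓ - s‖k‖²| is that of
    -- |ℓ|, uniformly in s. This justifies Fubini.
    have hbd : ∀ s, ∫⁻ y, ‖D s y * (ℓ y - s * ‖k‖ ^ 2) * Z y‖ₑ ∂μ ≤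
        (∫⁻ y, ‖ℓ y‖ₑ ∂μ) * ENNReal.ofReal C := by
      intro s
      calc _ ≤ ∫⁻ y, (ENNReal.ofReal (D s y) * ‖ℓ y - s * ‖k‖ ^ 2‖ₑ) * ENNReal.ofReal C ∂μ := by
            refine lintegral_mono fun y => ?_
            rw [enorm_mul, enorm_mul, Real.enorm_eq_ofReal (r := D s y) (Real.exp_pos _).le]
            gcongr
            rw [Real.enorm_eq_ofReal_abs]
            exact ENNReal.ofReal_le_ofReal (hC y)
        _ = (∫⁻ y, ‖ℓ y‖ₑ ∂μ) * ENNReal.ofReal C := by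
            rw [lintegral_mul_const _ (by
              have : Continuous fun y => D s y := continuous_cmDensity _
              fun_prop)]
            congr 1
            have h := hW.lintegral_add_dualVec (s • ℓ) (w := fun y => ‖ℓ y - s * ‖k‖ ^ 2‖ₑ)
              (by fun_prop)
            simp only [dualVec_smul, ← hk, map_add, map_smul, smul_eq_mul, hℓk,
              add_sub_cancel_right] at h
            rw [h]
    refine (lintegral_mono fun s => hbd s).trans_lt ?_
    rw [lintegral_const]
    exact ENNReal.mul_lt_top (ENNReal.mul_lt_top (hW.lintegral_enorm_dual_lt_top ℓ) (by simp))
      (by simp)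
  have hDZ : ∀ s, Integrable (fun y => D s y * Z y) μ := fun s =>
    (hW.integrable_cmDensity _).mul_bdd (c := C) hZ.aestronglyMeasurable (ae_of_all _ hC)
  have h0 : ∫ y, Z y ∂μ = ∫ y, D 0 y * Z y ∂μ := by simp [hDeq]
  rw [hshift, h0, ← integral_sub (hDZ θ) (hDZ 0), intervalIntegral.integral_of_le hθ]
  simp_rw [hshift']
  rw [integral_integral_swap hint]
  refine integral_congr_ae (ae_of_all _ fun y => ?_)
  simp only
  rw [← intervalIntegral.integral_of_le hθ]
  refine (intervalIntegral.integral_eq_sub_of_hasDerivAt (fun s _ => hderiv y s) ?_).symm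
  refine Continuous.intervalIntegrable ?_ _ _
  have : Continuous fun s => D s y := hDcont.comp (by fun_prop : Continuous fun s => (s, y))
  fun_prop

/-- Translations along `H` preserve null sets. -/
lemma ae_add (hW : IsAbstractWienerSpace ι μ) (h : H) {P : X → Prop} (hP : ∀ᵐ x ∂μ, P x) :
    ∀ᵐ x ∂μ, P (x + ι h) := by
  obtain ⟨N, hsub, hN, hN0⟩ := exists_measurable_superset_of_null hP
  have h1 := hW.lintegral_add_le h (measurable_one.indicator hN : Measurable (N.indicator
    (1 : X → ℝ≥0∞)))
  have h2 : ∀ y, N.indicator (1 : X → ℝ≥0∞) y ^ (2 : ℝ) = N.indicator 1 y := fun y => by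
    by_cases hy : y ∈ N <;> simp [hy]
  simp_rw [h2] at h1
  rw [lintegral_indicator_one hN, hN0, ENNReal.zero_rpow_of_pos (by norm_num), mul_zero,
    nonpos_iff_eq_zero] at h1
  have hm : Measurable fun y => N.indicator (1 : X → ℝ≥0∞) (y + ι h) :=
    (measurable_one.indicator hN).comp (by fun_prop : Measurable fun y => y + ι h)
  rw [lintegral_eq_zero_iff hm] at h1
  filter_upwards [h1] with x hx
  by_contra hn
  have : x + ι h ∈ N := hsub hn
  simp [this] at hx

lemma ae_of_ae_add (hW : IsAbstractWienerSpace ι μ) (h : H) {P : X → Prop}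
    (hP : ∀ᵐ x ∂μ, P (x + ι h)) : ∀ᵐ x ∂μ, P x := by
  simpa using hW.ae_add (-h) hP

/-- Integrals along segments in the directions of `H`. -/
lemma lintegral_lintegral_line_le (hW : IsAbstractWienerSpace ι μ) (k : H) {w : X → ℝ≥0∞}
    (hw : Measurable w) {T : ℝ} (hT : 0 ≤ T) :
    ∫⁻ x, (∫⁻ s in Ioc 0 T, w (x + ι (s • k))) ∂μ ≤
      ENNReal.ofReal (T * Real.exp ((T * ‖k‖) ^ 2 / 2)) *
        (∫⁻ x, w x ^ (2 : ℝ) ∂μ) ^ (1 / 2 : ℝ) := by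
  have := hW.isProbabilityMeasure
  have hm : Measurable fun q : X × ℝ => w (q.1 + ι (q.2 • k)) := hw.comp (by fun_prop)
  rw [lintegral_lintegral_swap hm.aemeasurable]
  calc ∫⁻ s in Ioc 0 T, ∫⁻ x, w (x + ι (s • k)) ∂μ
      ≤ ∫⁻ s in Ioc 0 T, ENNReal.ofReal (Real.exp ((T * ‖k‖) ^ 2 / 2)) *
        (∫⁻ x, w x ^ (2 : ℝ) ∂μ) ^ (1 / 2 : ℝ) := by
        refine setLIntegral_mono measurable_const fun s hs => ?_
        refine (hW.lintegral_add_le (s • k) hw).trans ?_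
        gcongr
        rw [norm_smul, Real.norm_of_nonneg hs.1.le]
        gcongr
        exact hs.2
    _ = _ := by
        rw [setLIntegral_const, Real.volume_Ioc, sub_zero, ENNReal.ofReal_mul hT]
        ring

end IsAbstractWienerSpace

/-- `w` is the derivative of `u` in the direction `k`, in integrated form. -/
def ShiftDeriv (ι : H →L[ℝ] X) (μ : Measure X) (k : H) (u w : X → ℝ) : Prop :=
  ∀ τ : ℝ, 0 ≤ τ → ∀ᵐ x ∂μ, u (x + ι (τ • k)) - u x = ∫ s in (0 : ℝ)..τ, w (x + ι (s • k))

lemma ae_intervalIntegrable_line (hW : IsAbstractWienerSpace ι μ) (k : H) {w : X → ℝ}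
    (hw : Measurable w) (h2 : ∫⁻ x, ‖w x‖ₑ ^ (2 : ℝ) ∂μ ≠ ⊤) {T : ℝ} (hT : 0 ≤ T) :
    ∀ᵐ x ∂μ, IntervalIntegrable (fun s => w (x + ι (s • k))) volume 0 T := by
  have hm : Measurable fun q : X × ℝ => ‖w (q.1 + ι (q.2 • k))‖ₑ :=
    (hw.comp (by fun_prop : Measurable fun q : X × ℝ => q.1 + ι (q.2 • k))).enorm
  have h := hW.lintegral_lintegral_line_le k hw.enorm hT
  have h3 : ∫⁻ x, (∫⁻ s in Ioc 0 T, ‖w (x + ι (s • k))‖ₑ) ∂μ ≠ ⊤ :=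
    (h.trans_lt (ENNReal.mul_lt_top (by simp)
      (ENNReal.rpow_lt_top_of_nonneg (by norm_num) h2))).ne
  filter_upwards [ae_lt_top hm.lintegral_prod_right' h3] with x hx
  rw [intervalIntegrable_iff_integrableOn_Ioc_of_le hT]
  exact ⟨(hw.comp (by fun_prop : Continuous fun s : ℝ => x + ι (s • k)).measurable).aestronglyMeasurable, hx⟩

/-- The directional derivative is a closed operator in `L²`. -/
lemma ShiftDeriv.of_tendsto (hW : IsAbstractWienerSpace ι μ) {k : H} {u w : X → ℝ}
    {un wn : ℕ → X → ℝ} (hu : Measurable u) (hw : Measurable w) (hun : ∀ n, Measurable (un n))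
    (hwn : ∀ n, Measurable (wn n)) (h : ∀ n, ShiftDeriv ι μ k (un n) (wn n))
    (hw2 : ∫⁻ x, ‖w x‖ₑ ^ (2 : ℝ) ∂μ ≠ ⊤)
    (hlu : Tendsto (fun n => ∫⁻ x, ‖u x - un n x‖ₑ ^ (2 : ℝ) ∂μ) atTop (𝓝 0))
    (hlw : Tendsto (fun n => ∫⁻ x, ‖w x - wn n x‖ₑ ^ (2 : ℝ) ∂μ) atTop (𝓝 0)) :
    ShiftDeriv ι μ k u w := by
  have := hW.isProbabilityMeasure
  intro τ hτ
  set E : X → ℝ := fun x => u (x + ι (τ • k)) - u x - ∫ s in (0 : ℝ)..τ, w (x + ι (s • k)) with hE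
  have hline : ∀ {f : X → ℝ}, Measurable f →
      Measurable fun x => ∫ s in (0 : ℝ)..τ, f (x + ι (s • k)) := by
    intro f hf
    simp only [intervalIntegral.integral_of_le hτ]
    have hm : Measurable fun q : X × ℝ => f (q.1 + ι (q.2 • k)) := hf.comp (by fun_prop)
    exact hm.stronglyMeasurable.integral_prod_right'.measurable
  have hEm : Measurable E :=
    ((hu.comp (by fun_prop : Measurable fun x => x + ι (τ • k))).sub hu).sub (hline hw)
  set a : ℕ → ℝ≥0∞ := fun n => (∫⁻ x, ‖u x - un n x‖ₑ ^ (2 : ℝ) ∂μ) ^ (1 / 2 : ℝ) with ha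
  set b : ℕ → ℝ≥0∞ := fun n => (∫⁻ x, ‖w x - wn n x‖ₑ ^ (2 : ℝ) ∂μ) ^ (1 / 2 : ℝ) with hb
  set C1 : ℝ≥0∞ := ENNReal.ofReal (Real.exp (‖τ • k‖ ^ 2 / 2)) with hC1
  set C0 : ℝ≥0∞ := ENNReal.ofReal (Real.exp (‖(0 : H)‖ ^ 2 / 2)) with hC0
  set C2 : ℝ≥0∞ := ENNReal.ofReal (τ * Real.exp ((τ * ‖k‖) ^ 2 / 2)) with hC2
  -- The approximants have no defect, so the defect `E` only involves differences, and translations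
  -- along `H` are bounded from `L²` to `L¹`.
  have hbound : ∀ᶠ n in atTop, ∫⁻ x, ‖E x‖ₑ ∂μ ≤ C1 * a n + (C0 * a n + C2 * b n) := by
    have hfin : ∀ᶠ n in atTop, ∫⁻ x, ‖w x - wn n x‖ₑ ^ (2 : ℝ) ∂μ < ⊤ :=
      hlw.eventually_lt_const ENNReal.zero_lt_top
    filter_upwards [hfin] with n hn
    have hsub : Measurable fun x => w x - wn n x := hw.sub (hwn n)
    have hmu : Measurable fun x => ‖u x - un n x‖ₑ := (hu.sub (hun n)).enorm
    have hmw : Measurable fun q : X × ℝ => ‖w (q.1 + ι (q.2 • k)) - wn n (q.1 + ι (q.2 • k))‖ₑ :=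
      hsub.enorm.comp (by fun_prop : Measurable fun q : X × ℝ => q.1 + ι (q.2 • k))
    calc ∫⁻ x, ‖E x‖ₑ ∂μ ≤ ∫⁻ x, (‖u (x + ι (τ • k)) - un n (x + ι (τ • k))‖ₑ +
          (‖u (x + ι 0) - un n (x + ι 0)‖ₑ + ∫⁻ s in Ioc 0 τ,
            ‖w (x + ι (s • k)) - wn n (x + ι (s • k))‖ₑ)) ∂μ := by
          refine lintegral_mono_ae ?_
          filter_upwards [h n τ hτ, ae_intervalIntegrable_line hW k hw hw2 hτ,
            ae_intervalIntegrable_line hW k hsub hn.ne hτ] with x h1 h2 h3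
          have h4 : ∫ s in (0 : ℝ)..τ, (w (x + ι (s • k)) - wn n (x + ι (s • k))) =
              (∫ s in (0 : ℝ)..τ, w (x + ι (s • k))) -
                ∫ s in (0 : ℝ)..τ, wn n (x + ι (s • k)) := by
            refine intervalIntegral.integral_sub h2 ?_
            simpa using h2.sub h3
          have h5 : E x = (u (x + ι (τ • k)) - un n (x + ι (τ • k))) -
              ((u (x + ι 0) - un n (x + ι 0)) +
              ∫ s in (0 : ℝ)..τ, (w (x + ι (s • k)) - wn n (x + ι (s • k)))) := by
            rw [h4, ← h1, hE, map_zero, add_zero]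
            ring
          rw [h5]
          refine enorm_sub_le.trans ?_
          gcongr
          refine (enorm_add_le _ _).trans ?_
          gcongr
          rw [intervalIntegral.integral_of_le hτ]
          exact enorm_integral_le_lintegral_enorm _
      _ = ∫⁻ x, ‖u (x + ι (τ • k)) - un n (x + ι (τ • k))‖ₑ ∂μ +
          (∫⁻ x, ‖u (x + ι 0) - un n (x + ι 0)‖ₑ ∂μ + ∫⁻ x, (∫⁻ s in Ioc 0 τ,
            ‖w (x + ι (s • k)) - wn n (x + ι (s • k))‖ₑ) ∂μ) := by
          rw [lintegral_add_left, lintegral_add_left]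
          exacts [hmu.comp (by fun_prop : Measurable fun x => x + ι 0),
            hmu.comp (by fun_prop : Measurable fun x => x + ι (τ • k))]
      _ ≤ C1 * a n + (C0 * a n + C2 * b n) := by
          gcongr
          · exact hW.lintegral_add_le (τ • k) hmu
          · exact hW.lintegral_add_le 0 hmu
          · exact hW.lintegral_lintegral_line_le k hsub.enorm hτ
  have hlim : Tendsto (fun n => C1 * a n + (C0 * a n + C2 * b n)) atTop (𝓝 0) := by
    have hcont := (ENNReal.continuous_rpow_const (y := (1 / 2 : ℝ))).tendsto 0
    rw [ENNReal.zero_rpow_of_pos (by norm_num)] at hcont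
    have h1 : Tendsto a atTop (𝓝 0) := hcont.comp hlu
    have h2 : Tendsto b atTop (𝓝 0) := hcont.comp hlw
    have h3 := (ENNReal.Tendsto.const_mul h1 (Or.inr (ENNReal.ofReal_ne_top : C1 ≠ ⊤))).add
      ((ENNReal.Tendsto.const_mul h1 (Or.inr (ENNReal.ofReal_ne_top : C0 ≠ ⊤))).add
      (ENNReal.Tendsto.const_mul h2 (Or.inr (ENNReal.ofReal_ne_top : C2 ≠ ⊤))))
    rwa [mul_zero, mul_zero, mul_zero, add_zero, add_zero] at h3
  have hzero : ∫⁻ x, ‖E x‖ₑ ∂μ = 0 := le_antisymm (ge_of_tendsto hlim hbound) zero_le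
  rw [lintegral_eq_zero_iff hEm.enorm] at hzero
  filter_upwards [hzero] with x hx
  simpa [hE, sub_eq_zero] using hx

/-- The integrated derivative is the limit of difference quotients almost everywhere. -/
lemma ShiftDeriv.ae_tendsto (hW : IsAbstractWienerSpace ι μ) {k : H} {u w : X → ℝ}
    (hw : Measurable w) (h : ShiftDeriv ι μ k u w) (hw2 : ∫⁻ x, ‖w x‖ₑ ^ (2 : ℝ) ∂μ ≠ ⊤) :
    ∀ᵐ x ∂μ, Tendsto (fun n => (scale n)⁻¹ * (u (x + ι (scale n • k)) - u x)) atTop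
      (𝓝 (w x)) := by
  have := hW.isProbabilityMeasure
  set A : ℕ → X → ℝ := fun n x => (scale n)⁻¹ * ∫ s in (0 : ℝ)..(scale n), w (x + ι (s • k)) with hA
  have hAm : ∀ n, Measurable (A n) := by
    intro n
    simp only [hA, intervalIntegral.integral_of_le (scale_pos n).le]
    have hm : Measurable fun q : X × ℝ => w (q.1 + ι (q.2 • k)) := hw.comp (by fun_prop)
    exact (hm.stronglyMeasurable.integral_prod_right'.measurable).const_mul _
  set Q : Set X := {x | Tendsto (fun n => A n x) atTop (𝓝 (w x))} with hQ
  have hQm : MeasurableSet Q := by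
    have h1 : Q = {x | Tendsto (fun n => A n x - w x) atTop (𝓝 0)} := by
      ext x
      simp only [hQ, mem_ofPred_eq]
      exact tendsto_sub_nhds_zero_iff.symm
    rw [h1]
    exact measurableSet_tendsto (𝓝 0) fun n => (hAm n).sub hw
  -- Lebesgue differentiation on almost every line. Integrability up to 2 leaves room for s + `scale
  -- n` with s < 1.
  have hline : ∀ᵐ x ∂μ, ∀ᵐ s : ℝ ∂volume.restrict (Ioo 0 1), x + ι (s • k) ∈ Q := by
    filter_upwards [ae_intervalIntegrable_line hW k hw hw2 (T := 2) (by norm_num)] with x hx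
    rw [ae_restrict_iff' measurableSet_Ioo]
    filter_upwards [hx.ae_hasDerivAt_integral] with s hs hs01
    have hd := hs (by rw [uIcc_of_le (by norm_num)]; exact ⟨hs01.1.le, by linarith [hs01.2]⟩) 0
      (by simp)
    have hd' := hd.tendsto_slope_zero_right
    have ht : Tendsto scale atTop (𝓝[>] 0) := tendsto_nhdsWithin_iff.2
      ⟨tendsto_scale, Eventually.of_forall scale_pos⟩
    refine (hd'.comp ht).congr fun n => ?_
    simp only [Function.comp_apply, smul_eq_mul, hA]
    congr 1
    have hi1 : IntervalIntegrable (fun s => w (x + ι (s • k))) volume 0 (s + scale n) :=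
      hx.mono_set (by
        rw [uIcc_of_le (by linarith [hs01.1, scale_pos n]), uIcc_of_le (by norm_num)]
        exact Icc_subset_Icc_right (by linarith [hs01.2, scale_le_one n]))
    have hi2 : IntervalIntegrable (fun s => w (x + ι (s • k))) volume 0 s :=
      hx.mono_set (by
        rw [uIcc_of_le hs01.1.le, uIcc_of_le (by norm_num)]
        exact Icc_subset_Icc_right (by linarith [hs01.2]))
    rw [intervalIntegral.integral_interval_sub_left hi1 hi2]
    have h2 := intervalIntegral.integral_comp_add_left (a := 0) (b := scale n)
      (fun s => w (x + ι (s • k))) s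
    rw [add_zero] at h2
    rw [← h2]
    simp only [add_smul, map_add, add_assoc]
  have hswap : ∀ᵐ s : ℝ ∂volume.restrict (Ioo 0 1), ∀ᵐ x ∂μ, x + ι (s • k) ∈ Q := by
    have hm : MeasurableSet {q : X × ℝ | q.1 + ι (q.2 • k) ∈ Q} :=
      hQm.preimage (by fun_prop : Measurable fun q : X × ℝ => q.1 + ι (q.2 • k))
    exact (Measure.ae_ae_comm hm).1 hline
  have : NeBot (ae (volume.restrict (Ioo (0 : ℝ) 1))) := by
    rw [ae_neBot, Ne, Measure.restrict_eq_zero]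
    simp
  -- By Fubini a single s works for almost every x, and quasi-invariance then removes the
  -- translation by s k.
  obtain ⟨s, hs⟩ := hswap.exists
  have hQae := hW.ae_of_ae_add (s • k) hs
  have hall : ∀ᵐ x ∂μ, ∀ n, u (x + ι (scale n • k)) - u x =
      ∫ s in (0 : ℝ)..(scale n), w (x + ι (s • k)) :=
    ae_all_iff.2 fun n => h _ (scale_pos n).le
  filter_upwards [hQae, hall] with x h1 h2
  refine Tendsto.congr (fun n => ?_) h1
  simp only [hA, h2]

end ShiftCalculus

/-! ### Integral representation of the derivative of a Bessel potential. -/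

section Representation

variable {X : Type*} [NormedAddCommGroup X] [NormedSpace ℝ X] [MeasurableSpace X]
  {H : Type*} [NormedAddCommGroup H] [InnerProductSpace ℝ H] [CompleteSpace H]
  {ι : H →L[ℝ] X} {μ : Measure X} [BorelSpace X] [CompleteSpace X] [SecondCountableTopology X]

/-- Separates the Gaussian factor from the function it multiplies. The free parameter later makes
errors small and bounds linear in the direction. -/
lemma enorm_mul_le_weighted (a b : ℝ≥0∞) {t : ℝ≥0∞} (ht : t ≠ 0) (ht' : t ≠ ⊤) :
    a * b ≤ t * a ^ (2 : ℝ) + t⁻¹ * b ^ (2 : ℝ) := by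
  rw [ENNReal.rpow_two, ENNReal.rpow_two]
  rcases le_total b (t * a) with h | h
  · calc a * b ≤ a * (t * a) := by gcongr
      _ = t * a ^ 2 := by ring
      _ ≤ _ := le_self_add
  · calc a * b = t⁻¹ * (t * a) * b := by
          rw [← mul_assoc, ENNReal.inv_mul_cancel ht ht', one_mul]
      _ ≤ t⁻¹ * b * b := by gcongr
      _ = t⁻¹ * b ^ 2 := by ring
      _ ≤ _ := le_add_self

section KerOp

/-- Integral operators of Mehler type. -/
def kerOp (ν : Measure (ℝ × X)) (κ : ℝ × X → ℝ) (g : X → ℝ) (x : X) : ℝ :=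
  ∫ z, κ z * g (mix z.1 x z.2) ∂ν

variable {ν : Measure (ℝ × X)} [SFinite ν] {κ : ℝ × X → ℝ}

lemma measurable_kerOp (hκ : Measurable κ) {g : X → ℝ} (hg : Measurable g) :
    Measurable (kerOp ν κ g) := by
  have hm : Measurable fun q : X × ℝ × X => κ q.2 * g (mix q.2.1 q.1 q.2.2) :=
    (hκ.comp measurable_snd).mul
      (hg.comp (by fun_prop : Continuous fun q : X × ℝ × X => mix q.2.1 q.1 q.2.2).measurable)
  exact hm.stronglyMeasurable.integral_prod_right'.measurable

lemma integrable_kerOp_bdd (hκ : Integrable κ ν) {g : X → ℝ} (hg : Measurable g) {C : ℝ}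
    (hC : ∀ x, |g x| ≤ C) (x : X) : Integrable (fun z => κ z * g (mix z.1 x z.2)) ν :=
  hκ.mul_bdd (c := C) (hg.comp
    (by fun_prop : Continuous fun z : ℝ × X => mix z.1 x z.2).measurable).aestronglyMeasurable
    (ae_of_all _ fun _ => hC _)

lemma continuous_kerOp (hκ : Integrable κ ν) {g : X → ℝ} (hg : Continuous g) {C : ℝ}
    (hC : ∀ x, |g x| ≤ C) : Continuous (kerOp ν κ g) := by
  refine continuous_of_dominated (bound := fun z => ‖κ z‖ * C)
    (fun x => (integrable_kerOp_bdd hκ hg.measurable hC x).aestronglyMeasurable)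
    (fun x => ae_of_all _ fun z => ?_) (hκ.norm.mul_const C) (ae_of_all _ fun z => by fun_prop)
  rw [norm_mul]
  gcongr
  exact hC _

lemma abs_kerOp_le (hκ : Integrable κ ν) {g : X → ℝ} {C : ℝ}
    (hC : ∀ x, |g x| ≤ C) (x : X) : |kerOp ν κ g x| ≤ ∫ z, ‖κ z‖ * C ∂ν := by
  rw [← Real.norm_eq_abs]
  unfold kerOp
  refine norm_integral_le_of_norm_le (hκ.norm.mul_const C) (ae_of_all _ fun z => ?_)
  rw [norm_mul]
  gcongr
  exact hC _

lemma enorm_kerOp_le (κ : ℝ × X → ℝ) (g : X → ℝ) (x : X) :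
    ‖kerOp ν κ g x‖ₑ ≤ ∫⁻ z, ‖κ z * g (mix z.1 x z.2)‖ₑ ∂ν :=
  enorm_integral_le_lintegral_enorm _

lemma kerOp_sub {g g' : X → ℝ} {x : X} (h : Integrable (fun z => κ z * g (mix z.1 x z.2)) ν)
    (h' : Integrable (fun z => κ z * g' (mix z.1 x z.2)) ν) :
    kerOp ν κ g x - kerOp ν κ g' x = kerOp ν κ (fun z => g z - g' z) x := by
  simp only [kerOp, ← integral_sub h h', mul_sub]

end KerOp

/-- The time weight of the derivative of the Bessel potential. -/
def derivCoef (a s : ℝ) : ℝ := s / a * (Real.exp (-s) / √(1 - Real.exp (-2 * s)))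

lemma sqrt_pos_of_pos {s : ℝ} (hs : 0 < s) : 0 < √(1 - Real.exp (-2 * s)) := by
  rw [Real.sqrt_pos, sub_pos, Real.exp_lt_one_iff]; linarith

lemma derivCoef_nonneg {a s : ℝ} (ha : 0 < a) (hs : 0 < s) : 0 ≤ derivCoef a s := by
  unfold derivCoef; positivity

/-- The claim reduces to 1 + s² ≤ e^{2s}, a consequence of 1 + s ≤ e^s. The factor s, gained by
lowering the Gamma parameter, thus absorbs the s^{-1/2} singularity of differentiation. -/
lemma derivCoef_le {a s : ℝ} (ha : 0 < a) (hs : 0 < s) : derivCoef a s ≤ a⁻¹ := by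
  have h1 : s * Real.exp (-s) ≤ √(1 - Real.exp (-2 * s)) := by
    refine Real.le_sqrt_of_sq_le ?_
    have h2 : Real.exp (-2 * s) = Real.exp (-s) ^ 2 := by
      rw [← Real.exp_nat_mul]; push_cast; ring_nf
    have h3 : Real.exp (-s) * Real.exp s = 1 := by rw [← Real.exp_add]; simp
    have h4 : 1 + s ≤ Real.exp s := by linarith [Real.add_one_le_exp s]
    have h5 : (1 + s) ^ 2 ≤ Real.exp s ^ 2 := by gcongr
    have h6 : Real.exp (-s) ^ 2 * (1 + s) ^ 2 ≤ 1 := by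
      calc Real.exp (-s) ^ 2 * (1 + s) ^ 2 ≤ Real.exp (-s) ^ 2 * Real.exp s ^ 2 := by gcongr
        _ = 1 := by rw [← mul_pow, h3, one_pow]
    rw [h2]
    nlinarith [sq_nonneg (Real.exp (-s)), mul_nonneg (sq_nonneg (Real.exp (-s))) hs.le]
  have hσ := sqrt_pos_of_pos hs
  calc derivCoef a s = a⁻¹ * (s * Real.exp (-s) / √(1 - Real.exp (-2 * s))) := by
        unfold derivCoef; field_simp
    _ ≤ a⁻¹ * 1 := by
        gcongr
        exact (div_le_one hσ).2 h1
    _ = a⁻¹ := mul_one _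

lemma measurable_derivCoef (a : ℝ) : Measurable (derivCoef a) := by
  unfold derivCoef; fun_prop

lemma enorm_derivCoef_le {a s : ℝ} (ha : 0 < a) (hs : 0 < s) :
    ‖derivCoef a s‖ₑ ≤ ENNReal.ofReal a⁻¹ := by
  rw [Real.enorm_eq_ofReal (derivCoef_nonneg ha hs)]
  exact ENNReal.ofReal_le_ofReal (derivCoef_le ha hs)

/-- The kernel of the derivative of the Bessel potential in the direction represented by `ℓ`. -/
def derivKer (a : ℝ) (ℓ : StrongDual ℝ X) (z : ℝ × X) : ℝ := derivCoef a z.1 * ℓ z.2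

lemma measurable_derivKer (a : ℝ) (ℓ : StrongDual ℝ X) : Measurable (derivKer a ℓ) :=
  ((measurable_derivCoef a).comp measurable_fst).mul (by fun_prop)

/-- The weight that dominates the derivative of the Bessel potential. -/
def derivWeight (a : ℝ) (t : ℝ≥0∞) (k : H) (w : X → ℝ≥0∞) (x : X) : ℝ≥0∞ :=
  ENNReal.ofReal a⁻¹ * (t * ‖k‖ₑ ^ (2 : ℝ) + t⁻¹ * w x ^ (2 : ℝ))

lemma measurable_derivWeight (a : ℝ) (t : ℝ≥0∞) (k : H) {w : X → ℝ≥0∞} (hw : Measurable w) :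
    Measurable (derivWeight a t k w) := by
  unfold derivWeight; fun_prop

/-- The kernel splits off ℓ(y)², whose integral is ‖k‖², and leaves the square of `u`; what remains
is an ordinary potential with the same Gamma law. -/
lemma lintegral_derivKer_le (hW : IsAbstractWienerSpace ι μ) {a : ℝ} (ha : 0 < a)
    (ℓ : StrongDual ℝ X) {u : X → ℝ} (hu : Measurable u) {t : ℝ≥0∞} (ht : t ≠ 0) (ht' : t ≠ ⊤)
    (x : X) :
    ∫⁻ z, ‖derivKer a ℓ z * u (mix z.1 x z.2)‖ₑ ∂((gammaMeasure a 1).prod μ) ≤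
      pot (gammaMeasure a 1) μ (derivWeight a t (dualVec ι ℓ) fun z => ‖u z‖ₑ) x := by
  have := hW.isProbabilityMeasure
  have := isProbabilityMeasure_gammaMeasure ha one_pos
  have hmix : Continuous fun z : ℝ × X => mix z.1 x z.2 := by fun_prop
  have hm : Measurable fun z : ℝ × X => ‖derivKer a ℓ z * u (mix z.1 x z.2)‖ₑ :=
    ((measurable_derivKer a ℓ).mul (hu.comp hmix.measurable)).enorm
  rw [lintegral_prod _ hm.aemeasurable]
  refine lintegral_mono_ae ?_
  filter_upwards [ae_pos_gammaMeasure a] with s hs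
  have hus : Measurable fun y => ‖u (mix s x y)‖ₑ :=
    (hu.comp (by fun_prop : Continuous fun y => mix s x y).measurable).enorm
  calc ∫⁻ y, ‖derivKer a ℓ (s, y) * u (mix s x y)‖ₑ ∂μ
      ≤ ∫⁻ y, ENNReal.ofReal a⁻¹ * (t * ‖ℓ y‖ₑ ^ (2 : ℝ) +
          t⁻¹ * ‖u (mix s x y)‖ₑ ^ (2 : ℝ)) ∂μ := by
        refine lintegral_mono fun y => ?_
        rw [derivKer, enorm_mul, enorm_mul, mul_assoc]
        exact mul_le_mul' (enorm_derivCoef_le ha hs) (enorm_mul_le_weighted _ _ ht ht')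
    _ = ∫⁻ y, ENNReal.ofReal a⁻¹ * (t * ‖dualVec ι ℓ‖ₑ ^ (2 : ℝ) +
          t⁻¹ * ‖u (mix s x y)‖ₑ ^ (2 : ℝ)) ∂μ := by
        rw [lintegral_const_mul _ (by fun_prop), lintegral_const_mul _ (by fun_prop),
          lintegral_add_left (by fun_prop), lintegral_add_left (by fun_prop),
          lintegral_const_mul _ (by fun_prop), hW.lintegral_dual_sq]
        simp
    _ = _ := rfl

lemma integrable_derivKer (hW : IsAbstractWienerSpace ι μ) {a : ℝ} (ha : 0 < a)
    (ℓ : StrongDual ℝ X) : Integrable (derivKer a ℓ) ((gammaMeasure a 1).prod μ) := by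
  have := hW.isProbabilityMeasure
  have := isProbabilityMeasure_gammaMeasure ha one_pos
  refine ⟨(measurable_derivKer a ℓ).aestronglyMeasurable, ?_⟩
  have h := lintegral_derivKer_le hW ha ℓ (u := fun _ => 1) measurable_const (t := 1)
    one_ne_zero ENNReal.one_ne_top 0
  simp only [mul_one] at h
  refine h.trans_lt ?_
  unfold derivWeight
  rw [pot_const]
  exact ENNReal.mul_lt_top (by simp) (by simp)

lemma integral_gammaMeasure_succ {a : ℝ} (ha : 0 < a) (φ : ℝ → ℝ) :
    ∫ s, φ s ∂(gammaMeasure (a + 1) 1) = ∫ s, s / a * φ s ∂(gammaMeasure a 1) := by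
  have hG := Real.Gamma_pos_of_pos ha
  rw [gammaMeasure, gammaMeasure, integral_withDensity_eq_integral_toReal_smul
    (measurable_gammaPDF _ _) (by simp [gammaPDF]), integral_withDensity_eq_integral_toReal_smul
    (measurable_gammaPDF _ _) (by simp [gammaPDF])]
  refine integral_congr_ae ?_
  have h0 : ∀ᵐ r : ℝ, r ≠ 0 := by simp [ae_iff]
  filter_upwards [h0] with s hs
  rcases lt_or_gt_of_ne hs with h | h
  · rw [gammaPDF_of_neg h, gammaPDF_of_neg h]
    simp
  · have h1 : s ^ a = s ^ (a - 1) * s := by rw [← Real.rpow_add_one h.ne']; simp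
    rw [gammaPDF_one_of_pos h, gammaPDF_one_of_pos h, ENNReal.toReal_ofReal (by positivity),
      ENNReal.toReal_ofReal (by positivity), Real.Gamma_add_one ha.ne']
    simp only [smul_eq_mul, add_sub_cancel_right, h1]
    field_simp

/-- The Bessel potential of order `2 + 2a` as an integral over `ℝ × X`. -/
def besselOp (μ : Measure X) (a : ℝ) (g : X → ℝ) : X → ℝ :=
  kerOp ((gammaMeasure (a + 1) 1).prod μ) (fun _ => 1) g

/-- The derivative of the Bessel potential in the direction represented by `ℓ`. -/
def derivOp (μ : Measure X) (a : ℝ) (ℓ : StrongDual ℝ X) (g : X → ℝ) : X → ℝ :=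
  kerOp ((gammaMeasure a 1).prod μ) (derivKer a ℓ) g

lemma besselOp_eq_besselPotential (hW : IsAbstractWienerSpace ι μ) {α : ℝ} (hα : 0 < α)
    {g : X → ℝ} {x : X}
    (h : Integrable (fun z : ℝ × X => g (mix z.1 x z.2))
      ((gammaMeasure (α / 2 + 1) 1).prod μ)) :
    besselOp μ (α / 2) g x = besselPotential μ (2 + α) g x := by
  have := hW.isProbabilityMeasure
  have := isProbabilityMeasure_gammaMeasure (a := α / 2 + 1) (by positivity) one_pos
  rw [besselPotential_eq (by positivity), besselOp, kerOp, show (2 + α) / 2 = α / 2 + 1 by ring]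
  simp only [one_mul]
  exact integral_prod _ h

/-- Integration by parts at each fixed time, then integration over time. The factor s/a comes from
rewriting the Gamma law of parameter a + 1 through that of parameter a. -/
lemma shiftDeriv_besselOp (hW : IsAbstractWienerSpace ι μ) {a : ℝ} (ha : 0 < a)
    (ℓ : StrongDual ℝ X) {g : X → ℝ} (hg : Continuous g) {C : ℝ} (hC : ∀ x, |g x| ≤ C) :
    ShiftDeriv ι μ (dualVec ι ℓ) (besselOp μ a g) (derivOp μ a ℓ g) := by
  have := hW.isProbabilityMeasure
  have := isProbabilityMeasure_gammaMeasure ha one_pos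
  have := isProbabilityMeasure_gammaMeasure (a := a + 1) (by positivity) one_pos
  intro τ hτ
  refine ae_of_all _ fun x => ?_
  set k := dualVec ι ℓ with hk
  set P : ℝ → X → ℝ := fun s z => ∫ y, g (mix s z y) ∂μ with hP
  set Q : ℝ → X → ℝ := fun s z => ∫ y, ℓ y * g (mix s z y) ∂μ with hQ
  have hint1 : ∀ z, Integrable (fun q : ℝ × X => (1 : ℝ) * g (mix q.1 z q.2))
      ((gammaMeasure (a + 1) 1).prod μ) := fun z =>
    integrable_kerOp_bdd (integrable_const _) hg.measurable hC z
  have hbes : ∀ z, besselOp μ a g z = ∫ s, P s z ∂(gammaMeasure (a + 1) 1) := fun z => by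
    rw [besselOp, kerOp, integral_prod _ (hint1 z)]
    simp only [one_mul, hP]
  have hder : ∀ z, derivOp μ a ℓ g z = ∫ s, derivCoef a s * Q s z ∂(gammaMeasure a 1) := fun z => by
    rw [derivOp, kerOp, integral_prod _
      (integrable_kerOp_bdd (integrable_derivKer hW ha ℓ) hg.measurable hC z)]
    simp only [derivKer, hQ, ← integral_const_mul, mul_assoc]
  have hPint : ∀ z, Integrable (fun s => P s z) (gammaMeasure (a + 1) 1) := fun z => by
    have := (hint1 z).integral_prod_left
    simpa only [one_mul] using this
  have hstep : ∀ s, 0 < s → s / a * (P s (x + ι (τ • k)) - P s x) =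
      ∫ r in (0 : ℝ)..τ, derivCoef a s * Q s (x + ι (r • k)) := by
    intro s hs
    have hσ := sqrt_pos_of_pos hs
    set c := Real.exp (-s) / √(1 - Real.exp (-2 * s)) with hc
    have hc0 : 0 < c := by positivity
    -- In Mehler's formula a translation of the starting point is a translation of the noise,
    -- enlarged by c = e^{-s}/√(1 - e^{-2s}).
    have hmix : ∀ (r : ℝ) y, mix s (x + ι (r • k)) y = mix s x (y + ι ((c * r) • k)) := by
      intro r y
      simp only [mix, smul_add, map_smul, smul_smul, hc]
      rw [← mul_assoc, mul_div_cancel₀ _ hσ.ne']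
      abel
    have hZ : Measurable fun y => g (mix s x y) :=
      (by fun_prop : Continuous fun y => g (mix s x y)).measurable
    have h1 := hW.integral_shift_sub ℓ hZ (fun y => hC _) (θ := c * τ) (by positivity)
    have h2 : P s (x + ι (τ • k)) - P s x =
        ∫ r in (0 : ℝ)..τ, c * Q s (x + ι (r • k)) := by
      simp only [hP, hQ, hmix]
      rw [h1, intervalIntegral.integral_const_mul]
      have h3 := intervalIntegral.mul_integral_comp_mul_left (a := 0) (b := τ)
        (f := fun r => ∫ y, ℓ y * g (mix s x (y + ι (r • k))) ∂μ) (c := c)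
      rw [mul_zero] at h3
      exact h3.symm
    rw [h2, ← intervalIntegral.integral_const_mul]
    refine intervalIntegral.integral_congr fun r _ => ?_
    simp only [derivCoef, hc]
    ring
  have hQm : Measurable fun q : ℝ × ℝ => derivCoef a q.1 * Q q.1 (x + ι (q.2 • k)) := by
    refine ((measurable_derivCoef a).comp measurable_fst).mul ?_
    have hm : Continuous fun q : (ℝ × ℝ) × X => ℓ q.2 * g (mix q.1.1 (x + ι (q.1.2 • k)) q.2) := by
      fun_prop
    exact hm.stronglyMeasurable.integral_prod_right'.measurable
  have hQb : ∀ s z, ‖Q s z‖ ≤ ∫ y, ‖ℓ y‖ * C ∂μ := fun s z => by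
    have hℓ : Integrable (fun y => ℓ y) μ := by
      simpa using (hW.memLp_dual ℓ 1).integrable (by simp)
    refine norm_integral_le_of_norm_le (hℓ.norm.mul_const C) (ae_of_all _ fun y => ?_)
    rw [norm_mul]
    gcongr
    exact hC _
  have hswap : Integrable (Function.uncurry fun s r => derivCoef a s * Q s (x + ι (r • k)))
      ((gammaMeasure a 1).prod (volume.restrict (Ioc 0 τ))) := by
    refine Integrable.of_bound (C := a⁻¹ * ∫ y, ‖ℓ y‖ * C ∂μ) hQm.aestronglyMeasurable ?_
    have hae : ∀ᵐ q ∂((gammaMeasure a 1).prod (volume.restrict (Ioc (0 : ℝ) τ))), 0 < q.1 :=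
      Measure.quasiMeasurePreserving_fst.ae (ae_pos_gammaMeasure a)
    filter_upwards [hae] with q hq
    simp only [Function.uncurry]
    rw [norm_mul, Real.norm_of_nonneg (derivCoef_nonneg ha hq)]
    exact mul_le_mul (derivCoef_le ha hq) (hQb _ _) (norm_nonneg _) (by positivity)
  rw [hbes, hbes, ← integral_sub (hPint _) (hPint _), integral_gammaMeasure_succ ha]
  calc ∫ s, s / a * (P s (x + ι (τ • k)) - P s x) ∂(gammaMeasure a 1)
      = ∫ s, (∫ r in Ioc 0 τ, derivCoef a s * Q s (x + ι (r • k))) ∂(gammaMeasure a 1) := by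
        refine integral_congr_ae ?_
        filter_upwards [ae_pos_gammaMeasure a] with s hs
        rw [hstep s hs, intervalIntegral.integral_of_le hτ]
    _ = ∫ r in Ioc 0 τ, (∫ s, derivCoef a s * Q s (x + ι (r • k)) ∂(gammaMeasure a 1)) :=
        integral_integral_swap hswap
    _ = _ := by
        rw [intervalIntegral.integral_of_le hτ]
        simp only [hder]

end Representation

/-! ### Approximation of a functional and its derivatives with potential errors. -/

section Approximation

variable {X : Type*} [NormedAddCommGroup X] [NormedSpace ℝ X] [MeasurableSpace X]
  {H : Type*} [NormedAddCommGroup H] [InnerProductSpace ℝ H] [CompleteSpace H]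
  {ι : H →L[ℝ] X} {μ : Measure X} [BorelSpace X] [CompleteSpace X] [SecondCountableTopology X]

lemma exists_seq_bounded_continuous [IsFiniteMeasure μ] {q : ℝ≥0∞} (hq0 : q ≠ 0) (hq : q ≠ ⊤)
    {g : X → ℝ} (hg : MemLp g q μ) : ∃ gs : ℕ → X → ℝ,
      (∀ n, Continuous (gs n)) ∧ (∀ n, ∃ C, ∀ x, |gs n x| ≤ C) ∧
      Tendsto (fun n => ∫⁻ x, ‖g x - gs n x‖ₑ ^ q.toReal ∂μ) atTop (𝓝 0) := by
  have hr : 0 < q.toReal := ENNReal.toReal_pos hq0 hq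
  choose f hf _ using fun n : ℕ => hg.exists_boundedContinuous_eLpNorm_sub_le hq
    (ε := (n : ℝ≥0∞)⁻¹) (by simp)
  refine ⟨fun n => f n, fun n => (f n).continuous, fun n => ⟨‖f n‖, (f n).norm_coe_le_norm⟩, ?_⟩
  have h1 := (ENNReal.continuous_rpow_const (y := q.toReal)).tendsto 0 |>.comp
    ENNReal.tendsto_inv_nat_nhds_zero
  rw [ENNReal.zero_rpow_of_pos hr] at h1
  refine tendsto_of_tendsto_of_tendsto_of_le_of_le tendsto_const_nhds h1 (fun _ => zero_le)
    fun n => ?_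
  have h2 := hf n
  rw [eLpNorm_eq_lintegral_rpow_enorm_toReal hq0 hq] at h2
  calc _ = ((∫⁻ x, ‖g x - f n x‖ₑ ^ q.toReal ∂μ) ^ (1 / q.toReal)) ^ q.toReal := by
        rw [← ENNReal.rpow_mul, one_div_mul_cancel hr.ne', ENNReal.rpow_one]
    _ ≤ _ := by
        simp only [Function.comp_apply]
        gcongr
        exact h2

lemma lintegral_rpow_le_rpow [IsProbabilityMeasure μ] {m s : ℝ} (hm : 0 < m) (hms : m < s)
    {f : X → ℝ≥0∞} (hf : Measurable f) :
    ∫⁻ x, f x ^ m ∂μ ≤ (∫⁻ x, f x ^ s ∂μ) ^ (m / s) := by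
  have h := rpow_lintegral_le_lintegral_rpow μ ((one_lt_div hm).2 hms) (hf.pow_const m).aemeasurable
  have h2 : ∀ x, (f x ^ m) ^ (s / m) = f x ^ s := fun x => by
    rw [← ENNReal.rpow_mul, mul_div_cancel₀ _ hm.ne']
  simp_rw [h2] at h
  calc _ = ((∫⁻ x, f x ^ m ∂μ) ^ (s / m)) ^ (m / s) := by
        have : s / m * (m / s) = 1 := by field_simp [hm.ne', (hm.trans hms).ne']
        rw [← ENNReal.rpow_mul, this, ENNReal.rpow_one]
    _ ≤ _ := by gcongr; exact div_nonneg hm.le (hm.trans hms).le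

lemma lintegral_rpow_ne_top [IsProbabilityMeasure μ] {m s : ℝ} (hm : 0 < m) (hms : m < s)
    {f : X → ℝ≥0∞} (hf : Measurable f) (h : ∫⁻ x, f x ^ s ∂μ ≠ ⊤) :
    ∫⁻ x, f x ^ m ∂μ ≠ ⊤ :=
  ((lintegral_rpow_le_rpow hm hms hf).trans_lt (ENNReal.rpow_lt_top_of_nonneg
    (div_nonneg hm.le (hm.trans hms).le) h)).ne

lemma tendsto_lintegral_rpow [IsProbabilityMeasure μ] {m s : ℝ} (hm : 0 < m) (hms : m < s)
    {f : ℕ → X → ℝ≥0∞} (hf : ∀ n, Measurable (f n))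
    (h : Tendsto (fun n => ∫⁻ x, f n x ^ s ∂μ) atTop (𝓝 0)) :
    Tendsto (fun n => ∫⁻ x, f n x ^ m ∂μ) atTop (𝓝 0) := by
  have h1 := (ENNReal.continuous_rpow_const (y := m / s)).tendsto 0 |>.comp h
  rw [ENNReal.zero_rpow_of_pos (div_pos hm (hm.trans hms))] at h1
  exact tendsto_of_tendsto_of_tendsto_of_le_of_le tendsto_const_nhds h1 (fun _ => zero_le)
    fun n => lintegral_rpow_le_rpow hm hms (hf n)

lemma lintegral_derivWeight_rpow_le {a : ℝ} (t : ℝ≥0∞) (k : H) {r : ℝ} (hr : 1 ≤ r)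
    {d : X → ℝ≥0∞} (hd : Measurable d) [IsProbabilityMeasure μ] :
    ∫⁻ x, derivWeight a t k d x ^ r ∂μ ≤ ENNReal.ofReal a⁻¹ ^ r * 2 ^ (r - 1) *
      ((t * ‖k‖ₑ ^ (2 : ℝ)) ^ r + t⁻¹ ^ r * ∫⁻ x, d x ^ (2 * r) ∂μ) := by
  have hr0 : 0 ≤ r := by linarith
  calc _ ≤ ∫⁻ x, ENNReal.ofReal a⁻¹ ^ r * 2 ^ (r - 1) *
        ((t * ‖k‖ₑ ^ (2 : ℝ)) ^ r + t⁻¹ ^ r * d x ^ (2 * r)) ∂μ := by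
        refine lintegral_mono fun x => ?_
        rw [derivWeight, ENNReal.mul_rpow_of_nonneg _ _ hr0, mul_assoc, ENNReal.rpow_mul,
          ← ENNReal.mul_rpow_of_nonneg t⁻¹ _ hr0]
        gcongr
        exact ENNReal.rpow_add_le_mul_rpow_add_rpow _ _ hr
    _ = _ := by
        rw [lintegral_const_mul _ (by fun_prop), lintegral_add_left (by fun_prop),
          lintegral_const_mul _ (by fun_prop)]
        simp

/-- The order of choices matters: t is taken small against ‖k‖² first, and only then n large against
t⁻¹. -/
lemma exists_derivWeight_small [IsProbabilityMeasure μ] (a : ℝ) (k : H) {r : ℝ} (hr : 1 ≤ r)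
    {d : ℕ → X → ℝ≥0∞} (hd : ∀ n, Measurable (d n))
    (h : Tendsto (fun n => ∫⁻ x, d n x ^ (2 * r) ∂μ) atTop (𝓝 0)) {c : ℝ≥0∞} (hc : 0 < c) :
    ∃ t : ℝ≥0∞, t ≠ 0 ∧ t ≠ ⊤ ∧
      ∀ᶠ n in atTop, ∫⁻ x, derivWeight a t k (d n) x ^ r ∂μ < c := by
  have hr0 : 0 < r := by linarith
  set M : ℝ≥0∞ := ENNReal.ofReal a⁻¹ ^ r * 2 ^ (r - 1) with hM
  have hMt : M ≠ ⊤ := ENNReal.mul_ne_top (ENNReal.rpow_ne_top_of_nonneg hr0.le (by simp))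
    (ENNReal.rpow_ne_top_of_nonneg (by linarith) (by simp))
  have hlim : Tendsto (fun m : ℕ => M * ((m : ℝ≥0∞)⁻¹ * ‖k‖ₑ ^ (2 : ℝ)) ^ r) atTop (𝓝 0) := by
    have h1 : Tendsto (fun m : ℕ => (m : ℝ≥0∞)⁻¹ * ‖k‖ₑ ^ (2 : ℝ)) atTop (𝓝 0) := by
      have := ENNReal.Tendsto.mul_const ENNReal.tendsto_inv_nat_nhds_zero
        (b := ‖k‖ₑ ^ (2 : ℝ)) (Or.inr (by simp))
      rwa [zero_mul] at this
    have h2 := (ENNReal.continuous_rpow_const (y := r)).tendsto 0 |>.comp h1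
    rw [ENNReal.zero_rpow_of_pos hr0] at h2
    have := ENNReal.Tendsto.const_mul h2 (Or.inr hMt)
    rwa [mul_zero] at this
  obtain ⟨m, hm, hm0⟩ := ((hlim.eventually_lt_const hc).and (eventually_gt_atTop 0)).exists
  set t : ℝ≥0∞ := (m : ℝ≥0∞)⁻¹ with ht
  have ht0 : t ≠ 0 := by simp [ht]
  have htt : t ≠ ⊤ := by simp [ht, hm0.ne']
  refine ⟨t, ht0, htt, ?_⟩
  have h3 : Tendsto (fun n => M * ((t * ‖k‖ₑ ^ (2 : ℝ)) ^ r + t⁻¹ ^ r *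
      ∫⁻ x, d n x ^ (2 * r) ∂μ)) atTop (𝓝 (M * (t * ‖k‖ₑ ^ (2 : ℝ)) ^ r)) := by
    have h4 := ENNReal.Tendsto.const_mul h (a := t⁻¹ ^ r)
      (Or.inr (ENNReal.rpow_ne_top_of_nonneg hr0.le (by simp [ht0])))
    have h5 := ENNReal.Tendsto.const_mul ((tendsto_const_nhds
      (x := (t * ‖k‖ₑ ^ (2 : ℝ)) ^ r)).add h4) (Or.inr hMt)
    rwa [mul_zero, add_zero] at h5
  filter_upwards [h3.eventually_lt_const hm] with n hn
  exact (lintegral_derivWeight_rpow_le t k hr (hd n)).trans_lt hn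

lemma integrable_mix_of_pot [SFinite μ] {γ : Measure ℝ} [SFinite γ] {g : X → ℝ}
    (hg : Measurable g) {x : X} (h : pot γ μ (fun z => ‖g z‖ₑ) x < ⊤) :
    Integrable (fun z : ℝ × X => g (mix z.1 x z.2)) (γ.prod μ) := by
  refine ⟨(hg.comp (by fun_prop : Continuous fun z : ℝ × X =>
    mix z.1 x z.2).measurable).aestronglyMeasurable, ?_⟩
  rw [hasFiniteIntegral_iff_enorm]
  rwa [pot_eq_prod hg.enorm] at h

/-- A functional of class `D^{2p}_{2+α}` and its directional derivatives are limits of bounded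
continuous functions, with errors dominated by potentials of order `α`. -/
theorem potApprox_of_memD (hW : IsAbstractWienerSpace ι μ) {α : ℝ} (hα : 0 < α) {p : ℝ≥0∞}
    (hp : 2 < p) (hp' : p < ⊤) {u : X → ℝ} (hu : Measurable u)
    (hD : MemD μ (2 * p) (2 + α) u) :
    PotApprox μ (gammaMeasure (α / 2) 1) p.toReal u ∧
    ∃ g : X → ℝ, Measurable g ∧ ∫⁻ x, ‖g x‖ₑ ^ (2 * p.toReal) ∂μ ≠ ⊤ ∧
      ∀ (ℓ : StrongDual ℝ X) (w : X → ℝ), Measurable w → ∫⁻ x, ‖w x‖ₑ ^ (2 : ℝ) ∂μ ≠ ⊤ →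
        ShiftDeriv ι μ (dualVec ι ℓ) u w →
        PotApprox μ (gammaMeasure (α / 2) 1) p.toReal w ∧
        ∀ t : ℝ≥0∞, t ≠ 0 → t ≠ ⊤ → ∀ᵐ x ∂μ, ‖w x‖ₑ ≤ pot (gammaMeasure (α / 2) 1) μ
          (derivWeight (α / 2) t (dualVec ι ℓ) fun z => ‖g z‖ₑ) x := by
  set a := α / 2 with ha_def
  have ha : 0 < a := half_pos hα
  have := hW.isProbabilityMeasure
  have := isProbabilityMeasure_gammaMeasure ha one_pos
  have := isProbabilityMeasure_gammaMeasure (a := a + 1) (by positivity) one_pos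
  have := isProbabilityMeasure_gammaMeasure (a := 1) one_pos one_pos
  set γ := gammaMeasure a 1 with hγ
  set γ' := gammaMeasure (a + 1) 1 with hγ'
  have hγ0 : ∀ᵐ s ∂γ, 0 ≤ s := ae_nonneg_gammaMeasure a
  have hγ'0 : ∀ᵐ s ∂γ', 0 ≤ s := ae_nonneg_gammaMeasure (a + 1)
  set r := p.toReal with hr_def
  have hr : 2 < r := by
    rw [hr_def, ← ENNReal.toReal_ofNat 2]
    exact (ENNReal.toReal_lt_toReal (by simp) hp'.ne).2 hp
  have hq : (2 * p).toReal = 2 * r := by simp [hr_def]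
  have hq0 : 2 * p ≠ 0 := by
    simp only [ne_eq, mul_eq_zero, not_or]
    exact ⟨by simp, (bot_lt_iff_ne_bot.1 (lt_of_le_of_lt bot_le hp))⟩
  have hqt : 2 * p ≠ ⊤ := ENNReal.mul_ne_top (by simp) hp'.ne
  obtain ⟨-, g₀, hg₀, hu₀⟩ := hD
  set g := hg₀.1.mk g₀ with hg_def
  have hg : Measurable g := hg₀.1.stronglyMeasurable_mk.measurable
  have hgae : g₀ =ᵐ[μ] g := hg₀.1.ae_eq_mk
  have hgL : MemLp g (2 * p) μ := hg₀.ae_eq hgae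
  have hg2r : ∫⁻ x, ‖g x‖ₑ ^ (2 * r) ∂μ ≠ ⊤ := by
    rw [← hq]
    exact (lintegral_rpow_enorm_lt_top_of_eLpNorm_lt_top hq0 hqt hgL.2).ne
  have hg1 : ∫⁻ x, ‖g x‖ₑ ∂μ ≠ ⊤ := by
    have := lintegral_rpow_ne_top one_pos (by linarith) hg.enorm hg2r
    simpa using this
  obtain ⟨gs, hgsc, hgsb, hgslim⟩ := exists_seq_bounded_continuous hq0 hqt hgL
  rw [hq] at hgslim
  -- The squares in `derivWeight` turn `L^r` energies into `L^{2r}` norms of this error, hence the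
  -- exponent `2 * p` in the hypothesis.
  set d : ℕ → X → ℝ≥0∞ := fun n x => ‖g x - gs n x‖ₑ with hd_def
  have hdm : ∀ n, Measurable (d n) := fun n => (hg.sub (hgsc n).measurable).enorm
  choose C hC using hgsb
  have hgint' : ∀ᵐ x ∂μ, Integrable (fun z : ℝ × X => g (mix z.1 x z.2)) (γ'.prod μ) := by
    have : ∀ᵐ x ∂μ, pot γ' μ (fun z => ‖g z‖ₑ) x < ⊤ :=
      ae_lt_top (measurable_pot hg.enorm) (by rwa [lintegral_pot hW hγ'0 hg.enorm])
    filter_upwards [this] with x hx using integrable_mix_of_pot hg hx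
  have hubes : ∀ᵐ x ∂μ, u x = besselOp μ a g x := by
    filter_upwards [hgint', hu₀, besselPotential_congr_ae hW (by positivity : 0 < 2 + α) hgae]
      with x h1 h2 h3
    rw [h2, h3, besselOp_eq_besselPotential hW hα h1]
  have hudiff : ∀ n, ∀ᵐ x ∂μ, ‖u x - besselOp μ a (gs n) x‖ₑ ≤ pot γ' μ (d n) x := by
    intro n
    filter_upwards [hgint', hubes] with x h1 h2
    have h3 := integrable_kerOp_bdd (ν := γ'.prod μ) (κ := fun _ => 1) (integrable_const _)
      (hgsc n).measurable (hC n) x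
    rw [h2, besselOp, besselOp, kerOp_sub (by simpa using h1) h3]
    refine (enorm_kerOp_le _ _ _).trans (le_of_eq ?_)
    rw [pot_eq_prod (hdm n)]
    simp [hd_def]
  have hbesm : ∀ n, Measurable (besselOp μ a (gs n)) := fun n =>
    measurable_kerOp measurable_const (hgsc n).measurable
  have happ : PotApprox μ γ r u := by
    intro c hc
    have hlim := tendsto_lintegral_rpow (by linarith : 0 < r) (by linarith : r < 2 * r) hdm hgslim
    obtain ⟨n, hn⟩ := (hlim.eventually_lt_const hc).exists
    refine ⟨besselOp μ a (gs n), pot (gammaMeasure 1 1) μ (d n),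
      continuous_kerOp (integrable_const _) (hgsc n) (hC n),
      ⟨_, abs_kerOp_le (integrable_const _) (hC n)⟩, measurable_pot (hdm n), ?_, ?_⟩
    · exact (lintegral_rpow_pot_le hW (ae_nonneg_gammaMeasure 1) (by linarith) (hdm n)).trans_lt hn
    · filter_upwards [hudiff n] with x hx
      exact hx.trans (pot_gammaMeasure_succ_le hW ha (hdm n) x)
  refine ⟨happ, g, hg, hg2r, fun ℓ w hw hw2 hwd => ?_⟩
  set k := dualVec ι ℓ with hk
  have hker := integrable_derivKer hW ha ℓ
  have hgw : Measurable (derivWeight a 1 k fun z => ‖g z‖ₑ) := measurable_derivWeight _ _ _ hg.enorm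
  have hgwr : ∫⁻ x, derivWeight a 1 k (fun z => ‖g z‖ₑ) x ^ r ∂μ ≠ ⊤ := by
    refine ((lintegral_derivWeight_rpow_le 1 k (by linarith) hg.enorm).trans_lt ?_).ne
    refine ENNReal.mul_lt_top (ENNReal.mul_lt_top ?_ ?_) (ENNReal.add_lt_top.2 ⟨?_, ?_⟩)
    · exact ENNReal.rpow_lt_top_of_nonneg (by linarith) (by simp)
    · exact ENNReal.rpow_lt_top_of_nonneg (by linarith) (by simp)
    · exact ENNReal.rpow_lt_top_of_nonneg (by linarith) (by simp)
    · exact ENNReal.mul_lt_top (by simp) hg2r.lt_top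
  have hgint : ∀ᵐ x ∂μ, Integrable (fun z : ℝ × X => derivKer a ℓ z * g (mix z.1 x z.2))
      (γ.prod μ) := by
    have h1 : ∫⁻ x, derivWeight a 1 k (fun z => ‖g z‖ₑ) x ∂μ ≠ ⊤ := by
      have := lintegral_rpow_ne_top one_pos (by linarith) hgw hgwr
      simpa using this
    have : ∀ᵐ x ∂μ, pot γ μ (derivWeight a 1 k fun z => ‖g z‖ₑ) x < ⊤ :=
      ae_lt_top (measurable_pot hgw) (by rwa [lintegral_pot hW hγ0 hgw])
    filter_upwards [this] with x hx
    refine ⟨((measurable_derivKer a ℓ).mul (hg.comp (by fun_prop : Continuous fun z : ℝ × X =>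
      mix z.1 x z.2).measurable)).aestronglyMeasurable, ?_⟩
    rw [hasFiniteIntegral_iff_enorm]
    exact (lintegral_derivKer_le hW ha ℓ hg one_ne_zero ENNReal.one_ne_top x).trans_lt hx
  have hΦm : Measurable (derivOp μ a ℓ g) := measurable_kerOp (measurable_derivKer a ℓ) hg
  have hΦsm : ∀ n, Measurable (derivOp μ a ℓ (gs n)) := fun n =>
    measurable_kerOp (measurable_derivKer a ℓ) (hgsc n).measurable
  have hΦdiff : ∀ t : ℝ≥0∞, t ≠ 0 → t ≠ ⊤ → ∀ n, ∀ᵐ x ∂μ,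
      ‖derivOp μ a ℓ g x - derivOp μ a ℓ (gs n) x‖ₑ ≤ pot γ μ (derivWeight a t k (d n)) x := by
    intro t ht ht' n
    filter_upwards [hgint] with x h1
    rw [derivOp, derivOp, kerOp_sub h1
      (integrable_kerOp_bdd hker (hgsc n).measurable (hC n) x)]
    exact (enorm_kerOp_le _ _ _).trans
      (lintegral_derivKer_le hW ha ℓ (hg.sub (hgsc n).measurable) ht ht' x)
  have hΦle : ∀ t : ℝ≥0∞, t ≠ 0 → t ≠ ⊤ → ∀ x,
      ‖derivOp μ a ℓ g x‖ₑ ≤ pot γ μ (derivWeight a t k fun z => ‖g z‖ₑ) x := fun t ht ht' x =>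
    (enorm_kerOp_le _ _ _).trans (lintegral_derivKer_le hW ha ℓ hg ht ht' x)
  have hΦ2 : ∫⁻ x, ‖derivOp μ a ℓ g x‖ₑ ^ (2 : ℝ) ∂μ ≠ ⊤ := by
    have h2 := lintegral_rpow_ne_top two_pos hr hgw hgwr
    refine ((lintegral_mono fun x => ?_).trans_lt
      ((lintegral_rpow_pot_le hW hγ0 one_lt_two hgw).trans_lt h2.lt_top)).ne
    gcongr
    exact hΦle 1 one_ne_zero ENNReal.one_ne_top x
  -- The formula is known for bounded continuous `gs n` and passes to `g` because the directional
  -- derivative is closed.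
  have hderiv : ShiftDeriv ι μ k u (derivOp μ a ℓ g) := by
    refine ShiftDeriv.of_tendsto hW hu hΦm hbesm hΦsm
      (fun n => shiftDeriv_besselOp hW ha ℓ (hgsc n) (hC n)) hΦ2 ?_ ?_
    · have hlim := tendsto_lintegral_rpow two_pos (by linarith : 2 < 2 * r) hdm hgslim
      refine tendsto_of_tendsto_of_tendsto_of_le_of_le tendsto_const_nhds hlim
        (fun _ => zero_le) fun n => ?_
      refine (lintegral_mono_ae ?_).trans
        (lintegral_rpow_pot_le hW hγ'0 one_lt_two (hdm n))
      filter_upwards [hudiff n] with x hx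
      gcongr
    · rw [ENNReal.tendsto_nhds_zero]
      intro c hc
      have h2r : Tendsto (fun n => ∫⁻ x, d n x ^ (2 * (2 : ℝ)) ∂μ) atTop (𝓝 0) :=
        tendsto_lintegral_rpow (by norm_num) (by linarith) hdm hgslim
      obtain ⟨t, ht, ht', hev⟩ := exists_derivWeight_small a k one_le_two hdm h2r hc
      filter_upwards [hev] with n hn
      refine ((lintegral_mono_ae ?_).trans
        (lintegral_rpow_pot_le hW hγ0 one_lt_two (measurable_derivWeight a t k (hdm n)))).trans hn.le
      filter_upwards [hΦdiff t ht ht' n] with x hx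
      gcongr
  -- Both are limits of the same difference quotients of `u`.
  have hwΦ : w =ᵐ[μ] derivOp μ a ℓ g := by
    filter_upwards [hwd.ae_tendsto hW hw hw2, hderiv.ae_tendsto hW hΦm hΦ2] with x h1 h2
    exact tendsto_nhds_unique h1 h2
  constructor
  · intro c hc
    obtain ⟨t, ht, ht', hev⟩ := exists_derivWeight_small a k (by linarith : 1 ≤ r) hdm hgslim hc
    obtain ⟨n, hn⟩ := hev.exists
    refine ⟨derivOp μ a ℓ (gs n), derivWeight a t k (d n), continuous_kerOp hker (hgsc n) (hC n),
      ⟨_, abs_kerOp_le hker (hC n)⟩, measurable_derivWeight a t k (hdm n), hn, ?_⟩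
    filter_upwards [hwΦ, hΦdiff t ht ht' n] with x h1 h2
    rwa [h1]
  · intro t ht ht'
    filter_upwards [hwΦ] with x hx
    rw [hx]
    exact hΦle t ht ht' x

end Approximation

/-! ### Malliavin derivatives and the almost sure subgradient inequality. -/

section Subgradient

variable {X : Type*} [NormedAddCommGroup X] [NormedSpace ℝ X] [MeasurableSpace X]
  {H : Type*} [NormedAddCommGroup H] [InnerProductSpace ℝ H] [CompleteSpace H]
  {ι : H →L[ℝ] X} {μ : Measure X} [BorelSpace X] [CompleteSpace X] [SecondCountableTopology X]

namespace SmoothCyl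

lemma inner_grad (S : SmoothCyl X) (x : X) (k : H) :
    inner ℝ (S.grad ι x) k = fderiv ℝ S.f (fun j => S.ℓ j x) (fun j => S.ℓ j (ι k)) := by
  rw [grad, sum_inner]
  conv_rhs => rw [← LinearMap.coe_coe, LinearMap.pi_apply_eq_sum_univ]
  refine Finset.sum_congr rfl fun i _ => ?_
  have he : (Pi.single i 1 : Fin S.n → ℝ) = fun j => if i = j then 1 else 0 := by
    ext j
    simp [Pi.single_apply, eq_comm]
  rw [real_inner_smul_left, inner_dualVec, smul_eq_mul, mul_comm, he, LinearMap.coe_coe]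

lemma continuous_eval (S : SmoothCyl X) : Continuous S.eval :=
  S.smooth.continuous.comp (by fun_prop)

lemma continuous_inner_grad (S : SmoothCyl X) (k : H) :
    Continuous fun x => inner ℝ (S.grad ι x) k := by
  simp only [inner_grad]
  have h1 : Continuous (fderiv ℝ S.f) := S.smooth.continuous_fderiv (by simp)
  exact (h1.comp (by fun_prop : Continuous fun x j => S.ℓ j x)).clm_apply continuous_const

/-- The fundamental theorem of calculus along `H`-directions. -/
lemma shiftDeriv (S : SmoothCyl X) (k : H) :
    ShiftDeriv ι μ k S.eval (fun x => inner ℝ (S.grad ι x) k) := by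
  refine fun τ _ => ae_of_all _ fun x => ?_
  have hd : ∀ s : ℝ, HasDerivAt (fun s : ℝ => S.eval (x + ι (s • k)))
      (inner ℝ (S.grad ι (x + ι (s • k))) k) s := by
    intro s
    rw [inner_grad]
    have h1 : HasDerivAt (fun s : ℝ => fun j => S.ℓ j (x + ι (s • k)))
        (fun j => S.ℓ j (ι k)) s := by
      rw [hasDerivAt_pi]
      intro j
      simp only [map_add, map_smul, smul_eq_mul]
      simpa using ((hasDerivAt_id s).mul_const (S.ℓ j (ι k))).const_add (S.ℓ j x)
    exact ((S.smooth.differentiable (by simp)).differentiableAt.hasFDerivAt).comp_hasDerivAt s h1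
  have := intervalIntegral.integral_eq_sub_of_hasDerivAt (a := 0) (b := τ) (fun s _ => hd s)
    (((S.continuous_inner_grad k).comp (by fun_prop : Continuous fun s : ℝ => x + ι (s • k))).intervalIntegrable _ _)
  rw [this]
  simp

end SmoothCyl

lemma lintegral_enorm_sq_eq {E : Type*} [NormedAddCommGroup E] (f : X → E) :
    ∫⁻ x, ‖f x‖ₑ ^ (2 : ℝ) ∂μ = eLpNorm f 2 μ ^ (2 : ℝ) := by
  simpa using (eLpNorm_nnreal_pow_eq_lintegral (μ := μ) (f := f) (p := 2) (by simp)).symm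

lemma enorm_real_inner_le (x y : H) : ‖(inner ℝ x y : ℝ)‖ₑ ≤ ‖x‖ₑ * ‖y‖ₑ := by
  rw [← ofReal_norm, ← ofReal_norm, ← ofReal_norm, ← ENNReal.ofReal_mul (norm_nonneg _)]
  exact ENNReal.ofReal_le_ofReal (norm_inner_le_norm x y)

/-- Cylindrical functionals satisfy the fundamental theorem of calculus along `k`; their `L²`
closure inherits it. -/
lemma HasMalliavinDerivs.shiftDeriv (hW : IsAbstractWienerSpace ι μ) {F : X → ℝ} {G : X → H}
    {K : X → HTensor H} (h : HasMalliavinDerivs ι μ 2 F G K) (k : H) {u w : X → ℝ}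
    (hu : Measurable u) (hw : Measurable w) (hue : u =ᵐ[μ] F)
    (hwe : w =ᵐ[μ] fun x => inner ℝ (G x) k) :
    ShiftDeriv ι μ k u w ∧ ∫⁻ x, ‖w x‖ₑ ^ (2 : ℝ) ∂μ ≠ ⊤ := by
  have hsq : ∀ {f : ℕ → ℝ≥0∞}, Tendsto f atTop (𝓝 0) →
      Tendsto (fun n => f n ^ (2 : ℝ)) atTop (𝓝 0) := fun {f} hf => by
    have := ((ENNReal.continuous_rpow_const (y := (2 : ℝ))).tendsto 0).comp hf
    rwa [ENNReal.zero_rpow_of_pos (by norm_num)] at this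
  have hw2 : ∫⁻ x, ‖w x‖ₑ ^ (2 : ℝ) ∂μ ≠ ⊤ := by
    refine ne_top_of_le_ne_top ?_ (lintegral_mono_ae (g := fun x => (‖G x‖ₑ * ‖k‖ₑ) ^ (2 : ℝ)) ?_)
    · simp_rw [ENNReal.mul_rpow_of_nonneg _ _ (by norm_num : (0 : ℝ) ≤ 2)]
      rw [lintegral_mul_const' _ _ (by simp), lintegral_enorm_sq_eq]
      exact ENNReal.mul_ne_top (by simpa using h.memLp_grad.2.ne) (by simp)
    · filter_upwards [hwe] with x hx
      rw [hx]
      gcongr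
      exact enorm_real_inner_le _ _
  refine ⟨?_, hw2⟩
  obtain ⟨S, hS0, hS1, -⟩ := h.approx
  refine ShiftDeriv.of_tendsto hW hu hw (un := fun n => (S n).eval)
    (wn := fun n x => inner ℝ ((S n).grad ι x) k) (fun n => (S n).continuous_eval.measurable)
    (fun n => ((S n).continuous_inner_grad k).measurable) (fun n => (S n).shiftDeriv k) hw2 ?_ ?_
  · refine (hsq hS0).congr fun n => ?_
    rw [← lintegral_enorm_sq_eq]
    refine lintegral_congr_ae ?_
    filter_upwards [hue] with x hx
    rw [hx, enorm_sub_rev]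
  · have h1 : Tendsto (fun n => eLpNorm (fun x => (S n).grad ι x - G x) 2 μ ^ (2 : ℝ) *
        ‖k‖ₑ ^ (2 : ℝ)) atTop (𝓝 0) := by
      have := ENNReal.Tendsto.mul_const (hsq hS1) (b := ‖k‖ₑ ^ (2 : ℝ)) (Or.inr (by simp))
      rwa [zero_mul] at this
    refine tendsto_of_tendsto_of_tendsto_of_le_of_le tendsto_const_nhds h1 (fun n => zero_le)
      fun n => ?_
    dsimp only
    rw [← lintegral_enorm_sq_eq, ← lintegral_mul_const' _ _ (by simp)]
    refine lintegral_mono_ae ?_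
    filter_upwards [hwe] with x hx
    rw [hx, ← ENNReal.mul_rpow_of_nonneg _ _ (by norm_num), ← inner_sub_left, enorm_sub_rev (S n |>.grad ι x)]
    gcongr
    exact enorm_real_inner_le _ _

/-- The gradient of an `H`-convex functional is a subgradient along each direction of `H`. -/
lemma HConvex.ae_add_le (hW : IsAbstractWienerSpace ι μ) {F u w : X → ℝ} (hF : HConvex ι μ F)
    (hue : u =ᵐ[μ] F) {k : H} (hw : Measurable w) (h : ShiftDeriv ι μ k u w)
    (hw2 : ∫⁻ x, ‖w x‖ₑ ^ (2 : ℝ) ∂μ ≠ ⊤) : ∀ᵐ x ∂μ, u x + w x ≤ u (x + ι k) := by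
  have h1 : ∀ᵐ x ∂μ, ∀ n, F (x + ι (scale n • k)) ≤ scale n * F (x + ι k) + (1 - scale n) * F x := by
    refine ae_all_iff.2 fun n => ?_
    simpa using hF.2 k 0 (scale n) ⟨(scale_pos n).le, scale_le_one n⟩
  have h2 : ∀ᵐ x ∂μ, ∀ n, u (x + ι (scale n • k)) = F (x + ι (scale n • k)) :=
    ae_all_iff.2 fun n => hW.ae_add _ hue
  filter_upwards [h1, h2, hue, hW.ae_add k hue, h.ae_tendsto hW hw hw2] with x a1 a2 a3 a4 a5
  -- Convexity bounds every difference quotient by the increment over the full step.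
  have : w x ≤ u (x + ι k) - u x := by
    refine le_of_tendsto a5 (Eventually.of_forall fun n => ?_)
    rw [inv_mul_le_iff₀ (scale_pos n), a2, a3, a4]
    linarith [a1 n]
  linarith

end Subgradient

/-! ### Regular points, and the subgradient inequality between them. -/

section RegularPoints

variable {X : Type*} [NormedAddCommGroup X] [NormedSpace ℝ X] [MeasurableSpace X]
  {H : Type*} [NormedAddCommGroup H] [InnerProductSpace ℝ H] [CompleteSpace H]
  {ι : H →L[ℝ] X} {μ : Measure X} [BorelSpace X] [CompleteSpace X] [SecondCountableTopology X]

namespace IsAbstractWienerSpace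

lemma lintegral_enorm_add_ne_top (hW : IsAbstractWienerSpace ι μ) (k : H) {Z : X → ℝ}
    (hZ : Measurable Z) (hZ2 : ∫⁻ y, ‖Z y‖ₑ ^ (2 : ℝ) ∂μ ≠ ⊤) :
    ∫⁻ y, ‖Z (y + ι k)‖ₑ ∂μ ≠ ⊤ :=
  ((hW.lintegral_add_le k hZ.enorm).trans_lt (ENNReal.mul_lt_top (by simp)
    (ENNReal.rpow_lt_top_of_nonneg (by norm_num) hZ2))).ne

lemma integrable_add (hW : IsAbstractWienerSpace ι μ) (k : H) {Z : X → ℝ}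
    (hZ : Measurable Z) (hZ2 : ∫⁻ y, ‖Z y‖ₑ ^ (2 : ℝ) ∂μ ≠ ⊤) :
    Integrable (fun y => Z (y + ι k)) μ :=
  ⟨(hZ.comp (by fun_prop : Measurable fun y => y + ι k)).aestronglyMeasurable,
    (hW.lintegral_enorm_add_ne_top k hZ hZ2).lt_top⟩

/-- Translation along `H` is continuous from `L²` to `L¹`, tested against constants. -/
lemma continuous_integral_add (hW : IsAbstractWienerSpace ι μ) {Z : X → ℝ}
    (hZ : Measurable Z) (hZ2 : ∫⁻ y, ‖Z y‖ₑ ^ (2 : ℝ) ∂μ ≠ ⊤) :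
    Continuous fun k : H => ∫ y, Z (y + ι k) ∂μ := by
  have := hW.isProbabilityMeasure
  have hmem : MemLp Z 2 μ := by
    refine ⟨hZ.aestronglyMeasurable, ?_⟩
    have h := hZ2
    rw [lintegral_enorm_sq_eq] at h
    by_contra hn
    rw [not_lt, top_le_iff] at hn
    simp [hn] at h
  obtain ⟨V, hVc, hVb, hVlim⟩ := exists_seq_bounded_continuous (by simp) (by simp) hmem
  simp only [ENNReal.toReal_ofNat] at hVlim
  have hFc : ∀ n, Continuous fun k : H => ∫ y, V n (y + ι k) ∂μ := by
    intro n
    obtain ⟨C, hC⟩ := hVb n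
    refine continuous_of_dominated (bound := fun _ => C)
      (fun k => ((hVc n).comp (by fun_prop)).aestronglyMeasurable)
      (fun k => ae_of_all _ fun y => hC _) (integrable_const _)
      (ae_of_all _ fun y => (hVc n).comp (by fun_prop))
  refine continuous_of_locally_uniform_approx_of_continuousAt fun k s hs => ?_
  obtain ⟨δ, hδ, hsub⟩ := Metric.mem_uniformity_dist.1 hs
  -- The constant of the translation bound, uniform over the unit ball about `k`.
  set M : ℝ≥0∞ := ENNReal.ofReal (Real.exp ((‖k‖ + 1) ^ 2 / 2)) with hM
  have hlim : Tendsto (fun n => M * (∫⁻ y, ‖Z y - V n y‖ₑ ^ (2 : ℝ) ∂μ) ^ (1 / 2 : ℝ))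
      atTop (𝓝 0) := by
    have h1 := ((ENNReal.continuous_rpow_const (y := (1 / 2 : ℝ))).tendsto 0).comp hVlim
    rw [ENNReal.zero_rpow_of_pos (by norm_num)] at h1
    have := ENNReal.Tendsto.const_mul h1 (Or.inr (ENNReal.ofReal_ne_top : M ≠ ⊤))
    rwa [mul_zero] at this
  obtain ⟨n, hn⟩ := (hlim.eventually_lt_const (ENNReal.ofReal_pos.2 hδ)).exists
  refine ⟨Metric.ball k 1, Metric.ball_mem_nhds k one_pos, _, (hFc n).continuousAt,
    fun k' hk' => hsub ?_⟩
  obtain ⟨C, hC⟩ := hVb n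
  have hi2 : Integrable (fun y => V n (y + ι k')) μ :=
    (integrable_const C).mono' ((hVc n).comp (by fun_prop)).aestronglyMeasurable
      (ae_of_all _ fun y => hC _)
  rw [dist_eq_norm, ← integral_sub (hW.integrable_add k' hZ hZ2) hi2]
  have hnorm : ‖k'‖ ≤ ‖k‖ + 1 := by
    have := norm_le_norm_add_norm_sub k k'
    rw [← dist_eq_norm, dist_comm] at this
    linarith [Metric.mem_ball.1 hk']
  have h1 : ‖∫ y, (Z (y + ι k') - V n (y + ι k')) ∂μ‖ₑ < ENNReal.ofReal δ := by
    refine (enorm_integral_le_lintegral_enorm _).trans_lt (lt_of_le_of_lt ?_ hn)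
    refine (hW.lintegral_add_le k' (w := fun y => ‖Z y - V n y‖ₑ)
      (hZ.sub (hVc n).measurable).enorm).trans ?_
    rw [hM]
    gcongr
  rw [← ofReal_norm] at h1
  exact (ENNReal.ofReal_lt_ofReal_iff hδ).1 h1

end IsAbstractWienerSpace

/-- Points at which the short-time averages of `u` and `v` under the Ornstein–Uhlenbeck semigroup
converge to `us` and `vs`, with further control of these averages; `v` is tested in the
directions of `E`, and `B` is a set which the process avoids. -/
structure RegularAt (μ : Measure X) (γ : Measure ℝ) (E : Set H) (B : Set X) (u us : X → ℝ)
    (v vs : X → H) (x : X) : Prop where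
  tendsto : Tendsto (fun n => pot (unif (scale n)) μ (fun z => ‖u z - us x‖ₑ) x) atTop (𝓝 0)
  tendsto_inner : ∀ k ∈ E, Tendsto (fun n => pot (unif (scale n)) μ
    (fun z => ‖inner ℝ (v z) k - inner ℝ (vs x) k‖ₑ) x) atTop (𝓝 0)
  bounded : ∃ b : ℝ≥0∞, b ≠ ⊤ ∧ ∀ n, pot (unif (scale n)) μ (fun z => ‖v z‖ₑ) x ≤ b
  avoids : pot γ μ (B.indicator 1) x = 0
  sq_ne_top : pot γ μ (fun z => ‖u z‖ₑ ^ (2 : ℝ)) x ≠ ⊤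

variable {a : ℝ} {E : Set H} {B : Set X} {u us : X → ℝ} {v vs : X → H}

/-- The subgradient inequality, averaged over the law of the process at time `t`. -/
lemma integral_add_inner_le (hW : IsAbstractWienerSpace ι μ) (hu : Measurable u)
    (hE : Dense E) (hB : ∀ z ∉ B, ∀ k ∈ E, u z + inner ℝ (v z) k ≤ u (z + ι k)) {t : ℝ}
    (ht : 0 < t) {x : X} (hx : ∀ᵐ y ∂μ, mix t x y ∉ B)
    (hu2 : ∫⁻ y, ‖u (mix t x y)‖ₑ ^ (2 : ℝ) ∂μ ≠ ⊤)
    (hv : Integrable (fun y => v (mix t x y)) μ) (h : H) :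
    ∫ y, u (mix t x y) ∂μ + inner ℝ (∫ y, v (mix t x y) ∂μ) h ≤
      ∫ y, u (mix t x y + ι h) ∂μ := by
  have hσ : √(1 - Real.exp (-2 * t)) ≠ 0 := by
    rw [Real.sqrt_ne_zero', sub_pos, Real.exp_lt_one_iff]
    linarith
  set σ := √(1 - Real.exp (-2 * t)) with hσdef
  have hmx : Measurable fun y => u (mix t x y) :=
    hu.comp (by unfold mix; fun_prop : Continuous fun y => mix t x y).measurable
  -- At positive time a translation of the state is a translation of the noise, to which
  -- Cameron–Martin continuity applies.
  have hshift : ∀ k : H, ∀ y, u (mix t x y + ι k) = u (mix t x (y + ι (σ⁻¹ • k))) := by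
    intro k y
    congr 1
    simp only [mix, ← hσdef, map_smul, smul_add, smul_smul, mul_inv_cancel₀ hσ, one_smul, add_assoc]
  have hcont : Continuous fun k : H => ∫ y, u (mix t x y + ι k) ∂μ := by
    simp only [hshift]
    exact (hW.continuous_integral_add hmx hu2).comp (by fun_prop : Continuous fun k : H => σ⁻¹ • k)
  have hi : ∀ k : H, Integrable (fun y => u (mix t x y + ι k)) μ := by
    intro k
    simp only [hshift]
    exact hW.integrable_add (σ⁻¹ • k) hmx hu2
  have hi0 : Integrable (fun y => u (mix t x y)) μ := by simpa using hi 0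
  -- Both sides are continuous in the direction after averaging, so testing on the dense set `E`
  -- suffices.
  have hclosed : IsClosed {h : H | ∫ y, u (mix t x y) ∂μ + inner ℝ (∫ y, v (mix t x y) ∂μ) h ≤
      ∫ y, u (mix t x y + ι h) ∂μ} := isClosed_le (by fun_prop) hcont
  refine hclosed.closure_subset_iff.2 ?_ (hE.closure_eq ▸ mem_univ h)
  intro k hk
  have hin : Integrable (fun y => (inner ℝ (v (mix t x y)) k : ℝ)) μ := hv.inner_const k
  have hin' : ∫ y, (inner ℝ (v (mix t x y)) k : ℝ) ∂μ = inner ℝ (∫ y, v (mix t x y) ∂μ) k := by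
    simp_rw [real_inner_comm k]
    exact integral_inner hv k
  rw [mem_ofPred_eq, ← hin', ← integral_add hi0 hin]
  refine integral_mono_ae (hi0.add hin) (hi k) ?_
  filter_upwards [hx] with y hy
  exact hB _ hy k hk

/-- The averaged subgradient inequality, with the errors at time `t`. -/
lemma ofReal_add_inner_sub_le (hW : IsAbstractWienerSpace ι μ) (hu : Measurable u)
    (hv : StronglyMeasurable v) (hE : Dense E)
    (hB : ∀ z ∉ B, ∀ k ∈ E, u z + inner ℝ (v z) k ≤ u (z + ι k)) {t : ℝ} (ht : 0 < t) {x : X}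
    {h : H} (hx : ∀ᵐ y ∂μ, mix t x y ∉ B) (hx2 : sg μ t (fun z => ‖u z‖ₑ ^ (2 : ℝ)) x ≠ ⊤)
    (hy2 : sg μ t (fun z => ‖u z‖ₑ ^ (2 : ℝ)) (x + ι h) ≠ ⊤)
    (hxv : sg μ t (fun z => ‖v z‖ₑ) x ≠ ⊤) (b c : ℝ) (m k : H) :
    ENNReal.ofReal (b + inner ℝ m k - c) ≤
      sg μ t (fun z => ‖u z - b‖ₑ) x + sg μ t (fun z => ‖u z - c‖ₑ) (x + ι h) +
      sg μ t (fun z => ‖inner ℝ (v z) k - inner ℝ m k‖ₑ) x +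
      ENNReal.ofReal (‖h - k‖ + t * ‖h‖) * sg μ t (fun z => ‖v z‖ₑ) x := by
  have := hW.isProbabilityMeasure
  have hmc : ∀ x : X, Continuous fun y => mix t x y := fun x => by unfold mix; fun_prop
  have hvi : Integrable (fun y => v (mix t x y)) μ :=
    ⟨(hv.comp_measurable (hmc x).measurable).aestronglyMeasurable, hxv.lt_top⟩
  have hui : ∀ z, sg μ t (fun z => ‖u z‖ₑ ^ (2 : ℝ)) z ≠ ⊤ →
      Integrable (fun y => u (mix t z y)) μ := fun z hz => by
    simpa using hW.integrable_add 0 (hu.comp (hmc z).measurable) hz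
  set h' : H := Real.exp (-t) • h with hh'
  have hkey := integral_add_inner_le hW hu hE hB ht hx hx2 hvi h'
  have hmix : ∀ y, mix t x y + ι h' = mix t (x + ι h) y := fun y => by
    rw [mix_add, hh', map_smul]
  simp only [hmix] at hkey
  have hin : ∀ k : H, ∫ y, (inner ℝ (v (mix t x y)) k : ℝ) ∂μ =
      inner ℝ (∫ y, v (mix t x y) ∂μ) k := fun k => by
    simp_rw [real_inner_comm k]
    exact integral_inner hvi k
  have e1 : ∫ y, (u (mix t x y) - b) ∂μ = ∫ y, u (mix t x y) ∂μ - b := by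
    rw [integral_sub (hui x hx2) (integrable_const b)]; simp
  have e2 : ∫ y, (u (mix t (x + ι h) y) - c) ∂μ = ∫ y, u (mix t (x + ι h) y) ∂μ - c := by
    rw [integral_sub (hui _ hy2) (integrable_const c)]; simp
  have e3 : ∫ y, ((inner ℝ (v (mix t x y)) k : ℝ) - inner ℝ m k) ∂μ =
      inner ℝ (∫ y, v (mix t x y) ∂μ) k - inner ℝ m k := by
    rw [integral_sub (hvi.inner_const k) (integrable_const _), hin]; simp
  -- The averaged inequality is used in the direction e^{-t}h, which moves the law started at x to
  -- the law started at x + h; the gradient is compared with `m` only in the direction `k`.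
  have hle : b + inner ℝ m k - c ≤ -(∫ y, (u (mix t x y) - b) ∂μ) +
      ∫ y, (u (mix t (x + ι h) y) - c) ∂μ +
      -(∫ y, ((inner ℝ (v (mix t x y)) k : ℝ) - inner ℝ m k) ∂μ) +
      inner ℝ (∫ y, v (mix t x y) ∂μ) (k - h') := by
    rw [e1, e2, e3, inner_sub_right]
    linarith
  have hnorm : ‖k - h'‖ ≤ ‖h - k‖ + t * ‖h‖ := by
    have h1 : k - h' = -(h - k) + (1 - Real.exp (-t)) • h := by
      rw [hh', sub_smul, one_smul]; abel
    rw [h1]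
    refine (norm_add_le _ _).trans ?_
    rw [norm_neg, norm_smul, Real.norm_of_nonneg
      (sub_nonneg.2 (Real.exp_le_one_iff.2 (by linarith)))]
    gcongr
    linarith [Real.add_one_le_exp (-t)]
  refine (Real.ofReal_le_enorm _ |>.trans' (ENNReal.ofReal_le_ofReal hle)).trans ?_
  refine (enorm_add_le _ _).trans (add_le_add ((enorm_add_le _ _).trans
    (add_le_add ((enorm_add_le _ _).trans (add_le_add ?_ ?_)) ?_)) ?_)
  · rw [enorm_neg]; exact enorm_integral_le_lintegral_enorm _
  · exact enorm_integral_le_lintegral_enorm _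
  · rw [enorm_neg]; exact enorm_integral_le_lintegral_enorm _
  · refine (enorm_real_inner_le _ _).trans ?_
    rw [mul_comm]
    gcongr
    · rw [← ofReal_norm]; exact ENNReal.ofReal_le_ofReal hnorm
    · exact enorm_integral_le_lintegral_enorm _

/-- The subgradient inequality holds between any two regular points. -/
theorem RegularAt.add_inner_le (hW : IsAbstractWienerSpace ι μ) (ha : 0 < a) (hu : Measurable u)
    (hv : StronglyMeasurable v) (hE : Dense E) (hBm : MeasurableSet B)
    (hB : ∀ z ∉ B, ∀ k ∈ E, u z + inner ℝ (v z) k ≤ u (z + ι k)) {x : X} {h : H}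
    (hx : RegularAt μ (gammaMeasure a 1) E B u us v vs x)
    (hy : RegularAt μ (gammaMeasure a 1) E B u us v vs (x + ι h)) :
    us x + inner ℝ (vs x) h ≤ us (x + ι h) := by
  have := hW.isProbabilityMeasure
  have := isProbabilityMeasure_gammaMeasure ha one_pos
  obtain ⟨b, hb, hbv⟩ := hx.bounded
  have hvm : Measurable fun z => ‖v z‖ₑ := hv.enorm
  have hvk : ∀ k : H, Measurable fun z => (inner ℝ (v z) k : ℝ) := fun k =>
    (hv.inner stronglyMeasurable_const).measurable
  have hu2 : Measurable fun z => ‖u z‖ₑ ^ (2 : ℝ) := by fun_prop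
  have hstep : ∀ k ∈ E, us x + inner ℝ (vs x) k - us (x + ι h) ≤ ‖h - k‖ * b.toReal := by
    intro k hk
    have hn : ∀ n, ENNReal.ofReal (us x + inner ℝ (vs x) k - us (x + ι h)) ≤
        pot (unif (scale n)) μ (fun z => ‖u z - us x‖ₑ) x +
        pot (unif (scale n)) μ (fun z => ‖u z - us (x + ι h)‖ₑ) (x + ι h) +
        pot (unif (scale n)) μ (fun z => ‖inner ℝ (v z) k - inner ℝ (vs x) k‖ₑ) x +
        ENNReal.ofReal (‖h - k‖ + scale n * ‖h‖) * b := by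
      intro n
      have := isProbabilityMeasure_unif (scale_pos n)
      have hac := unif_absolutelyContinuous ha (scale n)
      have f1 := hac.ae_le (ae_ae_of_pot_eq_zero hBm hx.avoids)
      have f2 := hac.ae_le (ae_lt_top (measurable_sg_time hu2 x) hx.sq_ne_top)
      have f3 := hac.ae_le (ae_lt_top (measurable_sg_time hu2 (x + ι h)) hy.sq_ne_top)
      have f4 := ae_lt_top (measurable_sg_time hvm x) (ne_top_of_le_ne_top hb (hbv n))
      have m1 : Measurable fun s => sg μ s (fun z => ‖u z - us x‖ₑ) x :=
        measurable_sg_time (by fun_prop) x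
      have m2 : Measurable fun s => sg μ s (fun z => ‖u z - us (x + ι h)‖ₑ) (x + ι h) :=
        measurable_sg_time (by fun_prop) _
      have m3 : Measurable fun s => sg μ s (fun z => ‖inner ℝ (v z) k - inner ℝ (vs x) k‖ₑ) x :=
        measurable_sg_time ((hvk k).sub_const _).enorm x
      calc _ = ∫⁻ _, ENNReal.ofReal (us x + inner ℝ (vs x) k - us (x + ι h)) ∂unif (scale n) := by
            simp
        _ ≤ ∫⁻ t, (sg μ t (fun z => ‖u z - us x‖ₑ) x +
              sg μ t (fun z => ‖u z - us (x + ι h)‖ₑ) (x + ι h) +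
              sg μ t (fun z => ‖inner ℝ (v z) k - inner ℝ (vs x) k‖ₑ) x +
              ENNReal.ofReal (‖h - k‖ + scale n * ‖h‖) * sg μ t (fun z => ‖v z‖ₑ) x)
              ∂unif (scale n) := by
            refine lintegral_mono_ae ?_
            filter_upwards [f1, f2, f3, f4, ae_mem_unif (scale n)] with t g1 g2 g3 g4 g5
            refine (ofReal_add_inner_sub_le hW hu hv hE hB g5.1 g1 g2.ne g3.ne g4.ne
              (us x) (us (x + ι h)) (vs x) k).trans ?_
            gcongr
            exact g5.2
        _ = pot (unif (scale n)) μ (fun z => ‖u z - us x‖ₑ) x +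
            pot (unif (scale n)) μ (fun z => ‖u z - us (x + ι h)‖ₑ) (x + ι h) +
            pot (unif (scale n)) μ (fun z => ‖inner ℝ (v z) k - inner ℝ (vs x) k‖ₑ) x +
            ENNReal.ofReal (‖h - k‖ + scale n * ‖h‖) *
              pot (unif (scale n)) μ (fun z => ‖v z‖ₑ) x := by
            rw [lintegral_add_left (by fun_prop), lintegral_add_left (by fun_prop),
              lintegral_add_left m1, lintegral_const_mul _ (measurable_sg_time hvm x)]
            rfl
        _ ≤ _ := by gcongr; exact hbv n
    have hs : Tendsto (fun n => ENNReal.ofReal (‖h - k‖ + scale n * ‖h‖) * b) atTop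
        (𝓝 (ENNReal.ofReal ‖h - k‖ * b)) := by
      refine ENNReal.Tendsto.mul_const (ENNReal.tendsto_ofReal ?_) (Or.inr hb)
      simpa using (tendsto_scale.mul_const ‖h‖).const_add ‖h - k‖
    have hlim := ((hx.tendsto.add hy.tendsto).add (hx.tendsto_inner k hk)).add hs
    simp only [add_zero, zero_add] at hlim
    have := ge_of_tendsto' hlim hn
    rw [← ENNReal.ofReal_toReal hb, ← ENNReal.ofReal_mul (norm_nonneg _)] at this
    exact (ENNReal.ofReal_le_ofReal_iff (by positivity)).1 this
  -- Letting `k` in `E` tend to `h` removes the error that the bound on averages of ‖v‖ left behind.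
  have hclosed : IsClosed {k : H | us x + inner ℝ (vs x) k - us (x + ι h) ≤
      ‖h - k‖ * b.toReal} := isClosed_le (by fun_prop) (by fun_prop)
  have := hclosed.closure_subset_iff.2 hstep (hE.closure_eq ▸ mem_univ h)
  rw [mem_ofPred_eq, sub_self, norm_zero, zero_mul] at this
  linarith

end RegularPoints

/-! ### The exceptional set has zero capacity. -/

section ExceptionalSet

variable {X : Type*} [NormedAddCommGroup X] [NormedSpace ℝ X] [MeasurableSpace X]
  {H : Type*} [NormedAddCommGroup H] [InnerProductSpace ℝ H] [CompleteSpace H]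
  {ι : H →L[ℝ] X} {μ : Measure X} [BorelSpace X] [CompleteSpace X] [SecondCountableTopology X]

/-- Energies of a lower exponent are controlled by Jensen's inequality, so exponents may be raised
at will. -/
lemma Polar.of_lt [IsProbabilityMeasure μ] {γ : Measure ℝ} {m s : ℝ} (hm : 0 < m) (hms : m < s)
    {A : Set X} (h : Polar μ γ s A) : Polar μ γ m A := by
  intro c hc
  have hs : 0 < s := hm.trans hms
  obtain ⟨O, w, hO, hA, hw, h1, h2⟩ := h (c ^ (s / m)) (by
    rcases eq_or_ne c ⊤ with rfl | hct
    · rw [ENNReal.top_rpow_of_pos (div_pos hs hm)]; simp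
    · exact ENNReal.rpow_pos hc hct)
  refine ⟨O, w, hO, hA, hw, h1, (lintegral_rpow_le_rpow hm hms hw).trans ?_⟩
  calc _ ≤ (c ^ (s / m)) ^ (m / s) := by
        gcongr
    _ = c := by
        have : s / m * (m / s) = 1 := by field_simp
        rw [← ENNReal.rpow_mul, this, ENNReal.rpow_one]

lemma QuasiContinuous.comp_continuous {E E' : Type*} [TopologicalSpace E] [TopologicalSpace E']
    {p : ℝ≥0∞} {α : ℝ} {f : X → E} (hf : QuasiContinuous μ p α f) {φ : E → E'}
    (hφ : Continuous φ) : QuasiContinuous μ p α fun x => φ (f x) := fun δ hδ =>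
  let ⟨O, hO, hcap, hc⟩ := hf δ hδ
  ⟨O, hO, hcap, hφ.comp_continuousOn hc⟩

/-- By density the bound may be tested on `v` itself. -/
lemma enorm_le_of_enorm_inner_le {E : Set H} (hE : Dense E) {b : ℝ≥0∞} {v : H}
    (h : ∀ k ∈ E, ‖(inner ℝ v k : ℝ)‖ₑ ≤ ‖k‖ₑ * b) : ‖v‖ₑ ≤ b := by
  rcases eq_or_ne b ⊤ with rfl | hb
  · exact le_top
  have hclosed : IsClosed {k : H | ‖(inner ℝ v k : ℝ)‖ ≤ ‖k‖ * b.toReal} :=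
    isClosed_le (by fun_prop) (by fun_prop)
  have hmem := hclosed.closure_subset_iff.2 (fun k hk => by
    have := h k hk
    rw [← ofReal_norm, ← ofReal_norm, ← ENNReal.ofReal_toReal hb,
      ← ENNReal.ofReal_mul (norm_nonneg _)] at this
    exact (ENNReal.ofReal_le_ofReal_iff (by positivity)).1 this) (hE.closure_eq ▸ mem_univ v)
  rw [mem_ofPred_eq, real_inner_self_eq_norm_sq, norm_pow, norm_norm, sq] at hmem
  rw [← ofReal_norm, ← ENNReal.ofReal_toReal hb]
  refine ENNReal.ofReal_le_ofReal ?_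
  rcases (norm_nonneg v).eq_or_lt with h0 | h0
  · rw [← h0]; positivity
  · exact le_of_mul_le_mul_left hmem h0

variable {α : ℝ} {p : ℝ≥0∞} {E : Set H} {B : Set X} {u us : X → ℝ} {v vs : X → H}

/-- Quasi-every point is regular for a functional of class `D^{2p}_{2+α}`. -/
theorem polar_not_regularAt (hW : IsAbstractWienerSpace ι μ) (hα : 0 < α) (hp : 2 < p)
    (hp' : p < ⊤) (hu : Measurable u) (hue : us =ᵐ[μ] u) (hqu : QuasiContinuous μ p α us)
    (hD : MemD μ (2 * p) (2 + α) u) (hv : StronglyMeasurable v) (hve : vs =ᵐ[μ] v)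
    (hqv : QuasiContinuous μ p α vs) (hE : Dense E) (hEc : E.Countable)
    (hEr : E ⊆ range (dualVec ι))
    (hd : ∀ k, ShiftDeriv ι μ k u (fun x => inner ℝ (v x) k) ∧
      ∫⁻ x, ‖(inner ℝ (v x) k : ℝ)‖ₑ ^ (2 : ℝ) ∂μ ≠ ⊤)
    (hBm : MeasurableSet B) (hB0 : μ B = 0) :
    Polar μ (gammaMeasure (α / 2) 1) p.toReal
      {x | ¬ RegularAt μ (gammaMeasure (α / 2) 1) E B u us v vs x} := by
  have ha : 0 < α / 2 := half_pos hα
  set a := α / 2 with ha_def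
  have := hW.isProbabilityMeasure
  have := isProbabilityMeasure_gammaMeasure ha one_pos
  set γ := gammaMeasure a 1 with hγ
  have hp1 : 1 < p := lt_trans (by norm_num) hp
  have hr1 : 1 < p.toReal := one_lt_toReal hp1 hp'
  have hr : 0 < p.toReal := by linarith
  have hvk : ∀ k : H, Measurable fun z => (inner ℝ (v z) k : ℝ) := fun k =>
    (hv.inner stronglyMeasurable_const).measurable
  have hvm : Measurable fun z => ‖v z‖ₑ := hv.enorm
  have hu2 : Measurable fun z => ‖u z‖ₑ ^ (2 : ℝ) := by fun_prop
  obtain ⟨happ, g, hgm, hgi, hg⟩ := potApprox_of_memD hW hα hp hp' hu hD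
  set w : X → ℝ≥0∞ := fun z => ENNReal.ofReal a⁻¹ * (1 + ‖g z‖ₑ ^ (2 : ℝ)) with hw_def
  have hwm : Measurable w := by fun_prop
  have hwi : ∫⁻ x, w x ^ p.toReal ∂μ ≠ ⊤ := by
    refine ne_top_of_le_ne_top ?_ (lintegral_mono (g := fun x => ENNReal.ofReal a⁻¹ ^ p.toReal *
      (2 ^ (p.toReal - 1) * (1 + ‖g x‖ₑ ^ (2 * p.toReal)))) fun x => ?_)
    · rw [lintegral_const_mul _ (by fun_prop), lintegral_const_mul _ (by fun_prop),
        lintegral_add_left (by fun_prop)]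
      refine ENNReal.mul_ne_top (ENNReal.rpow_ne_top_of_nonneg hr.le (by simp))
        (ENNReal.mul_ne_top (ENNReal.rpow_ne_top_of_nonneg (by linarith) (by simp)) ?_)
      simpa using hgi
    · dsimp only [w]
      rw [ENNReal.mul_rpow_of_nonneg _ _ hr.le, ENNReal.rpow_mul]
      gcongr
      simpa using ENNReal.rpow_add_le_mul_rpow_add_rpow 1 (‖g x‖ₑ ^ (2 : ℝ)) hr1.le
  -- With parameter ‖k‖⁻¹ the weight for direction k equals ‖k‖ · `w`. The bound is then linear in
  -- k, and running over countable `E` bounds the norm of the whole gradient.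
  have hvw : ∀ᵐ x ∂μ, ‖v x‖ₑ ≤ pot γ μ w x := by
    have h1 : ∀ᵐ x ∂μ, ∀ k ∈ E, ‖(inner ℝ (v x) k : ℝ)‖ₑ ≤ ‖k‖ₑ * pot γ μ w x := by
      rw [ae_ball_iff hEc]
      intro k hk
      obtain ⟨ℓ, rfl⟩ := hEr hk
      rcases eq_or_ne (dualVec ι ℓ) 0 with h0 | h0
      · simp [h0]
      have hk0 : ‖dualVec ι ℓ‖ₑ ≠ 0 := by simpa using h0
      have hkt : ‖dualVec ι ℓ‖ₑ ≠ ⊤ := by simp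
      filter_upwards [(hg ℓ _ (hvk _) (hd _).2 (hd _).1).2 ‖dualVec ι ℓ‖ₑ⁻¹
        (ENNReal.inv_ne_zero.2 hkt) (ENNReal.inv_ne_top.2 hk0)] with x hx
      rw [← pot_const_mul hwm]
      refine hx.trans (pot_mono (fun z => le_of_eq ?_) x)
      rw [derivWeight, hw_def, inv_inv, ENNReal.rpow_two, sq, ← mul_assoc,
        ENNReal.inv_mul_cancel hk0 hkt, one_mul]
      ring
    filter_upwards [h1] with x hx
    exact enorm_le_of_enorm_inner_le hE hx
  obtain ⟨M, hMsub, hMm, hM0⟩ := exists_measurable_superset_of_null hvw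
  have hind : ∀ {A : Set X}, μ A = 0 → A.indicator (1 : X → ℝ≥0∞) =ᵐ[μ] 0 := fun hA =>
    indicator_meas_zero hA
  have hMi : Measurable (M.indicator (1 : X → ℝ≥0∞)) := measurable_one.indicator hMm
  have c1 := polar_not_tendsto_pot_unif hW hα hp1 hp' hu hue hqu happ
  have c2 : ∀ k ∈ E, Polar μ γ p.toReal {x | ¬ Tendsto (fun n => pot (unif (scale n)) μ
      (fun z => ‖inner ℝ (v z) k - inner ℝ (vs x) k‖ₑ) x) atTop (𝓝 0)} := by
    intro k hk
    obtain ⟨ℓ, rfl⟩ := hEr hk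
    refine polar_not_tendsto_pot_unif hW hα hp1 hp' (hvk _)
      (us := fun x => inner ℝ (vs x) (dualVec ι ℓ)) ?_
      (hqv.comp_continuous (φ := fun z => inner ℝ z (dualVec ι ℓ)) (by fun_prop))
      (hg ℓ _ (hvk _) (hd _).2 (hd _).1).1
    filter_upwards [hve] with x hx
    rw [hx]
  have c3 : Polar μ γ p.toReal {x | pot γ μ w x = ⊤} := polar_pot_eq_top hr hwm hwi
  have c4 : Polar μ γ p.toReal {x | pot γ μ (M.indicator 1) x ≠ 0} :=
    polar_pot_ne_zero hr hMi (hind hM0)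
  have c5 : Polar μ γ p.toReal {x | pot γ μ (B.indicator 1) x ≠ 0} :=
    polar_pot_ne_zero hr (measurable_one.indicator hBm) (hind hB0)
  have c6 : Polar μ γ p.toReal {x | pot γ μ (fun z => ‖u z‖ₑ ^ (2 : ℝ)) x = ⊤} := by
    refine polar_pot_eq_top hr hu2 ?_
    simp_rw [← ENNReal.rpow_mul]
    have h2p : (2 * p).toReal = 2 * p.toReal := by simp
    rw [← h2p]
    refine (lintegral_rpow_enorm_lt_top_of_eLpNorm_lt_top ?_ ?_ hD.1.2).ne
    · exact mul_ne_zero (by simp) (pos_of_gt hp1).ne'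
    · exact ENNReal.mul_ne_top (by simp) hp'.ne
  refine (((((c1.union hr (Polar.biUnion hr hEc c2)).union hr c3).union hr c4).union hr c5).union
    hr c6).mono fun x hx => ?_
  by_contra hn
  simp only [mem_union, mem_iUnion, mem_ofPred_eq, not_or, not_exists, not_not] at hn
  obtain ⟨⟨⟨⟨⟨h1, h2⟩, h3⟩, h4⟩, h5⟩, h6⟩ := hn
  refine hx ⟨h1, h2, ?_, h5, h6⟩
  refine ⟨ENNReal.ofReal (domConst a) * pot γ μ w x, ENNReal.mul_ne_top (by simp) h3, fun n => ?_⟩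
  have := isProbabilityMeasure_unif (scale_pos n)
  -- On the null set `M` the bound may fail; there the weight ∞ is added, which the averages from
  -- `x` do not see.
  have hz : pot (unif (scale n)) μ (fun z => ⊤ * M.indicator (1 : X → ℝ≥0∞) z) x = 0 := by
    rw [pot_const_mul hMi, mul_eq_zero]
    right
    rw [pot, lintegral_eq_zero_iff (measurable_sg_time hMi x)] at h4 ⊢
    exact (unif_absolutelyContinuous ha _).ae_le h4
  calc pot (unif (scale n)) μ (fun z => ‖v z‖ₑ) x
      ≤ pot (unif (scale n)) μ (fun z => pot γ μ w z + ⊤ * M.indicator (1 : X → ℝ≥0∞) z) x := by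
        refine pot_mono (fun z => ?_) x
        by_cases hz : z ∈ M
        · simp [hz]
        · have : ‖v z‖ₑ ≤ pot γ μ w z := by
            by_contra hc
            exact hz (hMsub hc)
          exact this.trans le_self_add
    _ = pot (unif (scale n)) μ (pot γ μ w) x := by
        rw [pot_add (measurable_pot hwm), hz, add_zero]
    _ ≤ _ := pot_unif_pot_le hW ha (scale_pos n) (scale_le_one n) hwm x

lemma MemD.congr_ae {f f' : X → ℝ} (h : MemD μ p α f) (hf : f =ᵐ[μ] f') : MemD μ p α f' :=
  let ⟨g, hg, hfg⟩ := h.2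
  ⟨(memLp_congr_ae hf).1 h.1, g, hg, hf.symm.trans hfg⟩

/-- A quasi-continuous `H`-convex functional satisfies the subgradient inequality outside a set of
zero capacity. -/
theorem exists_capacity_eq_zero_subgradient [TopologicalSpace.SeparableSpace H]
    (hW : IsAbstractWienerSpace ι μ) (hα : 0 < α) {F : X → ℝ} (hF : MemDInf μ (2 + α) F)
    (hconv : HConvex ι μ F) {K : X → HTensor H} (hred : IsRedefinition ι μ α F us vs K) :
    ∃ N : Set X, (∀ p : ℝ≥0∞, 1 < p → p < ⊤ → capacity μ p α N = 0) ∧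
      ∀ x ∉ N, ∀ h : H, x + ι h ∉ N → us x + inner ℝ (vs x) h ≤ us (x + ι h) := by
  have := hW.isProbabilityMeasure
  have hder := hred.derivs 2 (by norm_num) (by simp)
  have : SecondCountableTopology H := UniformSpace.secondCountable_of_separable H
  -- Directions are taken among representatives of functionals, where the derivative formula for
  -- Bessel potentials is available.
  obtain ⟨E, hEr, hEc, hE⟩ := Dense.exists_countable_dense_subset
    (hW.denseRange_dualVec : Dense (range (dualVec ι)))
  set u : X → ℝ := hconv.1.mk F with hu_def
  have hu : Measurable u := hconv.1.measurable_mk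
  have huF : F =ᵐ[μ] u := hconv.1.ae_eq_mk
  set v : X → H := hder.memLp_grad.1.mk vs with hv_def
  have hv : StronglyMeasurable v := hder.memLp_grad.1.stronglyMeasurable_mk
  have hve : vs =ᵐ[μ] v := hder.memLp_grad.1.ae_eq_mk
  have hvk : ∀ k : H, Measurable fun z => (inner ℝ (v z) k : ℝ) := fun k =>
    (hv.inner stronglyMeasurable_const).measurable
  have hd : ∀ k, ShiftDeriv ι μ k u (fun x => inner ℝ (v x) k) ∧
      ∫⁻ x, ‖(inner ℝ (v x) k : ℝ)‖ₑ ^ (2 : ℝ) ∂μ ≠ ⊤ := by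
    refine fun k => hder.shiftDeriv hW k hu (hvk k) huF.symm ?_
    filter_upwards [hve] with x hx
    rw [hx]
  have hsub : ∀ᵐ x ∂μ, ∀ k ∈ E, u x + inner ℝ (v x) k ≤ u (x + ι k) := by
    rw [ae_ball_iff hEc]
    exact fun k _ => hconv.ae_add_le hW huF.symm (hvk k) (hd k).1 (hd k).2
  obtain ⟨B, hBsub, hBm, hB0⟩ := exists_measurable_superset_of_null hsub
  have hB : ∀ z ∉ B, ∀ k ∈ E, u z + inner ℝ (v z) k ≤ u (z + ι k) := fun z hz => by
    by_contra hc
    exact hz (hBsub hc)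
  have hpol : ∀ p : ℝ≥0∞, 2 < p → p < ⊤ → Polar μ (gammaMeasure (α / 2) 1) p.toReal
      {x | ¬ RegularAt μ (gammaMeasure (α / 2) 1) E B u us v vs x} := by
    intro p hp hp'
    have hp1 : 1 < p := lt_trans (by norm_num) hp
    have h2p : 1 < 2 * p := hp1.trans_le (le_mul_of_one_le_left zero_le (by norm_num))
    exact polar_not_regularAt hW hα hp hp' hu (hred.ae_eq.trans huF) (hred.quasi p hp1 hp')
      ((hF (2 * p) h2p (ENNReal.mul_lt_top (by simp) hp')).congr_ae huF) hv hve
      (hred.quasi_grad p hp1 hp') hE hEc hEr hd hBm hB0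
  -- Regularity does not mention p, so one set serves all exponents.
  refine ⟨{x | ¬ RegularAt μ (gammaMeasure (α / 2) 1) E B u us v vs x}, fun p hp hp' => ?_,
    fun x hx h hy => ?_⟩
  · refine Polar.capacity_eq_zero hW hα hp hp' ?_
    -- Polarity is known for exponents above 2; it is applied at p + 2 and lowered to p.
    have h3 : 2 < p + 2 := by
      calc (2 : ℝ≥0∞) = 0 + 2 := by simp
        _ < p + 2 := ENNReal.add_lt_add_right (by simp) (pos_of_gt hp)
    refine (hpol (p + 2) h3 (ENNReal.add_lt_top.2 ⟨hp', by simp⟩)).of_lt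
      (by linarith [one_lt_toReal hp hp']) ?_
    rw [ENNReal.toReal_add hp'.ne (by simp)]
    simp
  · simp only [mem_ofPred_eq, not_not] at hx hy
    exact hx.add_inner_le hW (half_pos hα) hu hv hE hBm hB hy

end ExceptionalSet

/-! ### Geometry of the ball that touches a level set. -/

section Normal

variable {X : Type*} [NormedAddCommGroup X] [NormedSpace ℝ X]
  {H : Type*} [NormedAddCommGroup H] [InnerProductSpace ℝ H] {ι : H →L[ℝ] X}

/-- Nonzero vectors that stay within distance `r` of `r η` have a positive component along `η`. -/
lemma inner_pos_of_norm_sub_le {g h : H} (hg : g ≠ 0) (hh : h ≠ 0) {r : ℝ} (hr : 0 < r)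
    (hle : ‖h - r • (‖g‖⁻¹ • g)‖ ≤ r) : 0 < (inner ℝ g h : ℝ) := by
  have hg' : 0 < ‖g‖ := norm_pos_iff.2 hg
  have hh' : 0 < ‖h‖ := norm_pos_iff.2 hh
  have h1 : ‖h - r • (‖g‖⁻¹ • g)‖ ^ 2 = ‖h‖ ^ 2 - 2 * (r * ‖g‖⁻¹ * inner ℝ g h) + r ^ 2 := by
    rw [norm_sub_sq_real, smul_smul, real_inner_smul_right, norm_smul, real_inner_comm h g]
    rw [Real.norm_of_nonneg (by positivity), mul_assoc r ‖g‖⁻¹ ‖g‖, inv_mul_cancel₀ hg'.ne', mul_one]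
  have h2 : ‖h - r • (‖g‖⁻¹ • g)‖ ^ 2 ≤ r ^ 2 := by gcongr
  -- Comparing the two previous facts gives ‖h‖² ≤ 2r⟨g/‖g‖, h⟩.
  have h3 : 0 < r * ‖g‖⁻¹ * inner ℝ g h := by nlinarith [pow_pos hh' 2]
  exact (pos_iff_pos_of_mul_pos h3).1 (by positivity)

/-- Under the subgradient inequality, the `H`-ball that touches the level set of `F` at `x` from
outside meets it in no other point. -/
lemma eq_of_mem_hBall {F : X → ℝ} {G : X → H} {x y : X} {r : ℝ} (hr : 0 < r)
    (hG : G x ≠ 0) (hxy : F x = F y)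
    (hsub : ∀ h, y = x + ι h → F x + inner ℝ (G x) h ≤ F y)
    (hy : y ∈ hBall ι (x + ι (r • unitNormal G x)) r) : y = x := by
  obtain ⟨k, hk, rfl⟩ := hy
  set h : H := r • unitNormal G x + k with hh
  have hyh : x + ι (r • unitNormal G x) + ι k = x + ι h := by rw [hh, map_add, add_assoc]
  rcases eq_or_ne h 0 with h0 | h0
  · rw [hyh, h0, map_zero, add_zero]
  have h1 := hsub h hyh
  have h2 : 0 < (inner ℝ (G x) h : ℝ) := by
    refine inner_pos_of_norm_sub_le hG h0 hr ?_
    rwa [hh, unitNormal, add_sub_cancel_left]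
  linarith

lemma norm_unitNormal {G : X → H} {x : X} (hG : G x ≠ 0) : ‖unitNormal G x‖ = 1 := by
  rw [unitNormal, norm_smul, norm_inv, norm_norm, inv_mul_cancel₀ (norm_ne_zero_iff.2 hG)]

end Normal

end WienerTube

end

/-! ### Conclusion: disjointness and injectivity outside the exceptional set. -/

theorem mainTheorem9 {X H : Type*}
    [NormedAddCommGroup X] [NormedSpace ℝ X] [CompleteSpace X] [MeasurableSpace X] [BorelSpace X]
    [NormedAddCommGroup H] [InnerProductSpace ℝ H] [CompleteSpace H]
    [TopologicalSpace.SeparableSpace H]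
    (ι : H →L[ℝ] X) (μ : Measure X) (hW : WienerTube.IsAbstractWienerSpace ι μ)
    (D : Set H) (hDc : D.Countable) (hDd : Dense D)
    (ε : ℝ) (hε : 0 < ε)
    (F : X → ℝ) (hF : WienerTube.MemDInf μ (2 + ε) F) (hconv : WienerTube.HConvex ι μ F)
    (Fs : X → ℝ) (G : X → H) (K : X → WienerTube.HTensor H)
    (hred : WienerTube.IsRedefinition ι μ ε F Fs G K) :
    ∃ N : Set X, (∀ p : ℝ≥0∞, 1 < p → p < ⊤ → WienerTube.capacity μ p ε N = 0) ∧
      ∀ u r : ℝ, 0 < r →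
        InjOn (fun x => x + ι (r • WienerTube.unitNormal G x))
          ((WienerTube.smoothPoints ι D Fs G K ∩ WienerTube.bdry Fs u) \ N) ∧
        ∀ x ∈ (WienerTube.smoothPoints ι D Fs G K ∩ WienerTube.bdry Fs u) \ N,
          {y ∈ (WienerTube.smoothPoints ι D Fs G K ∩ WienerTube.bdry Fs u) \ N |
            y ≠ x ∧ y ∈ WienerTube.hBall ι (x + ι (r • WienerTube.unitNormal G x)) r} = ∅ := by
  have := hW.secondCountableTopology
  obtain ⟨N, hN, hsub⟩ :=
    WienerTube.exists_capacity_eq_zero_subgradient hW hε hF hconv hred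
  have key : ∀ u r : ℝ, 0 < r →
      ∀ x ∈ (WienerTube.smoothPoints ι D Fs G K ∩ WienerTube.bdry Fs u) \ N,
      ∀ y ∈ (WienerTube.smoothPoints ι D Fs G K ∩ WienerTube.bdry Fs u) \ N,
      y ∈ WienerTube.hBall ι (x + ι (r • WienerTube.unitNormal G x)) r → y = x := by
    rintro u r hr x ⟨⟨hx, hxu⟩, hxN⟩ y ⟨⟨-, hyu⟩, hyN⟩ hmem
    refine WienerTube.eq_of_mem_hBall hr hx.1 (hxu.trans hyu.symm) (fun h hh => ?_) hmem
    subst hh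
    exact hsub x hxN h hyN
  refine ⟨N, hN, fun u r hr => ⟨fun x hx y hy hxy => ?_, fun x hx => ?_⟩⟩
  -- If the end points agree, then y = (x + rη_x) - rη_y, so y lies on the sphere of radius r about
  -- the end point of x.
  · refine (key u r hr x hx y hy ⟨-(r • WienerTube.unitNormal G y), ?_, ?_⟩).symm
    · rw [norm_neg, norm_smul, WienerTube.norm_unitNormal hy.1.1.1, mul_one,
        Real.norm_of_nonneg hr.le]
    · dsimp only at hxy
      rw [hxy, map_neg, add_neg_cancel_right]
  · refine eq_empty_of_forall_notMem ?_
    rintro y ⟨hy, hne, hmem⟩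
    exact hne (key u r hr x hx y hy hmem)
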